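/- **Setting.** A convex $0/1$-polyhedral set is a polytope $\Omega\subseteq\mathbb{R}^d$ whose vertex set $\mathcal V_\Omega$ is a nonempty subset of $\{0,1\}^d$. Its kernel is $K_\Omega(x,y)=\sum_{v\in\mathcal V_\Omega}\prod_{k:v[k]=1}x[k]\,y[k]$. Let $\mathbf 1$ be the all-ones vector, let $\bar e_i$ be $\mathbf 1$ with coordinate $i$ set to $0$, and $\bar e_{ij}$ be $\mathbf 1$ with coordinates $i,j$ set to $0$. The regret of actions $x^1,\dots,x^T\in\Omega$ against utilities $\nu^1,\dots,\nu^T\in\mathbb{R}^d$ is $\max_{x^*\in\Omega}\sum_{t\le T}\langle\nu^t,x^*\rangle-\sum_{t\le T}\langle\nu^t,x^t\rangle$. **The algorithm KDLRC-OMWU** has parameters $n\ge1$ (players), $L>0$ (smoothness), $N\ge|\mathcal V_\Omega|$ (for instance $N=|\mathcal V_\Omega|$, or the maximum of the numbers of vertices over the players), $\beta\ge 70$ and a horizon $T$. Put $$\alpha=2+2\log N+\beta\log^2N,\qquad \eta=\min\Big\{\tfrac1{50},\tfrac1{12\sqrt2\,Ln}\Big\},\qquad \lambda^0=\eta,\ \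 \nu^0=x^0=0 .$$ In round $t$ let $\mu^t=\nu^{t-1}+\sum_{\tau<t}\nu^\tau$, $\sigma^t=-\langle\nu^{t-1},x^{t-1}\rangle-\sum_{\tau<t}\langle\nu^\tau,x^\tau\rangle$, and $\mathcal R^t[v]=\langle\mu^t,v\rangle+\sigma^t$ for $v\in\mathcal V_\Omega$; let $$f(\lambda)=(\alpha-1)\log\lambda+\log\sum_{v\in\mathcal V_\Omega}e^{\lambda\mathcal R^t[v]} .$$ 1. *Learning rate.* Starting from $\lambda=\lambda^{t-1}$, repeat the Newton step $\lambda\leftarrow\lambda'=\min\{\eta,\ \lambda-f'(\lambda)/f''(\lambda)\}$ until $|\lambda'-\lambda|\le\lambda'/T$; the last $\lambda'$ is $\lambda^t$. Here $f'(\lambda)=\langle\mu^t,\mathbb E[v]\rangle+\sigma^t+\frac{\alpha-1}\lambda$ and $f''(\lambda)=(\mu^t)^\top\mathbb E[vv^\top]\mu^t-\langle\mu^t,\mathbb E[v]\rangle^2-\frac{\alpha-1}{\lambda^2}$ are computed from $b[k]=e^{\lambda\mu^t[k]}$ through $$\mathbb E[v]_i=\mathbb E[vv^\top]_{ii}=1-\tfrac{K_\Omega(b,\bar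 e_i)}{K_\Omega(b,\mathbf 1)},\qquad \mathbb E[vv^\top]_{ij}=1-\tfrac{K_\Omega(b,\bar e_i)}{K_\Omega(b,\mathbf 1)}-\tfrac{K_\Omega(b,\bar e_j)}{K_\Omega(b,\mathbf 1)}+\tfrac{K_\Omega(b,\bar e_{ij})}{K_\Omega(b,\mathbf 1)}\quad(i\ne j).$$ 2. *Action.* With $b^t[k]=e^{\lambda^t\mu^t[k]}$ play $x^t[i]=1-K_\Omega(b^t,\bar e_i)/K_\Omega(b^t,\mathbf 1)$ and observe $\nu^t$. 3. *Safeguard.* If for some round $s$ already completed $$\sum_{\tau=1}^{s-1}\max_{v\in\mathcal V_\Omega}\langle\nu^{\tau+1}-\nu^\tau,v\rangle^2>144L^2n^2\eta+48L^2n^2(\alpha\log s+\log N),$$ then from the next round on the player runs (kernelized) multiplicative weights with constant learning rate $\sqrt{\log N/T}$ on the utilities observed after that round, i.e. plays as in step 2 with that learning rate and with $\mu$ the sum of those utilities. (The maximum in this test is a linear optimization over $\Omega$, not a kernel evaluation.) **Games.** In an $n$-player convex $0/1$-polyhedral game player $i$ has a $0/1$-polyhedral strategy set $\Omega_i\subseteq\mathbb{R}^{d_i}$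 and a utility that is multilinear in $(x_1,\dots,x_n)$; its feedback vector is the gradient $\nu_i=\nabla_{x_i}u_i(x)$. Assume that (i) $|u_i|\le1$ on all profiles of vertices, (ii) the game is $L$-smooth on the simplices over the vertices: for all profiles $\chi,\chi'$ of distributions $\chi_j,\chi'_j$ on $\mathcal V_{\Omega_j}$ with means $x,x'$, and all $i$, $\max_{v\in\mathcal V_{\Omega_i}}|\langle\nabla_{x_i}u_i(x)-\nabla_{x_i}u_i(x'),v\rangle|\le L\sum_j\|\chi_j-\chi_j'\|_1$. **Statement.** For every $\beta\ge70$ there is a constant $C>0$, depending only on $\beta$, such that for all $n\ge1$, $L>0$, $N$ and $T\ge3$: * **Self-play.** If all players of such a game with $|\mathcal V_{\Omega_i}|\le N$ for all $i$ follow KDLRC-OMWU, then no player ever switches in the rounds $1,\dots,T$, and the regret of each player is at most $$C\,(1+Ln)\,\log^2N\,\log T\qquad(\text{which is } O(n\log^2 N\log T)).$$ * **Adversarial utilities.** For every convex $0/1$-polyhedral $\Omega\subseteq\mathbb{R}^d$ with $|\mathcal V_\Omega|\le N$ and every sequence $\nu^t\in\mathbb{R}^d$ with $|\langle\nu^t,v\rangle|\le1$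 for all $v\in\mathcal V_\Omega$, the regret of a player who follows KDLRC-OMWU is at most $$C\big(\sqrt{T\log N}+(1+Ln)\log^2N\,\log T\big)\qquad(\text{which is }\widetilde O(\sqrt{T\log N})).$$ * **Kernel evaluations.** In both settings, in each of the rounds $1,\dots,T$ a player with strategy set in $\mathbb{R}^d$ makes exactly $(d+1)+(d^2+1)\,k$ kernel evaluations for some integer $0\le k\le C\log\log T$: $d+1$ of them for the action and $(d^2+1)k$ for the learning rate. Moreover, in each round before a switch, $f$ has a unique maximizer $\hat\lambda$ over $(0,\eta]$, $|\lambda^t-\hat\lambda|\le\hat\lambda/T$, and $x^t=\sum_v\chi^t[v]\,v$ with $\chi^t[v]=e^{\lambda^t\mathcal R^t[v]}/\sum_{v'}e^{\lambda^t\mathcal R^t[v']}$. -/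

import Mathlib

open Finset
open scoped BigOperators Matrix

noncomputable section

/-! ### Convex 0/1-polyhedral sets and their kernel -/

/-- A (nonempty) convex 0/1-polyhedral set in `ℝ^d`, given by its finite set `𝒱_Ω` of vertices.
Any nonempty set of 0/1 vectors is exactly the vertex set of its convex hull
(`ZeroOnePolytope.extremePoints_carrier`). -/
structure ZeroOnePolytope (d : ℕ) where
  verts : Finset (Fin d → ℝ)
  nonempty : verts.Nonempty
  zero_one : ∀ v ∈ verts, ∀ k, v k = 0 ∨ v k = 1

namespace ZeroOnePolytope

variable {d : ℕ} (Ω : ZeroOnePolytope d)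

/-- The polytope `Ω` itself. -/
def carrier : Set (Fin d → ℝ) := convexHull ℝ (Ω.verts : Set (Fin d → ℝ))

theorem extremePoints_carrier :
    Ω.carrier.extremePoints ℝ = (Ω.verts : Set (Fin d → ℝ)) := by
  refine Set.Subset.antisymm extremePoints_convexHull_subset ?_
  intro v hv
  have hcube : Ω.carrier ⊆ Set.univ.pi (fun _ : Fin d => Set.Icc (0 : ℝ) 1) := by
    refine convexHull_min ?_ (convex_pi fun _ _ => convex_Icc 0 1)
    intro w hw k _
    rcases Ω.zero_one w hw k with h | h <;> simp [h]
  refine inter_extremePoints_subset_extremePoints_of_subset hcube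
    ⟨subset_convexHull ℝ _ hv, ?_⟩
  rw [extremePoints_pi]
  intro k _
  rw [mem_extremePoints_iff_left]
  constructor
  · rcases Ω.zero_one v hv k with h | h <;> simp [h]
  · rintro a ha b hb ⟨s, t, hs, ht, hst, hab⟩
    simp only [smul_eq_mul] at hab
    obtain ⟨ha0, ha1⟩ := ha
    obtain ⟨hb0, hb1⟩ := hb
    rcases Ω.zero_one v hv k with h | h
    · rw [h] at hab ⊢
      nlinarith [mul_nonneg hs.le ha0, mul_nonneg ht.le hb0]
    · rw [h] at hab ⊢
      nlinarith [mul_nonneg hs.le (sub_nonneg.2 ha1), mul_nonneg ht.le (sub_nonneg.2 hb1)]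

/-- The 0/1-polyhedral feature map `φ_Ω(x)[v] = ∏_{k : v[k] = 1} x[k]`. -/
def feature (x v : Fin d → ℝ) : ℝ := ∏ k ∈ univ.filter (fun k => v k = 1), x k

/-- The 0/1-polyhedral kernel `K_Ω(x, y) = ⟨φ_Ω(x), φ_Ω(y)⟩`. -/
def kernel (x y : Fin d → ℝ) : ℝ := ∑ v ∈ Ω.verts, feature x v * feature y v

/-- The sup norm of the utility that the linear functional `c` induces on the vertices:
`max_{v ∈ 𝒱_Ω} |⟨c, v⟩|`. -/
def utilityNorm (c : Fin d → ℝ) : ℝ := Ω.verts.sup' Ω.nonempty fun v => |c ⬝ᵥ v|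

/-- The external regret after `T` rounds with utilities `ν 0, …, ν (T-1)` and actions
`x 0, …, x (T-1)`, against the best fixed point of `Ω` in hindsight. -/
def regret (ν x : ℕ → Fin d → ℝ) (T : ℕ) : ℝ :=
  sSup ((fun z => ∑ t ∈ range T, ν t ⬝ᵥ z) '' Ω.carrier) - ∑ t ∈ range T, ν t ⬝ᵥ x t

/-- The learning rate control objective
`f(lam; R) = (α - 1) log lam + log ∑_{v ∈ 𝒱_Ω} exp (lam R[v])`. -/
def rateObjective (α : ℝ) (R : (Fin d → ℝ) → ℝ) (lam : ℝ) : ℝ :=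
  (α - 1) * Real.log lam + Real.log (∑ v ∈ Ω.verts, Real.exp (lam * R v))

/-- The softmax weights `χ[v] = exp (lam R[v]) / ∑_{v'} exp (lam R[v'])` on the vertices. -/
def softmax (R : (Fin d → ℝ) → ℝ) (lam : ℝ) (v : Fin d → ℝ) : ℝ :=
  Real.exp (lam * R v) / ∑ w ∈ Ω.verts, Real.exp (lam * R w)

end ZeroOnePolytope

/-! ### Programs with kernel evaluations

A `KernelProg d α` is a computation with exact real arithmetic that returns an element of `α` and
that can access the polytope only through evaluations of its kernel. -/

inductive KernelProg (d : ℕ) (α : Type) : Type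
  | ret (a : α) : KernelProg d α
  | query (x y : Fin d → ℝ) (next : ℝ → KernelProg d α) : KernelProg d α

namespace KernelProg

variable {d : ℕ} {α γ : Type}

/-- The result of a program, when the queries are answered by the kernel `K`. -/
def value (K : (Fin d → ℝ) → (Fin d → ℝ) → ℝ) : KernelProg d α → α
  | ret a => a
  | query x y next => value K (next (K x y))

/-- The number of kernel evaluations of a program, when the queries are answered by `K`. -/
def evals (K : (Fin d → ℝ) → (Fin d → ℝ) → ℝ) : KernelProg d α → ℕ
  | ret _ => 0
  | query x y next => evals K (next (K x y)) + 1

def bind : KernelProg d α → (α → KernelProg d γ) → KernelProg d γ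
  | ret a, f => f a
  | query x y next, f => query x y fun r => bind (next r) f

/-- Run `m` programs one after the other and collect their results. -/
def collect : (m : ℕ) → (Fin m → KernelProg d α) → KernelProg d (Fin m → α)
  | 0, _ => ret Fin.elim0
  | m + 1, p =>
      bind (p 0) fun a =>
        bind (collect m fun i => p i.succ) fun as => ret (Fin.cons a as)

end KernelProg

/-! ### The algorithm KDLRC-OMWU -/

/-- The parameters of the algorithm: the number `n` of players, the smoothness `L` of the game,
a bound `N` on the number of vertices, the constant `β`, the horizon `T`, and a cap `M` on the
number of passes through the Newton loop. -/
structure KDLRCParams where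
  n : ℕ
  L : ℝ
  N : ℕ
  β : ℝ
  T : ℕ
  M : ℕ

namespace KDLRCParams

variable (P : KDLRCParams)

def α : ℝ := 2 + 2 * Real.log P.N + P.β * Real.log P.N ^ 2

/-- The maximal learning rate. -/
def η : ℝ := min (1 / 50) (1 / (12 * √2 * P.L * P.n))

/-- The largest sum of squared variations of `s` consecutive utilities that is consistent with
self-play; once it is exceeded, the player switches to multiplicative weights. -/
def threshold (s : ℕ) : ℝ :=
  144 * P.L ^ 2 * (P.n : ℝ) ^ 2 * P.η
    + 48 * P.L ^ 2 * (P.n : ℝ) ^ 2 * (P.α * Real.log s + Real.log P.N)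

/-- The constant learning rate of multiplicative weights after the switch. -/
def fallbackRate : ℝ := √(Real.log P.N / P.T)

end KDLRCParams

/-- The memory of a player. -/
structure KDLRCState (d : ℕ) where
  /-- the number of completed rounds -/
  rounds : ℕ
  /-- `∑ ν^τ` over the completed rounds -/
  cumUtil : Fin d → ℝ
  /-- `- ∑ ⟨ν^τ, x^τ⟩` over the completed rounds -/
  cumCorr : ℝ
  /-- the utility of the last round (zero at the start) -/
  lastUtil : Fin d → ℝ
  /-- the action of the last round (zero at the start) -/
  lastAction : Fin d → ℝ
  /-- the learning rate of the last round -/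
  rate : ℝ
  /-- the sum of the squared variations of the utilities -/
  variation : ℝ
  /-- whether the player has switched to multiplicative weights -/
  switched : Prop
  /-- the sum of the utilities since the switch -/
  fallbackUtil : Fin d → ℝ

namespace KDLRC

variable {d : ℕ}

/-- `ē_i`, the indicator of `k ≠ i`. -/
def eBar (i : Fin d) : Fin d → ℝ := fun k => if k = i then 0 else 1

/-- `ē_{ij}`, the indicator of `k ≠ i ∧ k ≠ j`. -/
def eBar₂ (i j : Fin d) : Fin d → ℝ := fun k => if k = i ∨ k = j then 0 else 1

/-- The vector `b[k] = exp (lam μ[k])`. -/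
def bVec (lam : ℝ) (μ : Fin d → ℝ) : Fin d → ℝ := fun k => Real.exp (lam * μ k)

/-- The mean `𝔼[v]` of a vertex drawn with weights proportional to `φ_Ω(b)`. -/
def meanProgram (b : Fin d → ℝ) : KernelProg d (Fin d → ℝ) :=
  .query b (fun _ => 1) fun k₀ =>
    (KernelProg.collect d fun i => .query b (eBar i) .ret).bind fun k₁ =>
      .ret fun i => 1 - k₁ i / k₀

/-- The moments `𝔼[v]` and `𝔼[v vᵀ]` of a vertex drawn with weights proportional to `φ_Ω(b)`. -/
def momentProgram (b : Fin d → ℝ) :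
    KernelProg d ((Fin d → ℝ) × Matrix (Fin d) (Fin d) ℝ) :=
  .query b (fun _ => 1) fun k₀ =>
    (KernelProg.collect d fun i => .query b (eBar i) .ret).bind fun k₁ =>
      (KernelProg.collect d fun i => KernelProg.collect d fun j =>
          if i = j then .ret 0 else .query b (eBar₂ i j) .ret).bind fun k₂ =>
        .ret (fun i => 1 - k₁ i / k₀,
          fun i j => if i = j then 1 - k₁ i / k₀
            else 1 - k₁ i / k₀ - k₁ j / k₀ + k₂ i j / k₀)

/-- One Newton step for the maximization of `f(lam; R)` over `(0, η]`, where
`R[v] = ⟨μ, v⟩ + σ`; steps beyond `η` are cut off at `η`. -/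
def newtonStep (P : KDLRCParams) (μ : Fin d → ℝ) (σ lam : ℝ) : KernelProg d ℝ :=
  (momentProgram (bVec lam μ)).bind fun m =>
    let f₁ := μ ⬝ᵥ m.1 + σ + (P.α - 1) / lam
    let f₂ := μ ⬝ᵥ (m.2 *ᵥ μ) - (μ ⬝ᵥ m.1) ^ 2 - (P.α - 1) / lam ^ 2
    .ret (min P.η (lam - f₁ / f₂))

/-- Newton steps are repeated until the relative change is at most `1 / T`
(or the cap on the number of passes is reached). -/
def newtonLoop (P : KDLRCParams) (μ : Fin d → ℝ) (σ : ℝ) : ℕ → ℝ → KernelProg d ℝ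
  | 0, lam => .ret lam
  | m + 1, lam =>
      (newtonStep P μ σ lam).bind fun lam' =>
        if |lam' - lam| ≤ lam' / P.T then .ret lam' else newtonLoop P μ σ m lam'

def init (P : KDLRCParams) (d : ℕ) : KDLRCState d where
  rounds := 0
  cumUtil := 0
  cumCorr := 0
  lastUtil := 0
  lastAction := 0
  rate := P.η
  variation := 0
  switched := False
  fallbackUtil := 0

open Classical in
/-- The vector `μ` of cumulated utilities: with optimism before the switch, and
without optimism and counted from the switch on after it. -/
def mu (s : KDLRCState d) : Fin d → ℝ :=
  if s.switched then s.fallbackUtil else s.cumUtil + s.lastUtil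

/-- The optimistic correction `σ`. -/
def sigma (s : KDLRCState d) : ℝ := s.cumCorr - s.lastUtil ⬝ᵥ s.lastAction

/-- The optimistic cumulated regret `R[v] = ⟨μ, v⟩ + σ` of the vertex `v`. -/
def regretVec (s : KDLRCState d) (v : Fin d → ℝ) : ℝ := mu s ⬝ᵥ v + sigma s

open Classical in
/-- The learning rate of the next round, by Newton's method started at the last rate. -/
def rateProgram (P : KDLRCParams) (s : KDLRCState d) : KernelProg d ℝ :=
  if s.switched then .ret P.fallbackRate else newtonLoop P (mu s) (sigma s) P.M s.rate

/-- The action of the next round at the learning rate `lam`. -/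
def actionProgram (s : KDLRCState d) (lam : ℝ) : KernelProg d (Fin d → ℝ) :=
  meanProgram (bVec lam (mu s))

/-- The whole computation in a round: learning rate and action. -/
def stepProgram (P : KDLRCParams) (s : KDLRCState d) : KernelProg d (ℝ × (Fin d → ℝ)) :=
  (rateProgram P s).bind fun lam => (actionProgram s lam).bind fun x => .ret (lam, x)

/-- The learning rate used in the round that starts in the state `s`. -/
def rate (P : KDLRCParams) (Ω : ZeroOnePolytope d) (s : KDLRCState d) : ℝ :=
  ((stepProgram P s).value Ω.kernel).1

/-- The action played in the round that starts in the state `s`. -/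
def action (P : KDLRCParams) (Ω : ZeroOnePolytope d) (s : KDLRCState d) : Fin d → ℝ :=
  ((stepProgram P s).value Ω.kernel).2

open Classical in
/-- The state after the round that starts in the state `s` and in which the utility `ν` is
observed. -/
def next (P : KDLRCParams) (Ω : ZeroOnePolytope d) (s : KDLRCState d) (ν : Fin d → ℝ) :
    KDLRCState d :=
  let x := action P Ω s
  let var := if s.rounds = 0 then 0 else s.variation + Ω.utilityNorm (ν - s.lastUtil) ^ 2
  { rounds := s.rounds + 1
    cumUtil := s.cumUtil + ν
    cumCorr := s.cumCorr - ν ⬝ᵥ x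
    lastUtil := ν
    lastAction := x
    rate := rate P Ω s
    variation := var
    switched := s.switched ∨ P.threshold (s.rounds + 1) < var
    fallbackUtil := if s.switched then s.fallbackUtil + ν else 0 }

/-- The state of a player before round `t` (rounds are numbered from `0`) when the environment
shows the utilities `ν 0, ν 1, …`. -/
def state (P : KDLRCParams) (Ω : ZeroOnePolytope d) (ν : ℕ → Fin d → ℝ) : ℕ → KDLRCState d
  | 0 => init P d
  | t + 1 => next P Ω (state P Ω ν t) (ν t)

/-- In the round that starts in the state `s` the algorithm makes `(d² + 1) k` kernel evaluations
for the learning rate and `d + 1` for the action, for some `k ≤ B`. -/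
def StepCost (P : KDLRCParams) (Ω : ZeroOnePolytope d) (s : KDLRCState d) (B : ℝ) : Prop :=
  ∃ k : ℕ, (k : ℝ) ≤ B ∧
    (rateProgram P s).evals Ω.kernel = (d ^ 2 + 1) * k ∧
    (actionProgram s (rate P Ω s)).evals Ω.kernel = d + 1 ∧
    (stepProgram P s).evals Ω.kernel = (d + 1) + (d ^ 2 + 1) * k

/-- In the round that starts in the state `s` the learning rate approximates, up to the relative
error `1 / T`, the unique maximizer over `(0, η]` of the learning rate control objective, and the
action is the mean of the softmax distribution on the vertices at this learning rate. -/
def StepCorrect (P : KDLRCParams) (Ω : ZeroOnePolytope d) (s : KDLRCState d) : Prop :=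
  (∃ l ∈ Set.Ioc 0 P.η,
      (∀ l' ∈ Set.Ioc 0 P.η, l' ≠ l →
        Ω.rateObjective P.α (regretVec s) l' < Ω.rateObjective P.α (regretVec s) l) ∧
      |rate P Ω s - l| ≤ l / P.T) ∧
    action P Ω s = ∑ v ∈ Ω.verts, Ω.softmax (regretVec s) (rate P Ω s) v • v

end KDLRC

/-! ### Polyhedral games -/

/-- An `n`-player convex 0/1-polyhedral game: every player has a 0/1-polyhedral strategy set, and
the utilities are multilinear in the strategies. -/
structure PolyhedralGame (n : ℕ) where
  dim : Fin n → ℕ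
  Ω : (i : Fin n) → ZeroOnePolytope (dim i)
  utility : Fin n → MultilinearMap ℝ (fun j => Fin (dim j) → ℝ) ℝ

namespace PolyhedralGame

variable {n : ℕ} (G : PolyhedralGame n)

/-- The gradient of the utility of player `i` in the strategy of player `i`. -/
def gradient (i : Fin n) (x : (j : Fin n) → Fin (G.dim j) → ℝ) : Fin (G.dim i) → ℝ :=
  fun k => G.utility i (Function.update x i (Pi.single k 1))

/-- The utilities of all profiles of vertices lie in `[-1, 1]`. -/
def Bounded : Prop :=
  ∀ s : (j : Fin n) → Fin (G.dim j) → ℝ, (∀ j, s j ∈ (G.Ω j).verts) →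
    ∀ i, |G.utility i s| ≤ 1

/-- The profile `χ` consists of probability distributions on the vertices. -/
def IsMixed (χ : (j : Fin n) → (Fin (G.dim j) → ℝ) → ℝ) : Prop :=
  ∀ j, (∀ v ∈ (G.Ω j).verts, 0 ≤ χ j v) ∧ ∑ v ∈ (G.Ω j).verts, χ j v = 1

/-- The strategies induced by distributions on the vertices. -/
def mean (χ : (j : Fin n) → (Fin (G.dim j) → ℝ) → ℝ) : (j : Fin n) → Fin (G.dim j) → ℝ :=
  fun j => ∑ v ∈ (G.Ω j).verts, χ j v • v

/-- `L`-smoothness of the game on the simplices over the vertices: the utility vector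
`(⟨∇_i, v⟩)_v` of each player is `L`-Lipschitz from the sum of the `ℓ₁` norms to `ℓ_∞`. -/
def Smooth (L : ℝ) : Prop :=
  ∀ χ χ' : (j : Fin n) → (Fin (G.dim j) → ℝ) → ℝ, G.IsMixed χ → G.IsMixed χ' →
    ∀ i, ∀ v ∈ (G.Ω i).verts,
      |G.gradient i (G.mean χ) ⬝ᵥ v - G.gradient i (G.mean χ') ⬝ᵥ v|
        ≤ L * ∑ j, ∑ w ∈ (G.Ω j).verts, |χ j w - χ' j w|

/-- The states of the players before round `t` when all players follow the algorithm. -/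
def selfPlayState (P : KDLRCParams) : ℕ → (i : Fin n) → KDLRCState (G.dim i)
  | 0 => fun i => KDLRC.init P (G.dim i)
  | t + 1 => fun i =>
      KDLRC.next P (G.Ω i) (selfPlayState P t i)
        (G.gradient i fun j => KDLRC.action P (G.Ω j) (selfPlayState P t j))

/-- The action of player `i` in round `t` of self-play. -/
def selfPlayAction (P : KDLRCParams) (i : Fin n) (t : ℕ) : Fin (G.dim i) → ℝ :=
  KDLRC.action P (G.Ω i) (G.selfPlayState P t i)

/-- The utility observed by player `i` in round `t` of self-play. -/
def selfPlayUtility (P : KDLRCParams) (i : Fin n) (t : ℕ) : Fin (G.dim i) → ℝ :=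
  G.gradient i fun j => G.selfPlayAction P j t

end PolyhedralGame

end

/-! ### Gibbs distributions on a finite set -/

/-! The proof combines a regret-versus-movement inequality for optimistic learning, in which the
learning rate is itself optimized, with a Newton iteration fast enough to follow the optimal rate.

Entropy estimates. Under Gibbs weights p with exponent w = λR one has w(v) = log p(v) + log Z, so up
to sign and a constant the exponent is the surprisal -log p. Jensen's inequality bounds the moments
of the surprisal by powers of log N. Hence the exponent has variance at most (2 log N)² and third
cumulant O(log² N + log³ N), however large R is (`var_self_le`, `abs_cum₃_self_le`). Since λ² f''(λ)
= Var(λR) - (α - 1), the term β log² N in α makes f concave, with curvature at least that of a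
multiple of log λ. It follows that the optimal rate drifts by a factor 1 + O(1 / (1 + 2 log N)) when
the regrets change by a bounded amount (`IsOpt.drift`), and that Newton's method converges
quadratically from a neighbourhood of that relative size (`IsOpt.newton`). The last rate lies there,
so O(log log T) passes suffice (`newton_start`, `newtonLoop_spec`). Kernel evaluations deliver the
exact moments because on 0/1 vertices the features of the indicators are products of factors 1 - v
i.

Regret. Take as potential the maximal value of f minus the optimal rate times the expected last
gain. In a round it grows by O(η²) times the squared variation of the utilities, and it loses a
multiple of the squared ℓ₁ movement of the distributions (`IsOpt.step`). The loss comes from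
relative entropy, for the change of the regrets, and from the divergence ρ - 1 - log ρ, for the
change of the rate by a factor ρ. Comparing the final objective with its value at the rate η bounds
the regret. Comparing with η / (m + 1), where the trivial lower bound on the regret costs only O(η),
bounds the total squared movement by O(α log (m + 1)), up to lower order terms and η² times the
variation (`mul_regret_le`, `sum_sq_move_le`).

Conclusion. In self-play, smoothness bounds every variation by L² n times the total squared movement
of all players, and η² L² n² ≤ 1/288 allows the resulting inequality to be absorbed into itself; so
the threshold is never crossed (`not_switched_selfPlay`). Against arbitrary utilities the variation
is below the threshold up to a bounded excess until the round of the switch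
(`regret_before_switch`), and multiplicative weights handles the rest (`regret_after_switch`). -/

namespace Gibbs

variable {ι : Type*} {V : Finset ι}

/-- The partition function `∑ exp (w v)`. -/
noncomputable def partition (V : Finset ι) (w : ι → ℝ) : ℝ := ∑ v ∈ V, Real.exp (w v)

/-- The Gibbs weights `exp (w v) / ∑ exp (w u)`. -/
noncomputable def weight (V : Finset ι) (w : ι → ℝ) (v : ι) : ℝ := Real.exp (w v) / partition V w

/-- The expectation of `g` under the Gibbs weights of `w`. -/
noncomputable def mean (V : Finset ι) (w g : ι → ℝ) : ℝ := ∑ v ∈ V, weight V w v * g v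

/-- The variance of `g` under the Gibbs weights of `w`. -/
noncomputable def var (V : Finset ι) (w g : ι → ℝ) : ℝ :=
  mean V w (fun v => g v ^ 2) - mean V w g ^ 2

/-- The third cumulant of `g` under the Gibbs weights of `w`. -/
noncomputable def cum₃ (V : Finset ι) (w g : ι → ℝ) : ℝ :=
  mean V w (fun v => g v ^ 3) - 3 * mean V w g * mean V w (fun v => g v ^ 2)
    + 2 * mean V w g ^ 3

theorem partition_pos (hV : V.Nonempty) (w : ι → ℝ) : 0 < partition V w :=
  sum_pos (fun _ _ => Real.exp_pos _) hV

theorem weight_pos (hV : V.Nonempty) (w : ι → ℝ) (v : ι) : 0 < weight V w v :=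
  div_pos (Real.exp_pos _) (partition_pos hV w)

theorem sum_weight (hV : V.Nonempty) (w : ι → ℝ) : ∑ v ∈ V, weight V w v = 1 := by
  unfold weight
  rw [← sum_div]
  exact div_self (partition_pos hV w).ne'

theorem log_weight (hV : V.Nonempty) (w : ι → ℝ) (v : ι) :
    Real.log (weight V w v) = w v - Real.log (partition V w) := by
  rw [weight, Real.log_div (Real.exp_pos _).ne' (partition_pos hV w).ne', Real.log_exp]

theorem weight_le_one {w : ι → ℝ} {v : ι} (hv : v ∈ V) : weight V w v ≤ 1 := by
  have hV : V.Nonempty := ⟨v, hv⟩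
  rw [← sum_weight hV w]
  exact single_le_sum (f := weight V w) (fun u _ => (weight_pos hV w u).le) hv

theorem mean_add (w g h : ι → ℝ) :
    mean V w (fun v => g v + h v) = mean V w g + mean V w h := by
  simp only [mean, mul_add, sum_add_distrib]

theorem mean_sub (w g h : ι → ℝ) :
    mean V w (fun v => g v - h v) = mean V w g - mean V w h := by
  simp only [mean, mul_sub, sum_sub_distrib]

theorem mean_const_mul (w g : ι → ℝ) (c : ℝ) :
    mean V w (fun v => c * g v) = c * mean V w g := by
  simp only [mean, mul_sum]
  exact sum_congr rfl fun _ _ => by ring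

theorem mean_const (hV : V.Nonempty) (w : ι → ℝ) (c : ℝ) : mean V w (fun _ => c) = c := by
  simp only [mean]
  rw [← sum_mul, sum_weight hV, one_mul]

theorem mean_mono (hV : V.Nonempty) {w g h : ι → ℝ} (hgh : ∀ v ∈ V, g v ≤ h v) :
    mean V w g ≤ mean V w h :=
  sum_le_sum fun v hv => mul_le_mul_of_nonneg_left (hgh v hv) (weight_pos hV w v).le

theorem mean_congr {w g h : ι → ℝ} (hgh : ∀ v ∈ V, g v = h v) :
    mean V w g = mean V w h :=
  sum_congr rfl fun v hv => by rw [hgh v hv]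

theorem mean_nonneg (hV : V.Nonempty) {w g : ι → ℝ} (hg : ∀ v ∈ V, 0 ≤ g v) :
    0 ≤ mean V w g :=
  sum_nonneg fun v hv => mul_nonneg (weight_pos hV w v).le (hg v hv)

theorem abs_mean_le (hV : V.Nonempty) {w g : ι → ℝ} {c : ℝ} (hg : ∀ v ∈ V, |g v| ≤ c) :
    |mean V w g| ≤ c := by
  rw [abs_le]
  constructor
  · rw [← mean_const hV w (-c)]
    exact mean_mono hV fun v hv => (abs_le.1 (hg v hv)).1
  · rw [← mean_const hV w c]
    exact mean_mono hV fun v hv => (abs_le.1 (hg v hv)).2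

theorem var_eq (hV : V.Nonempty) (w g : ι → ℝ) :
    var V w g = mean V w (fun v => (g v - mean V w g) ^ 2) := by
  have h : (fun v => (g v - mean V w g) ^ 2)
      = fun v => (g v ^ 2 - 2 * mean V w g * g v) + mean V w g ^ 2 := by
    funext v; ring
  rw [h, mean_add, mean_sub, mean_const_mul, mean_const hV, var]
  ring

theorem var_nonneg (hV : V.Nonempty) (w g : ι → ℝ) : 0 ≤ var V w g := by
  rw [var_eq hV]
  exact mean_nonneg hV fun v _ => sq_nonneg _

theorem cum₃_eq (hV : V.Nonempty) (w g : ι → ℝ) :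
    cum₃ V w g = mean V w (fun v => (g v - mean V w g) ^ 3) := by
  have h : (fun v => (g v - mean V w g) ^ 3)
      = fun v => ((g v ^ 3 - 3 * mean V w g * g v ^ 2) + 3 * mean V w g ^ 2 * g v)
          - mean V w g ^ 3 := by
    funext v; ring
  rw [h, mean_sub, mean_add, mean_sub, mean_const_mul, mean_const_mul, mean_const hV, cum₃]
  ring

/-- The mean absolute deviation is at most the standard deviation. -/
theorem sq_mean_abs_sub_le (hV : V.Nonempty) (w g : ι → ℝ) :
    mean V w (fun v => |g v - mean V w g|) ^ 2 ≤ var V w g := by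
  have h := var_nonneg hV w (fun v => |g v - mean V w g|)
  rw [var] at h
  simp only [sq_abs] at h
  rw [var_eq hV]
  linarith

/-- The covariance of a function with a bounded function. -/
theorem abs_cov_le (hV : V.Nonempty) {w g h : ι → ℝ} {c s : ℝ} (hs : 0 ≤ s)
    (hh : ∀ v ∈ V, |h v| ≤ c) (hvar : var V w g ≤ s ^ 2) :
    |mean V w (fun v => g v * h v) - mean V w g * mean V w h| ≤ c * s := by
  obtain ⟨v₀, hv₀⟩ := hV
  have hV : V.Nonempty := ⟨v₀, hv₀⟩
  have hc : 0 ≤ c := (abs_nonneg _).trans (hh v₀ hv₀)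
  have h1 : mean V w (fun v => g v * h v) - mean V w g * mean V w h
      = mean V w (fun v => (g v - mean V w g) * h v) := by
    rw [← mean_const_mul, ← mean_sub]
    congr 1; funext v; ring
  have h2 : |mean V w (fun v => (g v - mean V w g) * h v)|
      ≤ c * mean V w (fun v => |g v - mean V w g|) := by
    rw [← mean_const_mul]
    refine (abs_sum_le_sum_abs _ _).trans (sum_le_sum fun v hv => ?_)
    rw [abs_mul, abs_of_pos (weight_pos hV w v), abs_mul]
    refine mul_le_mul_of_nonneg_left ?_ (weight_pos hV w v).le
    rw [mul_comm]
    exact mul_le_mul_of_nonneg_right (hh v hv) (abs_nonneg _)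
  have h3 : mean V w (fun v => |g v - mean V w g|) ≤ s := by
    refine abs_le_of_sq_le_sq' ((sq_mean_abs_sub_le hV w g).trans hvar) hs |>.2
  rw [h1]
  exact h2.trans (mul_le_mul_of_nonneg_left h3 hc)

/-! #### Entropy moments -/

/-- The derivative is (k + 1) (k + log z)^k / z. The shift by k is what makes it decrease from z = 1
on: the numerator grows by at most the factor (1 + log(y/x)/k)^k ≤ y/x between x and y. -/
theorem concaveOn_add_log_pow (k : ℕ) (hk : 1 ≤ k) :
    ConcaveOn ℝ (Set.Ici (1 : ℝ)) fun z => ((k : ℝ) + Real.log z) ^ (k + 1) := by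
  have hd : ∀ z : ℝ, 0 < z → HasDerivAt (fun z => ((k : ℝ) + Real.log z) ^ (k + 1))
      (((k : ℝ) + 1) * (((k : ℝ) + Real.log z) ^ k * z⁻¹)) z := by
    intro z hz
    have := ((Real.hasDerivAt_log hz.ne').const_add (k : ℝ)).pow (k + 1)
    refine this.congr_deriv ?_
    rw [show k + 1 - 1 = k from rfl]
    push_cast
    ring
  refine AntitoneOn.concaveOn_of_deriv (convex_Ici 1) ?_ ?_ ?_
  · intro z hz
    exact (hd z (lt_of_lt_of_le one_pos hz)).continuousAt.continuousWithinAt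
  · intro z hz
    rw [interior_Ici] at hz
    exact (hd z (one_pos.trans hz)).differentiableAt.differentiableWithinAt
  · rw [interior_Ici]
    have heq : Set.EqOn (fun z : ℝ => ((k : ℝ) + 1) * (((k : ℝ) + Real.log z) ^ k * z⁻¹))
        (deriv fun z => ((k : ℝ) + Real.log z) ^ (k + 1)) (Set.Ioi 1) := fun z hz =>
      (hd z (one_pos.trans hz)).deriv.symm
    refine AntitoneOn.congr ?_ heq
    intro x hx y hy hxy
    have hx1 : (1 : ℝ) < x := hx
    have hx0 : (0 : ℝ) < x := one_pos.trans hx1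
    have hy0 : (0 : ℝ) < y := hx0.trans_le hxy
    refine mul_le_mul_of_nonneg_left ?_ (by positivity)
    have hlx : 0 ≤ Real.log x := Real.log_nonneg hx1.le
    have hk1 : (1 : ℝ) ≤ k := by exact_mod_cast hk
    have hs : Real.log (y / x) ≥ 0 := Real.log_nonneg ((one_le_div hx0).2 hxy)
    have hly : Real.log y = Real.log x + Real.log (y / x) := by
      rw [Real.log_div hy0.ne' hx0.ne']; ring
    have h1 : ((k : ℝ) + Real.log y) / ((k : ℝ) + Real.log x) ≤ 1 + Real.log (y / x) / k := by
      rw [div_le_iff₀ (by linarith), hly]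
      have : Real.log (y / x) / k * k = Real.log (y / x) := by field_simp
      have h' : 0 ≤ Real.log (y / x) / k * Real.log x := by positivity
      nlinarith
    have h2 : (1 + Real.log (y / x) / k) ^ k ≤ y / x := by
      calc (1 + Real.log (y / x) / k) ^ k ≤ Real.exp (Real.log (y / x) / k) ^ k := by
            refine pow_le_pow_left₀ (by positivity) ?_ k
            rw [add_comm]; exact Real.add_one_le_exp _
        _ = y / x := by
            rw [← Real.exp_nat_mul, mul_div_cancel₀ _ (by positivity : (k : ℝ) ≠ 0),
              Real.exp_log (by positivity)]
    have h3 : (((k : ℝ) + Real.log y) / ((k : ℝ) + Real.log x)) ^ k ≤ y / x := by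
      refine (pow_le_pow_left₀ ?_ h1 k).trans h2
      rw [hly]; positivity
    rw [div_pow, div_le_div_iff₀ (by positivity) hx0] at h3
    change ((k : ℝ) + Real.log y) ^ k * y⁻¹ ≤ ((k : ℝ) + Real.log x) ^ k * x⁻¹
    rw [← div_eq_mul_inv, ← div_eq_mul_inv, div_le_div_iff₀ hy0 hx0]
    linarith

/-- Jensen's inequality at the points 1 / p(v) ≥ 1, whose mean under p is the number of elements of
V. The exponent w may be arbitrarily large. -/
theorem mean_neg_log_pow_le (hV : V.Nonempty) {N : ℕ} (hN : V.card ≤ N) (w : ι → ℝ) (k : ℕ)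
    (hk : 1 ≤ k) :
    mean V w (fun v => ((k : ℝ) + -Real.log (weight V w v)) ^ (k + 1))
      ≤ ((k : ℝ) + Real.log N) ^ (k + 1) := by
  have h := (concaveOn_add_log_pow k hk).le_map_sum (t := V) (w := weight V w)
    (p := fun v => (weight V w v)⁻¹) (fun v _ => (weight_pos hV w v).le) (sum_weight hV w)
    (fun v hv => (one_le_inv₀ (weight_pos hV w v)).2 (weight_le_one hv))
  have h1 : ∑ v ∈ V, weight V w v • (weight V w v)⁻¹ = V.card := by
    have h2 : ∀ v ∈ V, weight V w v • (weight V w v)⁻¹ = 1 := fun v _ =>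
      mul_inv_cancel₀ (weight_pos hV w v).ne'
    rw [sum_congr rfl h2]
    simp
  rw [h1] at h
  have hc : 0 < (V.card : ℝ) := by exact_mod_cast hV.card_pos
  have hlc : 0 ≤ Real.log V.card := Real.log_natCast_nonneg _
  simp only [Real.log_inv, smul_eq_mul] at h
  refine h.trans (pow_le_pow_left₀ (by positivity) ?_ _)
  have := Real.log_le_log hc (by exact_mod_cast hN : (V.card : ℝ) ≤ N)
  linarith

/-- Integrality of N: its logarithm is 0 or at least log 2 > 2/3. This allows linear terms in log N
to be absorbed into quadratic ones throughout. -/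
theorem log_nat_cases (N : ℕ) : 0 ≤ Real.log N ∧ 2 * Real.log N ≤ 3 * Real.log N ^ 2 := by
  refine ⟨Real.log_natCast_nonneg N, ?_⟩
  rcases Nat.lt_or_ge N 2 with h | h
  · interval_cases N <;> simp
  · have h1 : Real.log 2 ≤ Real.log N := Real.log_le_log (by norm_num) (by exact_mod_cast h)
    have := Real.log_two_gt_d9
    nlinarith

/-- The exponent is minus the surprisal Y plus a constant, and Jensen with k = 1 gives Var Y ≤ E[Y²]
≤ 2 log N + log² N. -/
theorem var_self_le (hV : V.Nonempty) {N : ℕ} (hN : V.card ≤ N) (w : ι → ℝ) :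
    var V w w ≤ (2 * Real.log N) ^ 2 := by
  obtain ⟨h0, h1⟩ := log_nat_cases N
  have h := mean_neg_log_pow_le hV hN w 1 le_rfl
  set Y : ι → ℝ := fun v => -Real.log (weight V w v) with hY
  have hY0 : 0 ≤ mean V w Y := mean_nonneg hV fun v hv =>
    neg_nonneg.2 (Real.log_nonpos (weight_pos hV w v).le (weight_le_one hv))
  have hw : ∀ v, w v = -Y v + Real.log (partition V w) := fun v => by
    simp only [hY, log_weight hV]; ring
  have hm : mean V w w = - mean V w Y + Real.log (partition V w) := by
    rw [mean_congr fun v _ => hw v, mean_add, mean_const hV]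
    congr 1
    simp only [mean, mul_neg, sum_neg_distrib]
  have hv : var V w w = var V w Y := by
    rw [var_eq hV, var_eq hV, hm]
    congr 1; funext v
    rw [hw v]
    ring
  have h2 : mean V w (fun v => ((1 : ℕ) + Y v) ^ (1 + 1))
      = 1 + 2 * mean V w Y + mean V w (fun v => Y v ^ 2) := by
    have e : (fun v => ((1 : ℕ) + Y v) ^ (1 + 1)) = fun v => (1 + 2 * Y v) + Y v ^ 2 := by
      funext v; push_cast; ring
    rw [e, mean_add, mean_add, mean_const hV, mean_const_mul]
  rw [h2] at h
  push_cast at h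
  rw [hv, var]
  nlinarith [sq_nonneg (mean V w Y)]

/-- As Y ≥ 0, the cube |E[Y] - Y|³ is at most E[Y]³ + Y³; Jensen with k = 2 bounds E[Y³] and with k
= 1 bounds E[Y] by log N. -/
theorem abs_cum₃_self_le (hV : V.Nonempty) {N : ℕ} (hN : V.card ≤ N) (w : ι → ℝ) :
    |cum₃ V w w| ≤ 24 * Real.log N ^ 2 + 2 * Real.log N ^ 3 := by
  obtain ⟨h0, h1⟩ := log_nat_cases N
  have h := mean_neg_log_pow_le hV hN w 2 one_le_two
  have h' := mean_neg_log_pow_le hV hN w 1 le_rfl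
  set Y : ι → ℝ := fun v => -Real.log (weight V w v) with hY
  have hYn : ∀ v ∈ V, 0 ≤ Y v := fun v hv =>
    neg_nonneg.2 (Real.log_nonpos (weight_pos hV w v).le (weight_le_one hv))
  have hY0 : 0 ≤ mean V w Y := mean_nonneg hV hYn
  have hY2 : 0 ≤ mean V w (fun v => Y v ^ 2) := mean_nonneg hV fun v hv => sq_nonneg _
  have hw : ∀ v, w v = -Y v + Real.log (partition V w) := fun v => by
    simp only [hY, log_weight hV]; ring
  have hm : mean V w w = - mean V w Y + Real.log (partition V w) := by
    rw [mean_congr fun v _ => hw v, mean_add, mean_const hV]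
    congr 1
    simp only [mean, mul_neg, sum_neg_distrib]
  have hv : cum₃ V w w = mean V w (fun v => (mean V w Y - Y v) ^ 3) := by
    rw [cum₃_eq hV, hm]
    congr 1; funext v
    rw [hw v]
    ring
  have h2 : mean V w (fun v => ((2 : ℕ) + Y v) ^ (2 + 1))
      = 8 + 12 * mean V w Y + 6 * mean V w (fun v => Y v ^ 2) + mean V w (fun v => Y v ^ 3) := by
    have e : (fun v => ((2 : ℕ) + Y v) ^ (2 + 1))
        = fun v => ((8 + 12 * Y v) + 6 * Y v ^ 2) + Y v ^ 3 := by
      funext v; push_cast; ring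
    rw [e, mean_add, mean_add, mean_add, mean_const hV, mean_const_mul, mean_const_mul]
  have h3 : mean V w (fun v => ((1 : ℕ) + Y v) ^ (1 + 1))
      = 1 + 2 * mean V w Y + mean V w (fun v => Y v ^ 2) := by
    have e : (fun v => ((1 : ℕ) + Y v) ^ (1 + 1)) = fun v => (1 + 2 * Y v) + Y v ^ 2 := by
      funext v; push_cast; ring
    rw [e, mean_add, mean_add, mean_const hV, mean_const_mul]
  rw [h2] at h
  rw [h3] at h'
  push_cast at h h'
  have hY1 : mean V w Y ≤ Real.log N := by
    have := var_nonneg hV w Y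
    rw [var] at this
    nlinarith
  have hcube : mean V w Y ^ 3 ≤ Real.log N ^ 3 := pow_le_pow_left₀ hY0 hY1 3
  have h4 : |mean V w (fun v => (mean V w Y - Y v) ^ 3)|
      ≤ mean V w (fun v => mean V w Y ^ 3 + Y v ^ 3) := by
    refine (abs_sum_le_sum_abs _ _).trans (sum_le_sum fun v hv => ?_)
    rw [abs_mul, abs_of_pos (weight_pos hV w v)]
    refine mul_le_mul_of_nonneg_left ?_ (weight_pos hV w v).le
    have hy := hYn v hv
    rw [abs_le]
    have e1 : 0 ≤ mean V w Y * Y v := mul_nonneg hY0 hy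
    constructor
    · have := pow_le_pow_left₀ hy (le_add_of_nonneg_left hY0 : Y v ≤ mean V w Y + Y v) 3
      nlinarith [mul_nonneg e1 hy, mul_nonneg e1 hY0, pow_nonneg hY0 3, pow_nonneg hy 3,
        mul_nonneg hY0 (sq_nonneg (mean V w Y - Y v)), mul_nonneg hy (sq_nonneg (mean V w Y - Y v))]
    · nlinarith [mul_nonneg e1 hy, mul_nonneg e1 hY0, pow_nonneg hY0 3, pow_nonneg hy 3,
        mul_nonneg hY0 (sq_nonneg (mean V w Y - Y v)), mul_nonneg hy (sq_nonneg (mean V w Y - Y v))]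
  rw [mean_add, mean_const hV] at h4
  rw [hv]
  refine h4.trans ?_
  nlinarith

/-! #### Calculus -/

theorem hasDerivAt_partition {w : ℝ → ι → ℝ} {w' : ι → ℝ} {s : ℝ}
    (hw : ∀ v ∈ V, HasDerivAt (fun s => w s v) (w' v) s) :
    HasDerivAt (fun s => partition V (w s)) (∑ v ∈ V, Real.exp (w s v) * w' v) s :=
  HasDerivAt.fun_sum fun v hv => (hw v hv).exp

theorem hasDerivAt_log_partition (hV : V.Nonempty) {w : ℝ → ι → ℝ} {w' : ι → ℝ} {s : ℝ}
    (hw : ∀ v ∈ V, HasDerivAt (fun s => w s v) (w' v) s) :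
    HasDerivAt (fun s => Real.log (partition V (w s))) (mean V (w s) w') s := by
  convert (hasDerivAt_partition hw).log (partition_pos hV _).ne' using 1
  simp only [mean, weight, sum_div]
  exact sum_congr rfl fun v _ => by ring

/-- The bracket is the covariance of g with the velocity w' of the exponent; all later perturbation
bounds estimate this covariance. -/
theorem hasDerivAt_mean (hV : V.Nonempty) {w g : ℝ → ι → ℝ} {w' g' : ι → ℝ} {s : ℝ}
    (hw : ∀ v ∈ V, HasDerivAt (fun s => w s v) (w' v) s)
    (hg : ∀ v ∈ V, HasDerivAt (fun s => g s v) (g' v) s) :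
    HasDerivAt (fun s => mean V (w s) (g s))
      (mean V (w s) g' + (mean V (w s) (fun v => g s v * w' v)
        - mean V (w s) (g s) * mean V (w s) w')) s := by
  have h : ∀ v ∈ V, HasDerivAt (fun s => weight V (w s) v * g s v)
      (weight V (w s) v * g' v + (weight V (w s) v * (g s v * w' v)
        - mean V (w s) w' * (weight V (w s) v * g s v))) s := by
    intro v hv
    have h1 := (((hw v hv).exp).div (hasDerivAt_partition hw) (partition_pos hV _).ne').mul (hg v hv)
    refine h1.congr_deriv ?_
    have hp := (partition_pos hV (w s)).ne'
    have hm : ∑ v ∈ V, Real.exp (w s v) * w' v = partition V (w s) * mean V (w s) w' := by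
      simp only [mean, weight, mul_sum]
      exact sum_congr rfl fun v _ => by field_simp
    simp only [hm, weight]
    simp only [Pi.div_apply]
    field_simp
    ring
  refine (HasDerivAt.fun_sum h).congr_deriv ?_
  rw [sum_add_distrib, sum_sub_distrib, ← mul_sum]
  simp only [mean]
  ring

end Gibbs

/-! ### Perturbation of Gibbs distributions -/

namespace Gibbs

variable {ι : Type*} {V : Finset ι}

theorem var_const_mul (w g : ι → ℝ) (a : ℝ) :
    var V w (fun v => a * g v) = a ^ 2 * var V w g := by
  have : (fun v => (a * g v) ^ 2) = fun v => a ^ 2 * g v ^ 2 := by funext v; ring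
  rw [var, var, this, mean_const_mul, mean_const_mul]
  ring

/-- The relative entropy of two Gibbs distributions dominates their squared total variation. -/
theorem log_partition_ge (hV : V.Nonempty) (w w' : ι → ℝ) :
    Real.log (partition V w') + mean V w' (fun v => w v - w' v)
      + 1 / 4 * (∑ v ∈ V, |weight V w v - weight V w' v|) ^ 2 ≤ Real.log (partition V w) := by
  -- The comparison passes through the Hellinger distance ∑ (a - b)²: it is at most the relative
  -- entropy by log x ≤ x - 1, and Cauchy–Schwarz with ∑ (a + b)² ≤ 4 gives the factor 1/4 for the
  -- ℓ₁ distance.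
  set a : ι → ℝ := fun v => √(weight V w' v) with ha
  set b : ι → ℝ := fun v => √(weight V w v) with hb
  have ha2 : ∀ v, a v ^ 2 = weight V w' v := fun v => Real.sq_sqrt (weight_pos hV w' v).le
  have hb2 : ∀ v, b v ^ 2 = weight V w v := fun v => Real.sq_sqrt (weight_pos hV w v).le
  have ha0 : ∀ v, 0 < a v := fun v => Real.sqrt_pos.2 (weight_pos hV w' v)
  have hb0 : ∀ v, 0 < b v := fun v => Real.sqrt_pos.2 (weight_pos hV w v)
  have hsa : ∑ v ∈ V, a v ^ 2 = 1 := by simp only [ha2]; exact sum_weight hV w'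
  have hsb : ∑ v ∈ V, b v ^ 2 = 1 := by simp only [hb2]; exact sum_weight hV w
  have h1 : ∑ v ∈ V, (a v - b v) ^ 2 ≤ Real.log (partition V w) - Real.log (partition V w')
      - mean V w' (fun v => w v - w' v) := by
    have h2 : Real.log (partition V w) - Real.log (partition V w')
        - mean V w' (fun v => w v - w' v)
        = ∑ v ∈ V, a v ^ 2 * (2 * (Real.log (a v) - Real.log (b v))) := by
      have h3 : ∀ v ∈ V, a v ^ 2 * (2 * (Real.log (a v) - Real.log (b v)))
          = (Real.log (partition V w) - Real.log (partition V w')) * weight V w' v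
            - weight V w' v * (w v - w' v) := by
        intro v _
        have e1 : 2 * Real.log (a v) = w' v - Real.log (partition V w') := by
          rw [← log_weight hV, ← ha2, Real.log_pow]; norm_num
        have e2 : 2 * Real.log (b v) = w v - Real.log (partition V w) := by
          rw [← log_weight hV, ← hb2, Real.log_pow]; norm_num
        rw [ha2, mul_sub, e1, e2]
        ring
      rw [sum_congr rfl h3, sum_sub_distrib, ← mul_sum, sum_weight hV]
      simp only [mean]
      ring
    have h4 : ∑ v ∈ V, (a v - b v) ^ 2 = ∑ v ∈ V, (2 * a v ^ 2 - 2 * (a v * b v)) := by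
      have : ∑ v ∈ V, (a v - b v) ^ 2
          = ∑ v ∈ V, a v ^ 2 + ∑ v ∈ V, b v ^ 2 - ∑ v ∈ V, 2 * (a v * b v) := by
        rw [← sum_add_distrib, ← sum_sub_distrib]
        exact sum_congr rfl fun v _ => by ring
      rw [this, sum_sub_distrib, ← mul_sum (f := fun v => a v ^ 2), hsa, hsb]
      ring
    rw [h2, h4]
    refine sum_le_sum fun v _ => ?_
    have h5 : Real.log (b v) - Real.log (a v) ≤ b v / a v - 1 := by
      rw [← Real.log_div (hb0 v).ne' (ha0 v).ne']
      exact Real.log_le_sub_one_of_pos (div_pos (hb0 v) (ha0 v))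
    have h6 : a v ^ 2 * (b v / a v - 1) = a v * b v - a v ^ 2 := by
      have := (ha0 v).ne'
      field_simp
    nlinarith [mul_le_mul_of_nonneg_left h5 (sq_nonneg (a v))]
  have h7 : (∑ v ∈ V, |weight V w v - weight V w' v|) ^ 2
      ≤ (∑ v ∈ V, (a v - b v) ^ 2) * ∑ v ∈ V, (a v + b v) ^ 2 := by
    have h8 : ∑ v ∈ V, |weight V w v - weight V w' v| = ∑ v ∈ V, |a v - b v| * (a v + b v) := by
      refine sum_congr rfl fun v _ => ?_
      have e : a v ^ 2 - b v ^ 2 = (a v - b v) * (a v + b v) := by ring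
      rw [← ha2, ← hb2, abs_sub_comm, e, abs_mul, abs_of_pos (add_pos (ha0 v) (hb0 v))]
    rw [h8]
    refine (sum_mul_sq_le_sq_mul_sq V _ _).trans_eq ?_
    simp only [sq_abs]
  have h9 : ∑ v ∈ V, (a v + b v) ^ 2 ≤ 4 := by
    have : ∑ v ∈ V, (a v + b v) ^ 2 ≤ ∑ v ∈ V, (2 * a v ^ 2 + 2 * b v ^ 2) :=
      sum_le_sum fun v _ => by nlinarith [sq_nonneg (a v - b v)]
    rw [sum_add_distrib, ← mul_sum, ← mul_sum, hsa, hsb] at this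
    linarith
  have h10 : 0 ≤ ∑ v ∈ V, (a v - b v) ^ 2 := sum_nonneg fun v _ => sq_nonneg _
  nlinarith [mul_le_mul_of_nonneg_left h9 h10]

/-- The `ℓ₁` distance of the Gibbs distributions at two temperatures. -/
theorem sum_abs_weight_sub_le (hV : V.Nonempty) {N : ℕ} (hN : V.card ≤ N) (R : ι → ℝ) {x y : ℝ}
    (hx : 0 < x) (hy : 0 < y) :
    ∑ v ∈ V, |weight V (fun v => y * R v) v - weight V (fun v => x * R v) v|
      ≤ 2 * Real.log N * |Real.log (y / x)| := by
  -- The ℓ₁ distance is the change in the mean of this fixed sign function. In θ = log of the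
  -- temperature factor, the derivative of that mean is the covariance of ε with the exponent, at
  -- most its standard deviation.
  set ε : ι → ℝ := fun v =>
    SignType.sign (weight V (fun v => y * R v) v - weight V (fun v => x * R v) v) with hε
  have hε1 : ∀ v ∈ V, |ε v| ≤ 1 := by
    intro v _
    simp only [hε]
    rcases SignType.sign (weight V (fun v => y * R v) v - weight V (fun v => x * R v) v) <;> simp
  have hs : ∑ v ∈ V, |weight V (fun v => y * R v) v - weight V (fun v => x * R v) v|
      = mean V (fun v => y * R v) ε - mean V (fun v => x * R v) ε := by
    simp only [mean]
    rw [← sum_sub_distrib]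
    refine sum_congr rfl fun v _ => ?_
    rw [← self_mul_sign]
    ring
  have hd : ∀ θ : ℝ, HasDerivAt (fun θ => mean V (fun v => Real.exp θ * R v) ε)
      (mean V (fun v => Real.exp θ * R v) (fun v => ε v * (Real.exp θ * R v))
        - mean V (fun v => Real.exp θ * R v) ε
          * mean V (fun v => Real.exp θ * R v) (fun v => Real.exp θ * R v)) θ := by
    intro θ
    have := hasDerivAt_mean hV (w := fun θ v => Real.exp θ * R v) (g := fun _ => ε)
      (w' := fun v => Real.exp θ * R v) (g' := fun _ => 0) (s := θ)
      (fun v _ => (Real.hasDerivAt_exp θ).mul_const _) (fun v _ => hasDerivAt_const _ _)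
    rwa [mean_const hV, zero_add] at this
  have hb : ∀ θ : ℝ, |mean V (fun v => Real.exp θ * R v) (fun v => ε v * (Real.exp θ * R v))
        - mean V (fun v => Real.exp θ * R v) ε
          * mean V (fun v => Real.exp θ * R v) (fun v => Real.exp θ * R v)| ≤ 2 * Real.log N := by
    intro θ
    have h := abs_cov_le hV (w := fun v => Real.exp θ * R v) (g := fun v => Real.exp θ * R v)
      (by linarith [(log_nat_cases N).1] : 0 ≤ 2 * Real.log N) hε1 (var_self_le hV hN _)
    rw [one_mul] at h
    convert h using 2
    rw [mul_comm (mean V _ ε)]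
    congr 2
    funext v; ring
  have h := convex_univ.norm_image_sub_le_of_norm_hasDerivWithin_le
    (fun θ _ => (hd θ).hasDerivWithinAt) (fun θ _ => hb θ) (Set.mem_univ (Real.log x))
    (Set.mem_univ (Real.log y))
  simp only [Real.exp_log hx, Real.exp_log hy, Real.norm_eq_abs] at h
  rw [hs, Real.log_div hy.ne' hx.ne']
  exact (le_abs_self _).trans h

/-- The variance of the exponent is Lipschitz in the logarithm of the temperature. -/
theorem abs_var_sub_var_le (hV : V.Nonempty) {N : ℕ} (hN : V.card ≤ N) (R : ι → ℝ) {x y : ℝ}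
    (hx : 0 < x) (hy : 0 < y) :
    |var V (fun v => y * R v) (fun v => y * R v) - var V (fun v => x * R v) (fun v => x * R v)|
      ≤ (32 * Real.log N ^ 2 + 2 * Real.log N ^ 3) * |Real.log (y / x)| := by
  set w : ℝ → ι → ℝ := fun θ v => Real.exp θ * R v with hw
  have hwd : ∀ θ, ∀ v ∈ V, HasDerivAt (fun θ => w θ v) (w θ v) θ := fun θ v _ =>
    (Real.hasDerivAt_exp θ).mul_const _
  -- In the logarithmic variable θ the exponent is its own derivative, so only its own cumulants
  -- occur, and these have bounds free of R.
  have hd : ∀ θ : ℝ, HasDerivAt (fun θ => var V (w θ) (w θ))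
      (2 * var V (w θ) (w θ) + cum₃ V (w θ) (w θ)) θ := by
    intro θ
    have h1 := hasDerivAt_mean hV (w := w) (g := w) (hwd θ) (hwd θ)
    have h2 := hasDerivAt_mean hV (w := w) (g := fun θ v => w θ v ^ 2) (hwd θ)
      (fun v hv => (hwd θ v hv).fun_pow 2)
    refine (h2.sub (h1.fun_pow 2)).congr_deriv ?_
    have e1 : (fun v => ((2 : ℕ) : ℝ) * w θ v ^ (2 - 1) * w θ v) = fun v => 2 * w θ v ^ 2 := by
      funext v; push_cast; ring
    have e2 : (fun v => w θ v ^ 2 * w θ v) = fun v => w θ v ^ 3 := by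
      funext v; ring
    have e3 : (fun v => w θ v * w θ v) = fun v => w θ v ^ 2 := by
      funext v; ring
    rw [e1, e2, e3, mean_const_mul, var, cum₃]
    push_cast
    ring
  have hb : ∀ θ : ℝ, |2 * var V (w θ) (w θ) + cum₃ V (w θ) (w θ)|
      ≤ 32 * Real.log N ^ 2 + 2 * Real.log N ^ 3 := by
    intro θ
    refine (abs_add_le _ _).trans ?_
    have h1 := var_self_le hV hN (w θ)
    have h2 := abs_cum₃_self_le hV hN (w θ)
    rw [abs_of_nonneg (by linarith [var_nonneg hV (w θ) (w θ)])]
    nlinarith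
  have h := convex_univ.norm_image_sub_le_of_norm_hasDerivWithin_le
    (fun θ _ => (hd θ).hasDerivWithinAt) (fun θ _ => hb θ) (Set.mem_univ (Real.log x))
    (Set.mem_univ (Real.log y))
  simp only [hw, Real.exp_log hx, Real.exp_log hy, Real.norm_eq_abs] at h
  rwa [Real.log_div hy.ne' hx.ne']

/-- The expectation of the exponent under a bounded perturbation of the exponent. -/
theorem abs_mean_self_sub_le (hV : V.Nonempty) {N : ℕ} (hN : V.card ≤ N) (w w' : ι → ℝ) {D : ℝ}
    (hD : ∀ v ∈ V, |w' v - w v| ≤ D) :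
    |mean V w' w' - mean V w w| ≤ D * (1 + 2 * Real.log N) := by
  set p : ℝ → ι → ℝ := fun s v => w v + s * (w' v - w v) with hp
  have hpd : ∀ s, ∀ v ∈ V, HasDerivAt (fun s => p s v) (w' v - w v) s := fun s v _ => by
    simpa only [one_mul, id] using ((hasDerivAt_id s).mul_const (w' v - w v)).const_add (w v)
  have hd := fun s => hasDerivAt_mean hV (w := p) (g := p) (hpd s) (hpd s)
  have hb : ∀ s, |mean V (p s) (fun v => w' v - w v)
      + (mean V (p s) (fun v => p s v * (w' v - w v))
        - mean V (p s) (p s) * mean V (p s) (fun v => w' v - w v))| ≤ D * (1 + 2 * Real.log N) := by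
    intro s
    refine (abs_add_le _ _).trans ?_
    rw [mul_add, mul_one]
    exact add_le_add (abs_mean_le hV hD) (abs_cov_le hV
      (by linarith [(log_nat_cases N).1]) hD (var_self_le hV hN _))
  have h := convex_univ.norm_image_sub_le_of_norm_hasDerivWithin_le
    (fun s _ => (hd s).hasDerivWithinAt) (fun s _ => hb s) (Set.mem_univ (0 : ℝ))
    (Set.mem_univ (1 : ℝ))
  have h0 : p 0 = w := by funext v; simp [hp]
  have h1 : p 1 = w' := by funext v; simp [hp]
  simpa [h0, h1] using h

/-! ### The learning rate control objective -/

/-- The objective `A log lam + log ∑ exp (lam R[v])`. -/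
noncomputable def objective (V : Finset ι) (A : ℝ) (R : ι → ℝ) (lam : ℝ) : ℝ :=
  A * Real.log lam + Real.log (partition V fun v => lam * R v)

/-- The derivative of the objective. -/
noncomputable def slope (V : Finset ι) (A : ℝ) (R : ι → ℝ) (lam : ℝ) : ℝ :=
  mean V (fun v => lam * R v) R + A / lam

/-- The first order conditions for a maximizer of the objective over `(0, η]`. -/
structure IsOpt (V : Finset ι) (A : ℝ) (R : ι → ℝ) (η l : ℝ) : Prop where
  pos : 0 < l
  le : l ≤ η
  slope_nonneg : 0 ≤ slope V A R l
  slope_eq : l < η → slope V A R l = 0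

theorem hasDerivAt_objective (hV : V.Nonempty) (A : ℝ) (R : ι → ℝ) {x : ℝ} (hx : 0 < x) :
    HasDerivAt (objective V A R) (slope V A R x) x := by
  have h1 := (Real.hasDerivAt_log hx.ne').const_mul A
  have h2 := hasDerivAt_log_partition hV (w := fun s v => s * R v) (w' := R) (s := x)
    (fun v _ => by simpa using (hasDerivAt_id x).mul_const (R v))
  refine (h1.add h2).congr_deriv ?_
  rw [slope, div_eq_mul_inv, add_comm]

theorem hasDerivAt_energy (hV : V.Nonempty) (R : ι → ℝ) (x : ℝ) :
    HasDerivAt (fun x => mean V (fun v => x * R v) R) (var V (fun v => x * R v) R) x := by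
  have h := hasDerivAt_mean hV (w := fun s v => s * R v) (w' := R) (g := fun _ => R)
    (g' := fun _ => 0) (s := x)
    (fun v _ => by simpa using (hasDerivAt_id x).mul_const (R v)) (fun v _ => hasDerivAt_const _ _)
  refine h.congr_deriv ?_
  have e : (fun v => R v * R v) = fun v => R v ^ 2 := by funext v; ring
  rw [mean_const hV, zero_add, e, var, sq (mean V _ R)]

theorem hasDerivAt_slope (hV : V.Nonempty) (A : ℝ) (R : ι → ℝ) {x : ℝ} (hx : 0 < x) :
    HasDerivAt (slope V A R) ((var V (fun v => x * R v) (fun v => x * R v) - A) / x ^ 2) x := by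
  have h := (hasDerivAt_energy hV R x).add ((hasDerivAt_inv hx.ne').const_mul A)
  refine (h.congr_deriv ?_)
  rw [var_const_mul]
  field_simp
  ring

/-- Concavity of the objective: x² times the derivative of the slope is Var(xR) - A. -/
theorem antitoneOn_slope (hV : V.Nonempty) {N : ℕ} (hN : V.card ≤ N) {A : ℝ}
    (hA : (2 * Real.log N) ^ 2 ≤ A) (R : ι → ℝ) : AntitoneOn (slope V A R) (Set.Ioi 0) := by
  refine antitoneOn_of_deriv_nonpos (convex_Ioi 0)
    (fun x hx => (hasDerivAt_slope hV A R hx).continuousAt.continuousWithinAt)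
    (fun x hx => (hasDerivAt_slope hV A R (interior_subset hx)).differentiableAt.differentiableWithinAt)
    fun x hx => ?_
  rw [(hasDerivAt_slope hV A R (interior_subset hx)).deriv]
  exact div_nonpos_of_nonpos_of_nonneg (by linarith [var_self_le hV hN fun v => x * R v])
    (sq_nonneg x)

/-- Monotonicity of the slope in the borderline case A = (2 log N)². -/
theorem energy_sub_le (hV : V.Nonempty) {N : ℕ} (hN : V.card ≤ N) (R : ι → ℝ) {x y : ℝ}
    (hx : 0 < x) (hxy : x ≤ y) :
    mean V (fun v => y * R v) R - mean V (fun v => x * R v) R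
      ≤ (2 * Real.log N) ^ 2 * (1 / x - 1 / y) := by
  have h := antitoneOn_slope hV hN le_rfl R hx (hx.trans_le hxy) hxy
  simp only [slope] at h
  have e : (2 * Real.log N) ^ 2 * (1 / x - 1 / y)
    = (2 * Real.log N) ^ 2 / x - (2 * Real.log N) ^ 2 / y := by ring
  rw [e]
  linarith

theorem objective_le_tangent (hV : V.Nonempty) {N : ℕ} (hN : V.card ≤ N) {A : ℝ}
    (hA : (2 * Real.log N) ^ 2 ≤ A) (R : ι → ℝ) {x y : ℝ} (hx : 0 < x) (hy : 0 < y) :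
    objective V A R y ≤ objective V A R x + slope V A R x * (y - x) := by
  have hanti := antitoneOn_slope hV hN hA R
  rcases lt_trichotomy x y with h | rfl | h
  · obtain ⟨ξ, hξ, he⟩ := exists_hasDerivAt_eq_slope (objective V A R) (slope V A R) h
      (fun z hz => (hasDerivAt_objective hV A R (hx.trans_le hz.1)).continuousAt.continuousWithinAt)
      (fun z hz => hasDerivAt_objective hV A R (hx.trans hz.1))
    have h1 := hanti hx (hx.trans hξ.1) hξ.1.le
    rw [he, div_le_iff₀ (by linarith)] at h1
    linarith
  · simp
  · obtain ⟨ξ, hξ, he⟩ := exists_hasDerivAt_eq_slope (objective V A R) (slope V A R) h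
      (fun z hz => (hasDerivAt_objective hV A R (hy.trans_le hz.1)).continuousAt.continuousWithinAt)
      (fun z hz => hasDerivAt_objective hV A R (hy.trans hz.1))
    have h1 := hanti (hy.trans hξ.1) hx hξ.2.le
    rw [he, le_div_iff₀ (by linarith)] at h1
    linarith

/-- Strong concavity: the part (2 log N)² log λ already makes the objective concave, and the
remaining multiple of log λ contributes its Bregman divergence exactly. -/
theorem IsOpt.objective_le (hV : V.Nonempty) {N : ℕ} (hN : V.card ≤ N) {A : ℝ} {R : ι → ℝ}
    {η l : ℝ} (h : IsOpt V A R η l) {y : ℝ} (hy : 0 < y) (hyη : y ≤ η) :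
    objective V A R y + (A - (2 * Real.log N) ^ 2) * (y / l - 1 - Real.log (y / l))
      ≤ objective V A R l := by
  have h1 := objective_le_tangent hV hN le_rfl R h.pos hy
  have h2 : slope V A R l * (y - l) ≤ 0 := by
    rcases h.le.lt_or_eq with hl | hl
    · rw [h.slope_eq hl, zero_mul]
    · exact mul_nonpos_of_nonneg_of_nonpos h.slope_nonneg (by linarith)
  have h3 : slope V ((2 * Real.log N) ^ 2) R l
      = slope V A R l - (A - (2 * Real.log N) ^ 2) / l := by
    simp only [slope]; ring
  have h4 : (A - (2 * Real.log N) ^ 2) / l * (y - l) = (A - (2 * Real.log N) ^ 2) * (y / l - 1) := by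
    have := h.pos.ne'
    field_simp
  rw [h3, sub_mul, h4] at h1
  simp only [objective] at h1 ⊢
  rw [Real.log_div hy.ne' h.pos.ne']
  nlinarith

theorem exists_isOpt (hV : V.Nonempty) {A : ℝ} (hA : 0 < A) (R : ι → ℝ) {η : ℝ} (hη : 0 < η) :
    ∃ l, IsOpt V A R η l := by
  by_cases h : 0 ≤ slope V A R η
  · exact ⟨η, hη, le_rfl, h, fun h => absurd h (lt_irrefl _)⟩
  obtain ⟨c, hc⟩ : ∃ c : ℝ, ∀ v ∈ V, |R v| ≤ c := ⟨V.sup' hV fun v => |R v|, fun v hv =>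
    le_sup' (fun v => |R v|) hv⟩
  have hc0 : 0 ≤ c := (abs_nonneg _).trans (hc _ hV.choose_spec)
  -- At this rate A / x ≥ c + 1 outweighs the mean of R, which is at least -c, so the intermediate
  -- value theorem applies between x and η.
  set x := min η (A / (c + 1)) with hx
  have hx0 : 0 < x := lt_min hη (by positivity)
  have h1 : 0 ≤ slope V A R x := by
    have h2 := (abs_le.1 (abs_mean_le hV (w := fun v => x * R v) hc)).1
    have h3 : c + 1 ≤ A / x := by
      rw [le_div_iff₀ hx0, mul_comm, ← le_div_iff₀ (by positivity)]
      exact min_le_right _ _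
    rw [slope]
    linarith
  obtain ⟨l, hl, hl0⟩ := intermediate_value_Icc' (f := slope V A R) (min_le_left _ _ : x ≤ η)
    (fun z hz => (hasDerivAt_slope hV A R (hx0.trans_le hz.1)).continuousAt.continuousWithinAt)
    ⟨(not_le.1 h).le, h1⟩
  exact ⟨l, hx0.trans_le hl.1, hl.2, hl0.ge, fun _ => hl0⟩

/-- Optimal learning rates move little when the regrets change by a bounded amount. -/
theorem IsOpt.drift (hV : V.Nonempty) {N : ℕ} (hN : V.card ≤ N) {A : ℝ} {R R' : ι → ℝ}
    {η l l' : ℝ} (h : IsOpt V A R η l) (h' : IsOpt V A R' η l')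
    (hA : 1 + 2 * Real.log N + 70 * Real.log N ^ 2 ≤ A) (hη : η ≤ 1 / 50)
    (hR : ∀ v ∈ V, |R' v - R v| ≤ 6) (hl : l ≤ l') :
    (1 + 2 * Real.log N) * (l' / l - 1) ≤ 3 / 25 := by
  obtain ⟨hℓ0, hℓ1⟩ := log_nat_cases N
  have hl0 := h.pos
  have hl0' := h'.pos
  rcases hl.eq_or_lt with rfl | hlt
  · rw [div_self hl0.ne']; norm_num
  -- Because the rate increases, the smaller optimum is below η and its slope vanishes, while the
  -- larger one may be at the cap.
  have h1 := h.slope_eq (hlt.trans_le h'.le)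
  have h2 := h'.slope_nonneg
  have h3 := energy_sub_le hV hN R hl0 hl
  have h4 := abs_mean_self_sub_le hV hN (fun v => l' * R v) (fun v => l' * R' v) (D := 6 * l')
    (fun v hv => by
      rw [← mul_sub, abs_mul, abs_of_pos hl0', mul_comm]
      exact mul_le_mul_of_nonneg_right (hR v hv) hl0'.le)
  rw [mean_const_mul, mean_const_mul] at h4
  have h5 := (abs_le.1 h4).2
  simp only [slope] at h1 h2
  set E := mean V (fun v => l' * R v) R
  set E' := mean V (fun v => l' * R' v) R'
  set E₀ := mean V (fun v => l * R v) R
  have h6 : 0 ≤ A + l' * E' := by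
    have : l' * (E' + A / l') = A + l' * E' := by field_simp; ring
    rw [← this]; positivity
  have h7 : l' * E₀ = - A * (l' / l) := by
    have : E₀ = - (A / l) := by linarith
    rw [this]; ring
  have h8 : l' * (E - E₀) ≤ (2 * Real.log N) ^ 2 * (l' / l - 1) := by
    have := mul_le_mul_of_nonneg_left h3 hl0'.le
    refine this.trans_eq ?_
    field_simp
  have h9 : (A - (2 * Real.log N) ^ 2) * (l' / l - 1) ≤ 6 * l' * (1 + 2 * Real.log N) := by
    nlinarith
  have h10 : 6 * l' * (1 + 2 * Real.log N) ≤ 3 / 25 * (1 + 2 * Real.log N) :=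
    mul_le_mul_of_nonneg_right (by linarith [h'.le]) (by linarith)
  have h11 : 0 ≤ l' / l - 1 := by
    rw [sub_nonneg, one_le_div hl0]; exact hl
  -- One factor 1 + 2 log N cancels against the perturbation bound, and the other remains as the
  -- gain in the conclusion. The 3/25 is 6 · 1/50.
  have h12 : (1 + 2 * Real.log N) * (1 + 2 * Real.log N) ≤ A - (2 * Real.log N) ^ 2 := by nlinarith
  have h13 := mul_le_mul_of_nonneg_right h12 h11
  have h14 : 0 < 1 + 2 * Real.log N := by linarith
  refine le_of_mul_le_mul_left ?_ h14
  linarith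

/-! ### Newton's method -/

/-- In the variable τ = 1/λ the slope has derivative A - Var(R/τ). It is therefore nearly affine in
τ, with error governed by the Lipschitz bound for the variance in log λ. -/
theorem abs_slope_sub_le (hV : V.Nonempty) {N : ℕ} (hN : V.card ≤ N) (A : ℝ) (R : ι → ℝ) {x l : ℝ}
    (hx : 0 < x) (hl : 0 < l) :
    |slope V A R x - slope V A R l
        - (A - var V (fun v => x * R v) (fun v => x * R v)) * (1 / x - 1 / l)|
      ≤ (32 * Real.log N ^ 2 + 2 * Real.log N ^ 3) * |Real.log (x / l)| * |1 / x - 1 / l| := by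
  have hℓ := (log_nat_cases N).1
  set p := A - var V (fun v => x * R v) (fun v => x * R v) with hp
  have hpos : ∀ τ ∈ Set.uIcc (1 / l) (1 / x), 0 < τ := fun τ hτ =>
    (lt_min (by positivity) (by positivity)).trans_le hτ.1
  have hd : ∀ τ ∈ Set.uIcc (1 / l) (1 / x), HasDerivWithinAt (fun τ => slope V A R τ⁻¹ - p * τ)
      (A - var V (fun v => τ⁻¹ * R v) (fun v => τ⁻¹ * R v) - p) (Set.uIcc (1 / l) (1 / x)) τ := by
    intro τ hτ
    have h0 := hpos τ hτ
    have h1 := (hasDerivAt_slope hV A R (inv_pos.2 h0)).comp τ (hasDerivAt_inv h0.ne')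
    refine ((h1.sub ((hasDerivAt_id τ).const_mul p)).congr_deriv ?_).hasDerivWithinAt
    field_simp
    ring
  have hb : ∀ τ ∈ Set.uIcc (1 / l) (1 / x),
      ‖A - var V (fun v => τ⁻¹ * R v) (fun v => τ⁻¹ * R v) - p‖
        ≤ (32 * Real.log N ^ 2 + 2 * Real.log N ^ 3) * |Real.log (x / l)| := by
    intro τ hτ
    have h0 := hpos τ hτ
    have h1 := abs_var_sub_var_le hV hN R (inv_pos.2 h0) hx
    have e : A - var V (fun v => τ⁻¹ * R v) (fun v => τ⁻¹ * R v) - p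
      = var V (fun v => x * R v) (fun v => x * R v)
        - var V (fun v => τ⁻¹ * R v) (fun v => τ⁻¹ * R v) := by rw [hp]; ring
    rw [Real.norm_eq_abs, e]
    refine h1.trans (mul_le_mul_of_nonneg_left ?_ (by positivity))
    have hτ' : Real.log τ ∈ Set.uIcc (Real.log (1 / l)) (Real.log (1 / x)) := by
      rcases le_total (1 / l) (1 / x) with hle | hle
      · rw [Set.uIcc_of_le hle] at hτ
        exact Set.mem_uIcc_of_le (Real.log_le_log (by positivity) hτ.1) (Real.log_le_log h0 hτ.2)
      · rw [Set.uIcc_of_ge hle] at hτ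
        exact Set.mem_uIcc_of_ge (Real.log_le_log (by positivity) hτ.1) (Real.log_le_log h0 hτ.2)
    have := Set.abs_sub_right_of_mem_uIcc hτ'
    rw [Real.log_div hx.ne' (inv_pos.2 h0).ne', Real.log_div hx.ne' hl.ne', Real.log_inv]
    rw [one_div, one_div, Real.log_inv, Real.log_inv] at this
    have e1 : |Real.log x - -Real.log τ| = |-Real.log x - Real.log τ| := by
      rw [← abs_neg]; congr 1; ring
    have e2 : |Real.log x - Real.log l| = |-Real.log x - -Real.log l| := by
      rw [← abs_neg]; congr 1; ring
    rw [e1, e2]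
    exact this
  have h := (convex_uIcc (1 / l) (1 / x)).norm_image_sub_le_of_norm_hasDerivWithin_le hd hb
    Set.left_mem_uIcc Set.right_mem_uIcc
  simp only [one_div, inv_inv, Real.norm_eq_abs] at h ⊢
  convert h using 2
  ring

/-- Quadratic convergence of Newton's method, with steps cut off at `η`. -/
theorem IsOpt.newton (hV : V.Nonempty) {N : ℕ} (hN : V.card ≤ N) {A : ℝ} {R : ι → ℝ}
    {η l x : ℝ} (h : IsOpt V A R η l)
    (hA : 1 + 2 * Real.log N + 70 * Real.log N ^ 2 ≤ A)
    (hx : (1 + 2 * Real.log N) * |x - l| ≤ l / 4) :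
    (1 + 2 * Real.log N) * |min η (x - slope V A R x / (var V (fun v => x * R v) R - A / x ^ 2)) - l|
        * l ≤ ((1 + 2 * Real.log N) * |x - l|) ^ 2 := by
  obtain ⟨hℓ0, hℓ1⟩ := log_nat_cases N
  set ℓ := Real.log N
  have hl := h.pos
  have hxl : |x - l| ≤ l / 4 := by nlinarith [abs_nonneg (x - l)]
  obtain ⟨hxl1, hxl2⟩ := abs_le.1 hxl
  have hx0 : 0 < x := by linarith
  have hs := abs_slope_sub_le hV hN A R hx0 hl
  have hv := var_self_le hV hN fun v => x * R v
  have hvx := var_const_mul (V := V) (fun v => x * R v) R x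
  set p := A - var V (fun v => x * R v) (fun v => x * R v) with hp
  have hp1 : 1 + 2 * ℓ + 66 * ℓ ^ 2 ≤ p := by nlinarith
  have hp0 : 0 < p := by nlinarith
  have hstep : x - slope V A R x / (var V (fun v => x * R v) R - A / x ^ 2)
      = x + x ^ 2 * slope V A R x / p := by
    have e : var V (fun v => x * R v) R - A / x ^ 2 = - (p / x ^ 2) := by
      rw [hp, hvx]; field_simp; ring
    rw [e]
    field_simp
    ring
  rw [hstep]
  -- The Newton step as if the slope vanished at l. If l = η, the nonnegative slope there only moves
  -- the true step further up, and the cut-off at η cannot increase the distance to l.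
  set y := x + x ^ 2 * (slope V A R x - slope V A R l) / p with hy
  have hmin : |min η (x + x ^ 2 * slope V A R x / p) - l| ≤ |y - l| := by
    rcases h.le.lt_or_eq with hlt | heq
    · have : x + x ^ 2 * slope V A R x / p = y := by rw [hy, h.slope_eq hlt, sub_zero]
      rw [this]
      rcases le_total η y with hη | hη
      · rw [min_eq_left hη, abs_of_nonneg (by linarith), abs_of_nonneg (by linarith)]
        linarith
      · rw [min_eq_right hη]
    · have hyx : y ≤ x + x ^ 2 * slope V A R x / p := by
        rw [hy]
        have := h.slope_nonneg
        gcongr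
        linarith
      rw [← heq]
      rcases le_total l (x + x ^ 2 * slope V A R x / p) with hη | hη
      · rw [min_eq_left hη, sub_self, abs_zero]; exact abs_nonneg _
      · rw [min_eq_right hη, abs_of_nonpos (by linarith), abs_of_nonpos (by linarith)]
        linarith
  have hlog : x * |Real.log (x / l)| ≤ 5 / 4 * |x - l| := by
    rcases le_total l x with hle | hle
    · have h1 : 0 ≤ Real.log (x / l) := Real.log_nonneg ((one_le_div hl).2 hle)
      have h2 : Real.log (x / l) ≤ x / l - 1 := Real.log_le_sub_one_of_pos (by positivity)
      have h3 : x * (x / l - 1) = x / l * (x - l) := by field_simp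
      have h4 : x / l ≤ 5 / 4 := by rw [div_le_iff₀ hl]; linarith
      rw [abs_of_nonneg h1, abs_of_nonneg (by linarith)]
      calc x * Real.log (x / l) ≤ x / l * (x - l) := by
            rw [← h3]; exact mul_le_mul_of_nonneg_left h2 hx0.le
        _ ≤ _ := mul_le_mul_of_nonneg_right h4 (by linarith)
    · have h1 : Real.log (x / l) ≤ 0 := Real.log_nonpos (by positivity) ((div_le_one hl).2 hle)
      have h2 : Real.log (l / x) ≤ l / x - 1 := Real.log_le_sub_one_of_pos (by positivity)
      have h3 : x * (l / x - 1) = l - x := by field_simp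
      have h4 : Real.log (l / x) = - Real.log (x / l) := by rw [← Real.log_inv, inv_div]
      rw [h4] at h2
      rw [abs_of_nonpos h1, abs_of_nonpos (by linarith)]
      have := mul_le_mul_of_nonneg_left h2 hx0.le
      linarith
  set B := 32 * ℓ ^ 2 + 2 * ℓ ^ 3 with hB
  have hB0 : 0 ≤ B := by positivity
  set Δ := slope V A R x - slope V A R l - p * (1 / x - 1 / l) with hΔ
  -- A slope that is exactly affine in 1/λ would leave the error -(x - l)² / l; Δ is the deviation
  -- from that.
  have hyl : y - l = - ((x - l) ^ 2 / l) + x ^ 2 * Δ / p := by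
    have e : slope V A R x - slope V A R l = Δ + p * (1 / x - 1 / l) := by rw [hΔ]; ring
    rw [hy, e]
    field_simp
    ring
  have hinv : x * |1 / x - 1 / l| = |x - l| / l := by
    have : 1 / x - 1 / l = -(x - l) / (x * l) := by field_simp; ring
    rw [this, abs_div, abs_neg, abs_of_pos (mul_pos hx0 hl)]
    field_simp
  have hΔ2 : |x ^ 2 * Δ / p| ≤ (x - l) ^ 2 / l * (2 * ℓ) := by
    rw [abs_div, abs_mul, abs_of_pos hp0, abs_of_pos (pow_pos hx0 2), div_le_iff₀ hp0]
    calc x ^ 2 * |Δ| ≤ x ^ 2 * (B * |Real.log (x / l)| * |1 / x - 1 / l|) :=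
          mul_le_mul_of_nonneg_left hs (by positivity)
      _ = B * (x * |Real.log (x / l)|) * (x * |1 / x - 1 / l|) := by ring
      _ ≤ B * (5 / 4 * |x - l|) * (|x - l| / l) := by
          rw [hinv]
          gcongr
      _ = (x - l) ^ 2 / l * (5 / 4 * B) := by rw [← sq_abs (x - l)]; ring
      _ ≤ (x - l) ^ 2 / l * (2 * ℓ * p) := by
          -- The cubic Lipschitz constant B is dominated because p already contains 66 log² N.
          refine mul_le_mul_of_nonneg_left ?_ (by positivity)
          have : 2 * ℓ * (1 + 2 * ℓ + 66 * ℓ ^ 2) ≤ 2 * ℓ * p := by gcongr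
          nlinarith [mul_le_mul_of_nonneg_left hℓ1 hℓ0, pow_nonneg hℓ0 3]
      _ = (x - l) ^ 2 / l * (2 * ℓ) * p := by ring
  have hfin : |y - l| ≤ (x - l) ^ 2 / l * (1 + 2 * ℓ) := by
    rw [hyl]
    refine (abs_add_le _ _).trans ?_
    rw [abs_neg, abs_of_nonneg (by positivity)]
    linarith
  calc (1 + 2 * ℓ) * |min η (x + x ^ 2 * slope V A R x / p) - l| * l
      ≤ (1 + 2 * ℓ) * ((x - l) ^ 2 / l * (1 + 2 * ℓ)) * l := by
        gcongr
        exact hmin.trans hfin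
    _ = ((1 + 2 * ℓ) * |x - l|) ^ 2 := by
        rw [mul_pow, sq_abs]; field_simp

end Gibbs

/-! ### Invariance under constant shifts of the exponent -/

namespace Gibbs

variable {ι : Type*} {V : Finset ι}

theorem weight_add_const (w : ι → ℝ) (c : ℝ) :
    weight V (fun v => w v + c) = weight V w := by
  funext v
  simp only [weight, partition, Real.exp_add]
  rw [← sum_mul, mul_div_mul_right _ _ (Real.exp_pos c).ne']

theorem mean_add_const (w g : ι → ℝ) (c : ℝ) :
    mean V (fun v => w v + c) g = mean V w g := by
  simp only [mean, weight_add_const]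

end Gibbs

/-! ### Values and costs of programs -/

namespace KernelProg

variable {d : ℕ} {α γ : Type} (K : (Fin d → ℝ) → (Fin d → ℝ) → ℝ)

theorem value_bind (p : KernelProg d α) (f : α → KernelProg d γ) :
    (p.bind f).value K = (f (p.value K)).value K := by
  induction p with
  | ret a => rfl
  | query x y next ih => exact ih _

theorem evals_bind (p : KernelProg d α) (f : α → KernelProg d γ) :
    (p.bind f).evals K = p.evals K + (f (p.value K)).evals K := by
  induction p with
  | ret a => simp [bind, evals, value]
  | query x y next ih =>
    simp only [bind, evals, value, ih]
    omega

theorem value_collect (m : ℕ) (p : Fin m → KernelProg d α) :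
    (collect m p).value K = fun i => (p i).value K := by
  induction m with
  | zero => funext i; exact i.elim0
  | succ m ih =>
    simp only [collect, value_bind, value, ih]
    funext i
    refine Fin.cases ?_ (fun i => ?_) i <;> simp

theorem evals_collect (m : ℕ) (p : Fin m → KernelProg d α) :
    (collect m p).evals K = ∑ i, (p i).evals K := by
  induction m with
  | zero => simp [collect, evals]
  | succ m ih =>
    simp only [collect, evals_bind, evals, ih, Fin.sum_univ_succ, add_zero]

end KernelProg

/-! ### The moments computed from the kernel -/

namespace ZeroOnePolytope

variable {d : ℕ} (Ω : ZeroOnePolytope d)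

theorem feature_eBar {v : Fin d → ℝ} (hv : v ∈ Ω.verts) (i : Fin d) :
    feature (KDLRC.eBar i) v = 1 - v i := by
  unfold feature KDLRC.eBar
  rcases Ω.zero_one v hv i with h | h
  · rw [h, sub_zero]
    refine prod_eq_one fun k hk => if_neg ?_
    rintro rfl
    simp [h] at hk
  · rw [h, sub_self]
    exact prod_eq_zero (i := i) (by simp [h]) (by simp)

/-- Features are multiplicative in their first argument. Expanding the product yields the second
moments by inclusion–exclusion. -/
theorem feature_eBar₂ {v : Fin d → ℝ} (hv : v ∈ Ω.verts) (i j : Fin d) :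
    feature (KDLRC.eBar₂ i j) v = (1 - v i) * (1 - v j) := by
  rw [← feature_eBar Ω hv, ← feature_eBar Ω hv]
  unfold feature KDLRC.eBar KDLRC.eBar₂
  rw [← prod_mul_distrib]
  refine prod_congr rfl fun k _ => ?_
  by_cases h1 : k = i <;> by_cases h2 : k = j <;> simp [h1, h2]

theorem feature_bVec {v : Fin d → ℝ} (hv : v ∈ Ω.verts) (lam : ℝ) (μ : Fin d → ℝ) :
    feature (KDLRC.bVec lam μ) v = Real.exp (lam * (μ ⬝ᵥ v)) := by
  unfold feature KDLRC.bVec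
  rw [← Real.exp_sum, sum_filter, dotProduct, mul_sum]
  congr 1
  refine sum_congr rfl fun k _ => ?_
  rcases Ω.zero_one v hv k with h | h <;> simp [h]

/-- Kernel evaluations against indicators are expectations. -/
theorem kernel_bVec_div {lam : ℝ} {μ x : Fin d → ℝ} :
    Ω.kernel (KDLRC.bVec lam μ) x / Ω.kernel (KDLRC.bVec lam μ) (fun _ => 1)
      = Gibbs.mean Ω.verts (fun v => lam * (μ ⬝ᵥ v)) (feature x) := by
  have h1 : Ω.kernel (KDLRC.bVec lam μ) (fun _ => 1)
      = Gibbs.partition Ω.verts fun v => lam * (μ ⬝ᵥ v) := by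
    refine sum_congr rfl fun v hv => ?_
    rw [feature_bVec Ω hv]
    simp [feature]
  rw [h1, Gibbs.mean, kernel, sum_div]
  refine sum_congr rfl fun v hv => ?_
  rw [feature_bVec Ω hv, Gibbs.weight]
  ring

theorem kernel_eBar_div (lam : ℝ) (μ : Fin d → ℝ) (i : Fin d) :
    Ω.kernel (KDLRC.bVec lam μ) (KDLRC.eBar i) / Ω.kernel (KDLRC.bVec lam μ) (fun _ => 1)
      = 1 - Gibbs.mean Ω.verts (fun v => lam * (μ ⬝ᵥ v)) (fun v => v i) := by
  rw [kernel_bVec_div, Gibbs.mean_congr fun v hv => Ω.feature_eBar hv i, Gibbs.mean_sub,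
    Gibbs.mean_const Ω.nonempty]

theorem kernel_eBar₂_div (lam : ℝ) (μ : Fin d → ℝ) (i j : Fin d) :
    Ω.kernel (KDLRC.bVec lam μ) (KDLRC.eBar₂ i j) / Ω.kernel (KDLRC.bVec lam μ) (fun _ => 1)
      = 1 - Gibbs.mean Ω.verts (fun v => lam * (μ ⬝ᵥ v)) (fun v => v i)
        - Gibbs.mean Ω.verts (fun v => lam * (μ ⬝ᵥ v)) (fun v => v j)
        + Gibbs.mean Ω.verts (fun v => lam * (μ ⬝ᵥ v)) (fun v => v i * v j) := by
  have h : ∀ v ∈ Ω.verts, feature (KDLRC.eBar₂ i j) v = ((1 - v i) - v j) + v i * v j :=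
    fun v hv => by rw [Ω.feature_eBar₂ hv]; ring
  rw [kernel_bVec_div, Gibbs.mean_congr h, Gibbs.mean_add, Gibbs.mean_sub, Gibbs.mean_sub,
    Gibbs.mean_const Ω.nonempty]

end ZeroOnePolytope

/-! ### What the programs of a round compute and cost -/

namespace KDLRC

variable {d : ℕ} (Ω : ZeroOnePolytope d)

theorem value_meanProgram (lam : ℝ) (μ : Fin d → ℝ) :
    (meanProgram (bVec lam μ)).value Ω.kernel
      = fun i => Gibbs.mean Ω.verts (fun v => lam * (μ ⬝ᵥ v)) (fun v => v i) := by
  simp only [meanProgram, KernelProg.value, KernelProg.value_bind, KernelProg.value_collect,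
    Ω.kernel_eBar_div]
  funext i; ring

theorem evals_meanProgram (b : Fin d → ℝ) : (meanProgram b).evals Ω.kernel = d + 1 := by
  simp [meanProgram, KernelProg.evals, KernelProg.evals_bind, KernelProg.evals_collect]

theorem value_momentProgram (lam : ℝ) (μ : Fin d → ℝ) :
    (momentProgram (bVec lam μ)).value Ω.kernel
      = (fun i => Gibbs.mean Ω.verts (fun v => lam * (μ ⬝ᵥ v)) (fun v => v i),
        fun i j => Gibbs.mean Ω.verts (fun v => lam * (μ ⬝ᵥ v)) (fun v => v i * v j)) := by
  simp only [momentProgram, KernelProg.value, KernelProg.value_bind, KernelProg.value_collect,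
    Ω.kernel_eBar_div]
  refine congrArg₂ Prod.mk (by funext i; ring) (Matrix.ext fun i j => ?_)
  by_cases h : i = j
  · subst h
    rw [if_pos rfl, sub_sub_cancel]
    refine Gibbs.mean_congr fun v hv => ?_
    rcases Ω.zero_one v hv i with h | h <;> simp [h]
  · simp only [if_neg h, KernelProg.value, Ω.kernel_eBar₂_div]
    ring

theorem evals_momentProgram (b : Fin d → ℝ) :
    (momentProgram b).evals Ω.kernel = d ^ 2 + 1 := by
  have h : ∀ i j : Fin d, (if i = j then KernelProg.ret 0
      else KernelProg.query b (eBar₂ i j) KernelProg.ret : KernelProg d ℝ).evals Ω.kernel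
      = if i = j then 0 else 1 := by
    intro i j
    split_ifs <;> rfl
  have h2 : ∀ i : Fin d, ∑ j : Fin d, (if i = j then 0 else 1) = d - 1 := by
    intro i
    have : ∀ j : Fin d, (if i = j then 0 else 1) = if i ≠ j then 1 else 0 := fun j => by
      split_ifs <;> simp_all
    simp only [this, sum_boole]
    rw [filter_ne]
    simp
  simp only [momentProgram, KernelProg.evals, KernelProg.evals_bind, KernelProg.evals_collect, h,
    h2, sum_const, card_univ, Fintype.card_fin, smul_eq_mul]
  -- The count is 1 + d + d (d - 1), where d - 1 is truncated subtraction.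
  rcases d with _ | d
  · simp
  · simp only [Nat.add_sub_cancel]; ring

theorem dotProduct_mean (w : (Fin d → ℝ) → ℝ) (μ : Fin d → ℝ) :
    (μ ⬝ᵥ fun i => Gibbs.mean Ω.verts w (fun v => v i)) = Gibbs.mean Ω.verts w (fun v => μ ⬝ᵥ v) := by
  simp only [dotProduct, Gibbs.mean, mul_sum]
  rw [sum_comm]
  exact sum_congr rfl fun v _ => sum_congr rfl fun i _ => by ring

/-- The program weighs vertices by exp(λ⟨μ, v⟩) without σ; the shift λσ cancels in the weights, and
σ cancels in the variance. -/
theorem value_newtonStep (P : KDLRCParams) (μ : Fin d → ℝ) (σ lam : ℝ) :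
    (newtonStep P μ σ lam).value Ω.kernel
      = min P.η (lam - Gibbs.slope Ω.verts (P.α - 1) (fun v => μ ⬝ᵥ v + σ) lam
          / (Gibbs.var Ω.verts (fun v => lam * (μ ⬝ᵥ v + σ)) (fun v => μ ⬝ᵥ v + σ)
            - (P.α - 1) / lam ^ 2)) := by
  have hw : (fun v => lam * (μ ⬝ᵥ v + σ)) = fun v => lam * (μ ⬝ᵥ v) + lam * σ := by
    funext v; ring
  have h2 : (μ ⬝ᵥ ((fun i j => Gibbs.mean Ω.verts (fun v => lam * (μ ⬝ᵥ v))
      (fun v => v i * v j) : Matrix (Fin d) (Fin d) ℝ) *ᵥ μ)) = Gibbs.mean Ω.verts (fun v => lam * (μ ⬝ᵥ v))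
        (fun v => (μ ⬝ᵥ v) ^ 2) := by
    simp only [Matrix.mulVec, dotProduct, Gibbs.mean, mul_sum, sum_mul, sq]
    rw [sum_congr rfl fun i _ => sum_comm, sum_comm]
    exact sum_congr rfl fun v _ => sum_congr rfl fun i _ => sum_congr rfl fun j _ => by ring
  have h3 : (fun v => (μ ⬝ᵥ v + σ) ^ 2)
      = fun v => ((μ ⬝ᵥ v) ^ 2 + 2 * σ * (μ ⬝ᵥ v)) + σ ^ 2 := by
    funext v; ring
  simp only [newtonStep, KernelProg.value_bind, KernelProg.value, value_momentProgram]
  rw [dotProduct_mean]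
  simp only [Gibbs.slope, Gibbs.var]
  rw [hw]
  simp only [Gibbs.mean_add_const]
  rw [h3, Gibbs.mean_add, Gibbs.mean_add, Gibbs.mean_add, Gibbs.mean_const_mul,
    Gibbs.mean_const Ω.nonempty, Gibbs.mean_const Ω.nonempty, ← h2]
  congr 3
  ring

theorem evals_newtonStep (P : KDLRCParams) (μ : Fin d → ℝ) (σ lam : ℝ) :
    (newtonStep P μ σ lam).evals Ω.kernel = d ^ 2 + 1 := by
  simp [newtonStep, KernelProg.evals_bind, evals_momentProgram, KernelProg.evals]

/-- The Newton loop stops after at most `j + 1` passes, where `2 ^ j` is of the order of `log T`,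
and its result is accurate. -/
theorem newtonLoop_spec (P : KDLRCParams) (hcard : Ω.verts.card ≤ P.N) (hT : 1 ≤ P.T)
    (hA : 1 + 2 * Real.log P.N + 70 * Real.log P.N ^ 2 ≤ P.α - 1) {μ : Fin d → ℝ} {σ l : ℝ}
    (h : Gibbs.IsOpt Ω.verts (P.α - 1) (fun v => μ ⬝ᵥ v + σ) P.η l) :
    ∀ (j m : ℕ) (lam : ℝ), j + 1 ≤ m → (1 + 2 * Real.log P.N) * |lam - l| ≤ l / 4 →
      ((1 + 2 * Real.log P.N) * |lam - l| / l) ^ (2 ^ j) ≤ 3 / (4 * P.T) →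
      ∃ k ≤ j + 1, (newtonLoop P μ σ m lam).evals Ω.kernel = (d ^ 2 + 1) * k ∧
        (1 + 2 * Real.log P.N) * |(newtonLoop P μ σ m lam).value Ω.kernel - l| ≤ l / 16 ∧
        |(newtonLoop P μ σ m lam).value Ω.kernel - l| ≤ l / P.T := by
  have hℓ := (Gibbs.log_nat_cases P.N).1
  have hl := h.pos
  have hT0 : (1 : ℝ) ≤ P.T := by exact_mod_cast hT
  have key : ∀ lam : ℝ, (1 + 2 * Real.log P.N) * |lam - l| ≤ l / 4 →
      (1 + 2 * Real.log P.N) * |(newtonStep P μ σ lam).value Ω.kernel - l| * l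
        ≤ ((1 + 2 * Real.log P.N) * |lam - l|) ^ 2 := by
    intro lam hlam
    rw [value_newtonStep]
    exact h.newton Ω.nonempty hcard hA hlam
  set κ := 1 + 2 * Real.log P.N with hκ
  have hκ1 : 1 ≤ κ := by linarith
  intro j
  induction j with
  | zero =>
    intro m lam hm hlam hj
    obtain ⟨m, rfl⟩ : ∃ m', m = m' + 1 := ⟨m - 1, by omega⟩
    have hk := key lam hlam
    set lam' := (newtonStep P μ σ lam).value Ω.kernel with hlam'
    have hb : κ * |lam' - l| ≤ l / 16 := by
      refine le_of_mul_le_mul_right ?_ hl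
      nlinarith [mul_nonneg (by linarith : 0 ≤ κ) (abs_nonneg (lam - l))]
    have he : |lam' - l| ≤ |lam - l| / 4 := by
      have : κ * l * |lam' - l| ≤ κ * l * (|lam - l| / 4) := by
        nlinarith [mul_le_mul_of_nonneg_left hlam
          (mul_nonneg (by linarith : 0 ≤ κ) (abs_nonneg (lam - l)))]
      exact le_of_mul_le_mul_left this (by positivity)
    -- The error before this pass is at most 3l/(4T) and shrinks by a factor 4. The step is thus at
    -- most 15l/(16T) ≤ lam'/T, which triggers the stopping test.
    rw [pow_zero, pow_one, div_le_div_iff₀ hl (by positivity)] at hj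
    have hj' : |lam - l| * (4 * P.T) ≤ 3 * l := by
      refine le_trans ?_ hj
      nlinarith [mul_nonneg (abs_nonneg (lam - l)) (by linarith : 0 ≤ 4 * (P.T : ℝ))]
    have hb2 : |lam' - l| ≤ l / 16 := by nlinarith [abs_nonneg (lam' - l)]
    have hclose : |lam' - lam| ≤ lam' / P.T := by
      rw [le_div_iff₀ (by linarith)]
      have h1 : |lam' - lam| ≤ |lam' - l| + |lam - l| := by
        have := abs_sub_le lam' l lam
        rwa [abs_sub_comm l lam] at this
      have h2 := (abs_le.1 hb2).1
      nlinarith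
    have hval : (newtonLoop P μ σ (m + 1) lam).value Ω.kernel = lam' := by
      simp only [newtonLoop, KernelProg.value_bind, ← hlam', if_pos hclose, KernelProg.value]
    have hev : (newtonLoop P μ σ (m + 1) lam).evals Ω.kernel = d ^ 2 + 1 := by
      simp only [newtonLoop, KernelProg.evals_bind, ← hlam', if_pos hclose, KernelProg.evals,
        evals_newtonStep, add_zero]
    rw [hval, hev]
    refine ⟨1, le_rfl, by ring, hb, ?_⟩
    rw [le_div_iff₀ (by linarith)]
    nlinarith
  | succ j ih =>
    intro m lam hm hlam hj
    obtain ⟨m, rfl⟩ : ∃ m', m = m' + 1 := ⟨m - 1, by omega⟩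
    have hk := key lam hlam
    set lam' := (newtonStep P μ σ lam).value Ω.kernel with hlam'
    have hb : κ * |lam' - l| ≤ l / 16 := by
      refine le_of_mul_le_mul_right ?_ hl
      nlinarith [mul_nonneg (by linarith : 0 ≤ κ) (abs_nonneg (lam - l))]
    have he : |lam' - l| ≤ |lam - l| / 4 := by
      have : κ * l * |lam' - l| ≤ κ * l * (|lam - l| / 4) := by
        nlinarith [mul_le_mul_of_nonneg_left hlam
          (mul_nonneg (by linarith : 0 ≤ κ) (abs_nonneg (lam - l)))]
      exact le_of_mul_le_mul_left this (by positivity)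
    have hb2 : |lam' - l| ≤ l / 16 := by nlinarith [abs_nonneg (lam' - l)]
    by_cases hclose : |lam' - lam| ≤ lam' / P.T
    · have hval : (newtonLoop P μ σ (m + 1) lam).value Ω.kernel = lam' := by
        simp only [newtonLoop, KernelProg.value_bind, ← hlam', if_pos hclose, KernelProg.value]
      have hev : (newtonLoop P μ σ (m + 1) lam).evals Ω.kernel = d ^ 2 + 1 := by
        simp only [newtonLoop, KernelProg.evals_bind, ← hlam', if_pos hclose, KernelProg.evals,
          evals_newtonStep, add_zero]
      rw [hval, hev]
      refine ⟨1, by omega, by ring, hb, ?_⟩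
      rw [le_div_iff₀ (by linarith)] at hclose ⊢
      -- An early stop is also accurate: since the pass shrinks the error by 4, the new error is at
      -- most a third of the step.
      have h1 : |lam - l| ≤ |lam' - lam| + |lam' - l| := by
        have := abs_sub_le lam lam' l
        rwa [abs_sub_comm lam lam'] at this
      have h2 := (abs_le.1 hb2).2
      nlinarith
    · have hval : (newtonLoop P μ σ (m + 1) lam).value Ω.kernel
          = (newtonLoop P μ σ m lam').value Ω.kernel := by
        simp only [newtonLoop, KernelProg.value_bind, ← hlam', if_neg hclose]
      have hev : (newtonLoop P μ σ (m + 1) lam).evals Ω.kernel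
          = d ^ 2 + 1 + (newtonLoop P μ σ m lam').evals Ω.kernel := by
        simp only [newtonLoop, KernelProg.evals_bind, ← hlam', if_neg hclose,
          evals_newtonStep]
      have hpow : (κ * |lam' - l| / l) ^ (2 ^ j) ≤ 3 / (4 * P.T) := by
        refine le_trans ?_ hj
        rw [pow_succ' 2 j, pow_mul]
        refine pow_le_pow_left₀ (by positivity) ?_ _
        rw [div_pow, div_le_div_iff₀ hl (by positivity)]
        nlinarith
      obtain ⟨k, hk1, hk2, hk3, hk4⟩ := ih m lam' (by omega) (by linarith) hpow
      rw [hval, hev, hk2]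
      exact ⟨k + 1, by omega, by ring, hk3, hk4⟩

end KDLRC

/-- Doubly exponential growth reaches `T` after `O(log log T)` steps. -/
theorem exists_le_two_pow_two_pow {T : ℕ} (hT : 3 ≤ T) :
    ∃ j : ℕ, (T : ℝ) ≤ 2 ^ (2 ^ j) ∧ ((j : ℝ) + 1) ≤ 50 * Real.log (Real.log T) := by
  have hl2 := Real.log_two_gt_d9
  have hl3 : (1.09 : ℝ) ≤ Real.log 3 := by
    have h1 : Real.exp 1 ^ 109 ≤ 3 ^ 100 :=
      (pow_le_pow_left₀ (Real.exp_pos 1).le Real.exp_one_lt_d9.le 109).trans (by norm_num)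
    have h2 := Real.log_le_log (by positivity) h1
    rw [Real.log_pow, Real.log_pow, Real.log_exp] at h2
    push_cast at h2
    linarith
  have hT3 : Real.log 3 ≤ Real.log T :=
    Real.log_le_log (by norm_num) (by exact_mod_cast hT)
  have hlT : 0 < Real.log T := by linarith
  set x := Real.log (Real.log T) with hx
  have hx0 : 0.08 ≤ x := by
    have h1 := Real.one_sub_inv_le_log_of_pos hlT
    have h2 : (Real.log T)⁻¹ ≤ 0.92 := by
      rw [inv_le_comm₀ hlT (by norm_num)]
      norm_num
      linarith
    linarith
  -- The extra 1/2 supplies a factor e^(1/2) ≥ 3/2, which compensates log 2 < 1. The constant 50 is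
  -- needed because log log T is barely positive at T = 3.
  refine ⟨⌈(x + 1 / 2) / Real.log 2⌉₊, ?_, ?_⟩
  · set j := ⌈(x + 1 / 2) / Real.log 2⌉₊
    have h1 : x + 1 / 2 ≤ j * Real.log 2 := by
      rw [← div_le_iff₀ (by linarith)]
      exact Nat.le_ceil _
    have h2 : Real.log T * (3 / 2) ≤ 2 ^ j := by
      calc Real.log T * (3 / 2) ≤ Real.exp x * Real.exp (1 / 2) := by
            rw [hx, Real.exp_log hlT]
            refine mul_le_mul_of_nonneg_left ?_ hlT.le
            linarith [Real.add_one_le_exp (1 / 2 : ℝ)]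
        _ = Real.exp (x + 1 / 2) := (Real.exp_add _ _).symm
        _ ≤ Real.exp (j * Real.log 2) := Real.exp_le_exp.2 h1
        _ = 2 ^ j := by rw [Real.exp_nat_mul, Real.exp_log two_pos]
    have h3 : Real.log T ≤ ((2 ^ j : ℕ) : ℝ) * Real.log 2 := by
      push_cast
      nlinarith
    rw [← Real.log_pow] at h3
    exact (Real.log_le_log_iff (by positivity) (by positivity)).1 h3
  · have h1 := (Nat.ceil_lt_add_one (a := (x + 1 / 2) / Real.log 2) (by positivity)).le
    have h2 : (x + 1 / 2) / Real.log 2 ≤ 1.5 * (x + 1 / 2) := by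
      rw [div_le_iff₀ (by linarith)]
      nlinarith
    linarith

/-! ### The one-round potential inequality -/

namespace Gibbs

variable {ι : Type*} {V : Finset ι}

theorem abs_mean_sub_mean_le (w w' : ι → ℝ) {g : ι → ℝ} {c : ℝ} (hg : ∀ v ∈ V, |g v| ≤ c) :
    |mean V w' g - mean V w g| ≤ c * ∑ v ∈ V, |weight V w' v - weight V w v| := by
  simp only [mean]
  rw [← sum_sub_distrib, mul_sum]
  refine (abs_sum_le_sum_abs _ _).trans (sum_le_sum fun v hv => ?_)
  rw [← sub_mul, abs_mul, mul_comm]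
  exact mul_le_mul_of_nonneg_right (hg v hv) (abs_nonneg _)

/-- From log ρ ≤ 2(√ρ - 1) the divergence is at least (√ρ - 1)², and (√ρ + 1)² ≤ 17/4 in this range.
-/
theorem sq_sub_one_le {ρ : ℝ} (h0 : 0 < ρ) (h1 : ρ ≤ 28 / 25) :
    4 / 17 * (ρ - 1) ^ 2 ≤ ρ - 1 - Real.log ρ := by
  have hs0 := Real.sqrt_pos.2 h0
  have hs : √ρ ^ 2 = ρ := Real.sq_sqrt h0.le
  have h2 : Real.log ρ ≤ 2 * (√ρ - 1) := by
    have := Real.log_le_sub_one_of_pos hs0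
    rw [Real.log_sqrt h0.le] at this
    linarith
  have h3 : √ρ ≤ 1.0591 := by
    rw [Real.sqrt_le_left (by norm_num)]; norm_num; linarith
  have h4 : (ρ - 1) ^ 2 = (√ρ - 1) ^ 2 * (√ρ + 1) ^ 2 := by
    rw [← mul_pow]; congr 1; nlinarith
  have h5 : (√ρ + 1) ^ 2 ≤ 17 / 4 := by nlinarith
  have h6 : (√ρ - 1) ^ 2 ≤ ρ - 1 - Real.log ρ := by nlinarith
  rw [h4]
  nlinarith [mul_le_mul_of_nonneg_left h5 (sq_nonneg (√ρ - 1))]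

theorem abs_log_le_of_ratio {ρ : ℝ} (h0 : 0 < ρ) (h1 : ρ⁻¹ ≤ 28 / 25) :
    |Real.log ρ| ≤ 28 / 25 * |ρ - 1| := by
  rcases le_total 1 ρ with h | h
  · rw [abs_of_nonneg (Real.log_nonneg h), abs_of_nonneg (by linarith)]
    linarith [Real.log_le_sub_one_of_pos h0]
  · rw [abs_of_nonpos (Real.log_nonpos h0.le h), abs_of_nonpos (by linarith)]
    have := Real.log_le_sub_one_of_pos (inv_pos.2 h0)
    rw [Real.log_inv] at this
    have e : ρ⁻¹ - 1 = ρ⁻¹ * (1 - ρ) := by field_simp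
    nlinarith

/-- One round of optimistic regularized leader: the potential `objective - l * mean g` grows at
most by the regret signal, a multiple of the squared variation, and minus the squared movement. -/
theorem IsOpt.step (hV : V.Nonempty) {N : ℕ} (hN : V.card ≤ N) {A : ℝ} {R R' g g' a : ι → ℝ}
    {η l l' c ω ζ : ℝ} (h : IsOpt V A R η l) (h' : IsOpt V A R' η l')
    (hA : 1 + 2 * Real.log N + 70 * Real.log N ^ 2 ≤ A) (hη : η ≤ 1 / 50)
    (hR : ∀ v, R' v - R v = 2 * g' v - g v) (hg : ∀ v, g' v - g v = a v + c)
    (hg2 : ∀ v ∈ V, |g v| ≤ 2) (hg2' : ∀ v ∈ V, |g' v| ≤ 2)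
    (ha : ∀ v ∈ V, |a v| ≤ ω) (hc : |c| ≤ ω + ζ) (hω : 0 ≤ ω) (hζ : 0 ≤ ζ) :
    objective V A R' l' - l' * mean V (fun v => l' * R' v) g'
      ≤ objective V A R l - l * mean V (fun v => l * R v) g + l * mean V (fun v => l * R v) g'
        + 25 / 2 * η ^ 2 * ω ^ 2 + ζ ^ 2 / 1000
        - 13 / 100 * (∑ v ∈ V,
          |weight V (fun v => l' * R' v) v - weight V (fun v => l * R v) v|) ^ 2 := by
  obtain ⟨hℓ0, hℓ1⟩ := log_nat_cases N
  have hl := h.pos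
  have hl' := h'.pos
  have hR6 : ∀ v ∈ V, |R' v - R v| ≤ 6 := by
    intro v hv
    rw [hR, abs_le]
    have h1 := abs_le.1 (hg2 v hv)
    have h2 := abs_le.1 (hg2' v hv)
    constructor <;> linarith
  have hR6' : ∀ v ∈ V, |R v - R' v| ≤ 6 := fun v hv => by rw [abs_sub_comm]; exact hR6 v hv
  set ρ := l' / l with hρ
  have hρ0 : 0 < ρ := by positivity
  have hratio : ρ ≤ 28 / 25 ∧ ρ⁻¹ ≤ 28 / 25 := by
    rcases le_total l l' with hle | hle
    · have h1 := h.drift hV hN h' hA hη hR6 hle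
      have h2 : 1 ≤ ρ := (one_le_div hl).2 hle
      have h3 : ρ - 1 ≤ 3 / 25 := by nlinarith
      exact ⟨by linarith, (inv_le_one_of_one_le₀ h2).trans (by norm_num)⟩
    · have h1 := h'.drift hV hN h hA hη hR6' hle
      have h2 : 1 ≤ l / l' := (one_le_div hl').2 hle
      have h3 : l / l' - 1 ≤ 3 / 25 := by nlinarith
      have h4 : ρ⁻¹ = l / l' := inv_div _ _
      refine ⟨((div_le_one hl).2 hle).trans (by norm_num), ?_⟩
      rw [h4]; linarith
  have hρ1 := sq_sub_one_le hρ0 hratio.1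
  have hρ2 := abs_log_le_of_ratio hρ0 hratio.2
  have hobj := h.objective_le hV hN hl' h'.le
  rw [← hρ] at hobj
  -- The intermediate exponent l' R separates the two changes: relative entropy pays for R → R' at
  -- the new rate, and optimality of l pays for l → l' at the old regrets.
  have hkl := log_partition_ge hV (fun v => l' * R v) (fun v => l' * R' v)
  have hmean : mean V (fun v => l' * R' v) (fun v => l' * R v - l' * R' v)
      = l' * (mean V (fun v => l' * R' v) g - 2 * mean V (fun v => l' * R' v) g') := by
    rw [← mean_const_mul, ← mean_sub, ← mean_const_mul]
    congr 1; funext v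
    linear_combination (-l') * hR v
  rw [hmean] at hkl
  set a₁ := ∑ v ∈ V, |weight V (fun v => l' * R v) v - weight V (fun v => l' * R' v) v| with ha₁
  have hb₁ := sum_abs_weight_sub_le hV hN R hl hl'
  rw [← hρ] at hb₁
  set b₁ := ∑ v ∈ V, |weight V (fun v => l' * R v) v - weight V (fun v => l * R v) v|
  set z := ∑ v ∈ V, |weight V (fun v => l' * R' v) v - weight V (fun v => l * R v) v| with hz
  have ha0 : 0 ≤ a₁ := sum_nonneg fun v _ => abs_nonneg _
  have hb0 : 0 ≤ b₁ := sum_nonneg fun v _ => abs_nonneg _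
  have hz0 : 0 ≤ z := sum_nonneg fun v _ => abs_nonneg _
  have hzab : z ≤ a₁ + b₁ := by
    rw [hz, ha₁, ← sum_add_distrib]
    refine sum_le_sum fun v _ => ?_
    rw [abs_sub_comm (weight V (fun v => l' * R v) v)]
    exact abs_sub_le _ _ _
  have hma := abs_mean_sub_mean_le (fun v => l * R v) (fun v => l' * R' v) ha
  have hma' := abs_mean_le hV (w := fun v => l' * R' v) ha
  have hg₁ : ∀ w : ι → ℝ, mean V w g' - mean V w g = mean V w a + c := by
    intro w
    rw [← mean_sub, ← mean_const hV w c, ← mean_add]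
    congr 1; funext v
    exact hg v
  have hq := hg₁ fun v => l * R v
  have hq' := hg₁ fun v => l' * R' v
  set G := mean V (fun v => l * R v) g
  set G' := mean V (fun v => l * R v) g'
  set a₂ := mean V (fun v => l * R v) a
  set F := mean V (fun v => l' * R' v) g
  set F' := mean V (fun v => l' * R' v) g'
  set a₃ := mean V (fun v => l' * R' v) a
  set x := ρ - 1 with hx
  have hlx : l' - l = l * x := by rw [hx, hρ]; field_simp
  have hlη := h.le
  -- The constant c in g' - g cancels from the difference of means. It survives only multiplied by
  -- l' - l, so ζ never multiplies the movement z.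
  have hstab : l' * (F' - F) - l * (G' - G) ≤ η * (ω * z) + η * (|x| * (2 * ω + ζ)) := by
    have e : l' * (F' - F) - l * (G' - G) = l * (a₃ - a₂) + l * (x * (a₃ + c)) := by
      rw [hq, hq']
      linear_combination (a₃ + c) * hlx
    have e1 : a₃ - a₂ ≤ ω * z := (le_abs_self _).trans hma
    have e2 : x * (a₃ + c) ≤ |x| * (2 * ω + ζ) := by
      refine (le_abs_self _).trans ?_
      rw [abs_mul]
      refine mul_le_mul_of_nonneg_left ((abs_add_le _ _).trans ?_) (abs_nonneg x)
      linarith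
    rw [e]
    refine add_le_add ?_ ?_
    · exact (mul_le_mul_of_nonneg_left e1 hl.le).trans
        (mul_le_mul_of_nonneg_right hlη (by positivity))
    · exact (mul_le_mul_of_nonneg_left e2 hl.le).trans
        (mul_le_mul_of_nonneg_right hlη (by positivity))
  have hη0 : 0 < η := hl.trans_le hlη
  -- Here 70 is used: 66 · 4/17 exceeds 3 · (56/25)², so the rate divergence covers the movement b₁
  -- caused by the change of rate, of order log N · |x|.
  have hD : 23 / 100 * z ^ 2 + 4 / 17 * x ^ 2
      ≤ (A - (2 * Real.log N) ^ 2) * (ρ - 1 - Real.log ρ) + 1 / 4 * a₁ ^ 2 := by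
    set ℓ := Real.log N
    have e1 : (1 + 66 * ℓ ^ 2) * (4 / 17 * x ^ 2)
        ≤ (A - (2 * ℓ) ^ 2) * (ρ - 1 - Real.log ρ) :=
      mul_le_mul (by nlinarith) hρ1 (by positivity) (by nlinarith)
    have e2 : b₁ ≤ ℓ * |x| * (56 / 25) := by
      refine hb₁.trans ?_
      have := mul_le_mul_of_nonneg_left hρ2 hℓ0
      linarith
    have e3 : b₁ ^ 2 ≤ ℓ ^ 2 * x ^ 2 * (56 / 25) ^ 2 := by
      rw [← sq_abs x, ← mul_pow, ← mul_pow]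
      exact pow_le_pow_left₀ hb0 e2 2
    have e4 : z ^ 2 ≤ (a₁ + b₁) ^ 2 := pow_le_pow_left₀ hz0 hzab 2
    have e5 : 23 / 100 * (a₁ + b₁) ^ 2 ≤ 1 / 4 * a₁ ^ 2 + 3 * b₁ ^ 2 := by
      nlinarith only [sq_nonneg (a₁ - 23 / 2 * b₁), sq_nonneg b₁]
    have e6 : 0 ≤ ℓ ^ 2 * x ^ 2 := by positivity
    linarith
  have e1 : η * (ω * z) ≤ 1 / 10 * z ^ 2 + 5 / 2 * η ^ 2 * ω ^ 2 := by
    nlinarith only [sq_nonneg (z - 5 * (η * ω))]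
  have e2 : η * (|x| * (2 * ω + ζ)) ≤ 1 / 5 * x ^ 2 + 10 * η ^ 2 * ω ^ 2 + ζ ^ 2 / 1000 := by
    have e3 : η ^ 2 ≤ 1 / 2500 := by nlinarith only [hη, hη0]
    have e4 := mul_le_mul_of_nonneg_right e3 (sq_nonneg ζ)
    nlinarith only [sq_nonneg (|x| - 10 * (η * ω)), sq_nonneg (|x| - 5 * (η * ζ)), sq_abs x, e4]
  simp only [objective] at hobj ⊢
  linarith [sq_nonneg x]

end Gibbs

/-! ### Runs of the algorithm against bounded utilities -/

namespace KDLRC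

variable {d : ℕ}

/-- The standing assumptions on the parameters of the algorithm and on the utilities. -/
structure Admissible (P : KDLRCParams) (Ω : ZeroOnePolytope d) (ν : ℕ → Fin d → ℝ) : Prop where
  one_le_n : 1 ≤ P.n
  L_pos : 0 < P.L
  β_ge : 70 ≤ P.β
  T_ge : 3 ≤ P.T
  M_ge : 50 * Real.log (Real.log P.T) ≤ P.M
  card_le : Ω.verts.card ≤ P.N
  bounded : ∀ t, ∀ v ∈ Ω.verts, |ν t ⬝ᵥ v| ≤ 1

/-- The distribution on the vertices that the algorithm plays in the state `s`. -/
noncomputable def dist (P : KDLRCParams) (Ω : ZeroOnePolytope d) (s : KDLRCState d) :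
    (Fin d → ℝ) → ℝ :=
  Gibbs.weight Ω.verts fun v => rate P Ω s * (mu s ⬝ᵥ v)

theorem action_eq (P : KDLRCParams) (Ω : ZeroOnePolytope d) (s : KDLRCState d) :
    action P Ω s = ∑ v ∈ Ω.verts, dist P Ω s v • v := by
  have h : action P Ω s = (actionProgram s (rate P Ω s)).value Ω.kernel := by
    simp only [action, rate, stepProgram, KernelProg.value_bind, KernelProg.value]
  rw [h, actionProgram, value_meanProgram]
  funext i
  simp [Gibbs.mean, dist]

theorem rate_eq (P : KDLRCParams) (Ω : ZeroOnePolytope d) (s : KDLRCState d) :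
    rate P Ω s = (rateProgram P s).value Ω.kernel := by
  simp only [rate, stepProgram, KernelProg.value_bind, KernelProg.value]

theorem stepProgram_evals (P : KDLRCParams) (Ω : ZeroOnePolytope d) (s : KDLRCState d) :
    (actionProgram s (rate P Ω s)).evals Ω.kernel = d + 1 ∧
    (stepProgram P s).evals Ω.kernel = (d + 1) + (rateProgram P s).evals Ω.kernel := by
  constructor
  · rw [actionProgram, evals_meanProgram]
  · simp only [stepProgram, KernelProg.evals_bind, KernelProg.evals, actionProgram,
      evals_meanProgram]
    omega

theorem dist_nonneg (P : KDLRCParams) (Ω : ZeroOnePolytope d) (s : KDLRCState d) (v : Fin d → ℝ) :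
    0 ≤ dist P Ω s v := (Gibbs.weight_pos Ω.nonempty _ v).le

theorem sum_dist (P : KDLRCParams) (Ω : ZeroOnePolytope d) (s : KDLRCState d) :
    ∑ v ∈ Ω.verts, dist P Ω s v = 1 := Gibbs.sum_weight Ω.nonempty _

theorem dotProduct_action (P : KDLRCParams) (Ω : ZeroOnePolytope d) (s : KDLRCState d)
    (c : Fin d → ℝ) :
    c ⬝ᵥ action P Ω s
      = Gibbs.mean Ω.verts (fun v => rate P Ω s * (mu s ⬝ᵥ v)) (fun v => c ⬝ᵥ v) := by
  rw [action_eq, dotProduct_sum]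
  simp only [dotProduct_smul, smul_eq_mul]
  rfl

theorem abs_dotProduct_action_le (P : KDLRCParams) (Ω : ZeroOnePolytope d) (s : KDLRCState d)
    {c : Fin d → ℝ} {b : ℝ} (hc : ∀ v ∈ Ω.verts, |c ⬝ᵥ v| ≤ b) : |c ⬝ᵥ action P Ω s| ≤ b := by
  rw [dotProduct_action]
  exact Gibbs.abs_mean_le Ω.nonempty hc

section Run

variable (P : KDLRCParams) (Ω : ZeroOnePolytope d) (ν : ℕ → Fin d → ℝ)

/-- The advantage of the vertex `v` in the last round before the state `t`. -/
noncomputable def gain (t : ℕ) (v : Fin d → ℝ) : ℝ :=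
  (state P Ω ν t).lastUtil ⬝ᵥ v - (state P Ω ν t).lastUtil ⬝ᵥ (state P Ω ν t).lastAction

/-- The optimistic regret of the vertex `v` before round `t`, without regard to a switch. -/
noncomputable def optRegret (t : ℕ) (v : Fin d → ℝ) : ℝ :=
  ∑ τ ∈ range t, gain P Ω ν (τ + 1) v + gain P Ω ν t v

variable {P Ω ν}

theorem gain_zero (v : Fin d → ℝ) : gain P Ω ν 0 v = 0 := by
  simp [gain, state, init]

theorem gain_succ (t : ℕ) (v : Fin d → ℝ) :
    gain P Ω ν (t + 1) v = ν t ⬝ᵥ v - ν t ⬝ᵥ action P Ω (state P Ω ν t) := rfl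

theorem optRegret_zero (v : Fin d → ℝ) : optRegret P Ω ν 0 v = 0 := by
  simp [optRegret, gain_zero]

theorem optRegret_succ_sub (t : ℕ) (v : Fin d → ℝ) :
    optRegret P Ω ν (t + 1) v - optRegret P Ω ν t v
      = 2 * gain P Ω ν (t + 1) v - gain P Ω ν t v := by
  simp only [optRegret, sum_range_succ]
  ring

theorem rounds_state (t : ℕ) : (state P Ω ν t).rounds = t := by
  induction t with
  | zero => rfl
  | succ t ih => change (state P Ω ν t).rounds + 1 = t + 1; rw [ih]

theorem cumUtil_state (t : ℕ) (v : Fin d → ℝ) :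
    (state P Ω ν t).cumUtil ⬝ᵥ v + (state P Ω ν t).cumCorr
      = ∑ τ ∈ range t, gain P Ω ν (τ + 1) v := by
  induction t with
  | zero => simp [state, init]
  | succ t ih =>
    rw [sum_range_succ, ← ih, gain_succ]
    change ((state P Ω ν t).cumUtil + ν t) ⬝ᵥ v
      + ((state P Ω ν t).cumCorr - ν t ⬝ᵥ action P Ω (state P Ω ν t)) = _
    rw [add_dotProduct]
    ring

theorem switched_succ (t : ℕ) : (state P Ω ν (t + 1)).switched
    ↔ (state P Ω ν t).switched ∨ P.threshold (t + 1) < (state P Ω ν (t + 1)).variation := by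
  have e : P.threshold (t + 1) = P.threshold ((state P Ω ν t).rounds + 1) := by
    rw [rounds_state]
  rw [e]
  rfl

theorem variation_state (m : ℕ) : (state P Ω ν (m + 1)).variation
    = ∑ t ∈ range m, Ω.utilityNorm (ν (t + 1) - ν t) ^ 2 := by
  induction m with
  | zero => simp [state, next, init]
  | succ m ih =>
    rw [sum_range_succ, ← ih]
    have h : (state P Ω ν (m + 1)).rounds ≠ 0 := by rw [rounds_state]; omega
    change (if (state P Ω ν (m + 1)).rounds = 0 then 0 else (state P Ω ν (m + 1)).variation
      + Ω.utilityNorm (ν (m + 1) - ν m) ^ 2) = _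
    rw [if_neg h]

theorem not_switched_of_le {s t : ℕ} (hst : s ≤ t) (h : ¬ (state P Ω ν t).switched) :
    ¬ (state P Ω ν s).switched := by
  induction t, hst using Nat.le_induction with
  | base => exact h
  | succ t _ ih => exact ih fun h' => h ((switched_succ t).2 (Or.inl h'))

theorem regretVec_state {t : ℕ} (h : ¬ (state P Ω ν t).switched) :
    regretVec (state P Ω ν t) = optRegret P Ω ν t := by
  funext v
  rw [regretVec, optRegret, ← cumUtil_state, mu, if_neg h, sigma, gain, add_dotProduct]
  ring

theorem dist_state {t : ℕ} (h : ¬ (state P Ω ν t).switched) :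
    dist P Ω (state P Ω ν t)
      = Gibbs.weight Ω.verts fun v => rate P Ω (state P Ω ν t) * optRegret P Ω ν t v := by
  rw [← regretVec_state h, dist]
  unfold regretVec
  simp only [mul_add]
  rw [Gibbs.weight_add_const]

end Run

/-! ### Optimal and computed learning rates along a run -/

namespace Admissible

variable {P : KDLRCParams} {Ω : ZeroOnePolytope d} {ν : ℕ → Fin d → ℝ}

theorem le_alpha (H : Admissible P Ω ν) :
    1 + 2 * Real.log P.N + 70 * Real.log P.N ^ 2 ≤ P.α - 1 := by
  have := H.β_ge
  rw [KDLRCParams.α]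
  nlinarith [sq_nonneg (Real.log P.N)]

theorem alpha_pos (H : Admissible P Ω ν) : 0 < P.α - 1 := by
  have := H.le_alpha
  have := (Gibbs.log_nat_cases P.N).1
  nlinarith [sq_nonneg (Real.log P.N)]

theorem eta_pos (H : Admissible P Ω ν) : 0 < P.η := by
  have h1 := H.L_pos
  have h2 : (0 : ℝ) < P.n := by exact_mod_cast H.one_le_n
  exact lt_min (by norm_num) (by positivity)

theorem eta_le (_ : Admissible P Ω ν) : P.η ≤ 1 / 50 := min_le_left _ _

theorem sq_eta_mul_le (H : Admissible P Ω ν) : P.η ^ 2 * (P.L ^ 2 * (P.n : ℝ) ^ 2) ≤ 1 / 288 := by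
  have h1 := H.L_pos
  have h2 : (0 : ℝ) < P.n := by exact_mod_cast H.one_le_n
  have h3 : P.η ≤ 1 / (12 * √2 * P.L * P.n) := min_le_right _ _
  have h4 := pow_le_pow_left₀ H.eta_pos.le h3 2
  have h5 : (1 / (12 * √2 * P.L * P.n)) ^ 2 = 1 / (288 * (P.L ^ 2 * (P.n : ℝ) ^ 2)) := by
    rw [div_pow, mul_pow, mul_pow, mul_pow, Real.sq_sqrt zero_le_two]
    norm_num
    ring
  rw [h5, le_div_iff₀ (by positivity)] at h4
  linarith

theorem inv_eta_le (H : Admissible P Ω ν) : 1 / P.η ≤ 50 * (1 + P.L * P.n) := by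
  have h1 := H.L_pos
  have h2 : (0 : ℝ) < P.n := by exact_mod_cast H.one_le_n
  have h0 : 0 < P.L * P.n := by positivity
  rw [div_le_iff₀ H.eta_pos, KDLRCParams.η]
  rcases min_cases (1 / 50 : ℝ) (1 / (12 * √2 * P.L * P.n)) with ⟨h, _⟩ | ⟨h, _⟩
  · rw [h]; linarith
  · rw [h, mul_one_div, le_div_iff₀ (by positivity)]
    have : √2 ≤ 3 / 2 := by
      rw [Real.sqrt_le_left (by norm_num)]; norm_num
    nlinarith

theorem abs_gain_le (H : Admissible P Ω ν) (t : ℕ) {v : Fin d → ℝ} (hv : v ∈ Ω.verts) :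
    |gain P Ω ν t v| ≤ 2 := by
  rcases t with _ | t
  · rw [gain_zero]; norm_num
  · rw [gain_succ]
    have h1 := H.bounded t v hv
    have h2 := abs_dotProduct_action_le P Ω (state P Ω ν t) (H.bounded t)
    exact (abs_sub _ _).trans (by linarith)

theorem exists_isOpt (H : Admissible P Ω ν) (t : ℕ) :
    ∃ l, Gibbs.IsOpt Ω.verts (P.α - 1) (optRegret P Ω ν t) P.η l :=
  Gibbs.exists_isOpt Ω.nonempty H.alpha_pos _ H.eta_pos

/-- The optimal learning rate in round `t`. -/
noncomputable def optRate (H : Admissible P Ω ν) (t : ℕ) : ℝ := (H.exists_isOpt t).choose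

theorem isOpt (H : Admissible P Ω ν) (t : ℕ) :
    Gibbs.IsOpt Ω.verts (P.α - 1) (optRegret P Ω ν t) P.η (H.optRate t) :=
  (H.exists_isOpt t).choose_spec

theorem abs_optRegret_sub_le (H : Admissible P Ω ν) (t : ℕ) {v : Fin d → ℝ} (hv : v ∈ Ω.verts) :
    |optRegret P Ω ν (t + 1) v - optRegret P Ω ν t v| ≤ 6 := by
  rw [optRegret_succ_sub, abs_le]
  have h1 := abs_le.1 (H.abs_gain_le t hv)
  have h2 := abs_le.1 (H.abs_gain_le (t + 1) hv)
  constructor <;> linarith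

/-- Newton's method, started close enough to the optimal learning rate. -/
theorem rateProgram_spec (H : Admissible P Ω ν) {t : ℕ} (h : ¬ (state P Ω ν t).switched)
    (hstart : (1 + 2 * Real.log P.N) * |(state P Ω ν t).rate - H.optRate t| ≤ H.optRate t / 4) :
    (∃ k : ℕ, (k : ℝ) ≤ 50 * Real.log (Real.log P.T) ∧
      (rateProgram P (state P Ω ν t)).evals Ω.kernel = (d ^ 2 + 1) * k) ∧
    (1 + 2 * Real.log P.N) * |rate P Ω (state P Ω ν t) - H.optRate t| ≤ H.optRate t / 16 ∧
    |rate P Ω (state P Ω ν t) - H.optRate t| ≤ H.optRate t / P.T := by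
  obtain ⟨j, hj1, hj2⟩ := exists_le_two_pow_two_pow H.T_ge
  have hT : (3 : ℝ) ≤ P.T := by exact_mod_cast H.T_ge
  have hopt := H.isOpt t
  have hl := hopt.pos
  have hℓ := (Gibbs.log_nat_cases P.N).1
  rw [← regretVec_state h] at hopt
  have hpow : ((1 + 2 * Real.log P.N) * |(state P Ω ν t).rate - H.optRate t| / H.optRate t) ^ (2 ^ j)
      ≤ 3 / (4 * P.T) := by
    -- Writing 1/4 as (1/2)² gives error at most 1/T² after squaring j times, which is at most
    -- 3/(4T) for T ≥ 3.
    have h1 : (1 + 2 * Real.log P.N) * |(state P Ω ν t).rate - H.optRate t| / H.optRate t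
        ≤ (1 / 2) ^ 2 := by
      rw [div_le_iff₀ hl]; linarith
    refine (pow_le_pow_left₀ (by positivity) h1 _).trans ?_
    rw [pow_right_comm, one_div, inv_pow, ← one_div, div_pow, one_pow,
      div_le_div_iff₀ (by positivity) (by positivity)]
    nlinarith
  have hjM : j + 1 ≤ P.M := by
    have := hj2.trans H.M_ge
    exact_mod_cast this
  obtain ⟨k, hk1, hk2, hk3, hk4⟩ := newtonLoop_spec Ω P H.card_le (by linarith [H.T_ge] : 1 ≤ P.T)
    H.le_alpha hopt j P.M (state P Ω ν t).rate hjM hstart hpow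
  rw [rate_eq, rateProgram, if_neg h]
  refine ⟨⟨k, ?_, hk2⟩, hk3, hk4⟩
  have : (k : ℝ) ≤ j + 1 := by exact_mod_cast hk1
  linarith

/-- The learning rate of the last round is a good starting point for Newton's method. -/
theorem newton_start (H : Admissible P Ω ν) {t : ℕ} (h : ¬ (state P Ω ν t).switched) :
    (1 + 2 * Real.log P.N) * |(state P Ω ν t).rate - H.optRate t| ≤ H.optRate t / 4 := by
  have hℓ := (Gibbs.log_nat_cases P.N).1
  induction t with
  | zero =>
    have hopt := H.isOpt 0
    -- With zero regrets the slope is A/λ > 0, so the optimum is at the cap, where the iteration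
    -- starts.
    have hl : H.optRate 0 = P.η := by
      by_contra hne
      have h1 := hopt.slope_eq (lt_of_le_of_ne hopt.le hne)
      have h2 : Gibbs.mean Ω.verts (fun v => H.optRate 0 * optRegret P Ω ν 0 v) (optRegret P Ω ν 0)
          = 0 := by
        simp [Gibbs.mean, optRegret_zero]
      rw [Gibbs.slope, h2, zero_add] at h1
      exact (div_pos H.alpha_pos hopt.pos).ne' h1
    have h0 := H.eta_pos
    rw [hl]
    change _ * |P.η - P.η| ≤ _
    rw [sub_self, abs_zero, mul_zero]
    positivity
  | succ t ih =>
    have ht := not_switched_of_le (Nat.le_succ t) h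
    have h1 := (H.rateProgram_spec ht (ih ht)).2.1
    have ho := H.isOpt t
    have ho' := H.isOpt (t + 1)
    have hl := ho.pos
    have hl' := ho'.pos
    change (1 + 2 * Real.log P.N) * |rate P Ω (state P Ω ν t) - H.optRate (t + 1)| ≤ _
    set κ := 1 + 2 * Real.log P.N with hκ
    have hκ1 : 1 ≤ κ := by linarith
    have hR : ∀ v ∈ Ω.verts, |optRegret P Ω ν (t + 1) v - optRegret P Ω ν t v| ≤ 6 :=
      fun v hv => H.abs_optRegret_sub_le t hv
    have h2 : κ * |H.optRate t - H.optRate (t + 1)| ≤ 3 / 25 * max (H.optRate t) (H.optRate (t + 1))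
        ∧ max (H.optRate t) (H.optRate (t + 1)) ≤ 28 / 25 * H.optRate (t + 1) := by
      rcases le_total (H.optRate t) (H.optRate (t + 1)) with hle | hle
      · have h3 := ho.drift Ω.nonempty H.card_le ho' H.le_alpha H.eta_le hR hle
        rw [max_eq_right hle, abs_of_nonpos (by linarith)]
        have e : H.optRate (t + 1) / H.optRate t - 1
            = (H.optRate (t + 1) - H.optRate t) / H.optRate t := by field_simp
        rw [e, ← mul_div_assoc, div_le_iff₀ hl] at h3
        constructor <;> linarith
      · have h3 := ho'.drift Ω.nonempty H.card_le ho H.le_alpha H.eta_le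
          (fun v hv => by rw [abs_sub_comm]; exact hR v hv) hle
        rw [max_eq_left hle, abs_of_nonneg (by linarith)]
        have e : H.optRate t / H.optRate (t + 1) - 1
            = (H.optRate t - H.optRate (t + 1)) / H.optRate (t + 1) := by field_simp
        rw [e, ← mul_div_assoc, div_le_iff₀ hl'] at h3
        constructor
        · linarith
        · nlinarith
    have h4 := abs_sub_le (rate P Ω (state P Ω ν t)) (H.optRate t) (H.optRate (t + 1))
    -- Newton error and drift add up to (1/16 + 3/25) · 28/25 < 1/4.
    have h5 := mul_le_mul_of_nonneg_left h4 (by linarith : 0 ≤ κ)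
    have h6 := le_max_left (H.optRate t) (H.optRate (t + 1))
    linarith

theorem rate_close (H : Admissible P Ω ν) {t : ℕ} (h : ¬ (state P Ω ν t).switched) :
    |rate P Ω (state P Ω ν t) - H.optRate t| ≤ H.optRate t / P.T :=
  (H.rateProgram_spec h (H.newton_start h)).2.2

theorem stepCost (H : Admissible P Ω ν) (t : ℕ) :
    StepCost P Ω (state P Ω ν t) (50 * Real.log (Real.log P.T)) := by
  obtain ⟨h1, h2⟩ := stepProgram_evals P Ω (state P Ω ν t)
  by_cases h : (state P Ω ν t).switched
  · obtain ⟨j, -, hj⟩ := exists_le_two_pow_two_pow H.T_ge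
    have h3 : (rateProgram P (state P Ω ν t)).evals Ω.kernel = 0 := by
      rw [rateProgram, if_pos h]; rfl
    refine ⟨0, ?_, ?_, h1, ?_⟩
    · push_cast
      refine le_trans ?_ hj
      positivity
    · rw [h3, mul_zero]
    · rw [h2, h3, mul_zero]
  · obtain ⟨⟨k, hk1, hk2⟩, -⟩ := H.rateProgram_spec h (H.newton_start h)
    exact ⟨k, hk1, hk2, h1, by rw [h2, hk2]⟩

theorem stepCorrect (H : Admissible P Ω ν) {t : ℕ} (h : ¬ (state P Ω ν t).switched) :
    StepCorrect P Ω (state P Ω ν t) := by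
  have ho := H.isOpt t
  refine ⟨⟨H.optRate t, ⟨ho.pos, ho.le⟩, ?_, H.rate_close h⟩, ?_⟩
  · intro y hy hne
    rw [regretVec_state h]
    have h1 := ho.objective_le Ω.nonempty H.card_le hy.1 hy.2
    have h2 : Real.log (y / H.optRate t) < y / H.optRate t - 1 :=
      Real.log_lt_sub_one_of_pos (div_pos hy.1 ho.pos) fun h => hne (by
        rwa [div_eq_one_iff_eq ho.pos.ne'] at h)
    have h3 := H.le_alpha
    have h4 : 0 < P.α - 1 - (2 * Real.log P.N) ^ 2 := by
      nlinarith [(Gibbs.log_nat_cases P.N).1, sq_nonneg (Real.log P.N)]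
    have h5 : 0 < (P.α - 1 - (2 * Real.log P.N) ^ 2)
        * (y / H.optRate t - 1 - Real.log (y / H.optRate t)) := mul_pos h4 (by linarith)
    exact (lt_add_of_pos_right _ h5).trans_le h1
  · rw [action_eq, dist_state h, regretVec_state h]
    rfl

end Admissible
end KDLRC

namespace ZeroOnePolytope

variable {d : ℕ} (Ω : ZeroOnePolytope d)

theorem abs_dotProduct_le_utilityNorm (c : Fin d → ℝ) {v : Fin d → ℝ} (hv : v ∈ Ω.verts) :
    |c ⬝ᵥ v| ≤ Ω.utilityNorm c := le_sup' (fun v => |c ⬝ᵥ v|) hv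

theorem utilityNorm_nonneg (c : Fin d → ℝ) : 0 ≤ Ω.utilityNorm c :=
  (abs_nonneg _).trans (Ω.abs_dotProduct_le_utilityNorm c Ω.nonempty.choose_spec)

theorem utilityNorm_le {c : Fin d → ℝ} {b : ℝ} (h : ∀ v ∈ Ω.verts, |c ⬝ᵥ v| ≤ b) :
    Ω.utilityNorm c ≤ b := sup'_le _ _ h

end ZeroOnePolytope

/-! ### The potential along a run: bounds on regret and movement -/

namespace KDLRC

variable {d : ℕ} {P : KDLRCParams} {Ω : ZeroOnePolytope d} {ν : ℕ → Fin d → ℝ}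

/-- The `ℓ₁` movement of the distribution on the vertices after round `t`. -/
noncomputable def move (P : KDLRCParams) (Ω : ZeroOnePolytope d) (ν : ℕ → Fin d → ℝ) (t : ℕ) : ℝ :=
  ∑ v ∈ Ω.verts, |dist P Ω (state P Ω ν (t + 1)) v - dist P Ω (state P Ω ν t) v|

theorem move_nonneg (t : ℕ) : 0 ≤ move P Ω ν t := sum_nonneg fun _ _ => abs_nonneg _

namespace Admissible

/-- The distribution on the vertices at the optimal learning rate of round `t`. -/
noncomputable def optDist (H : Admissible P Ω ν) (t : ℕ) : (Fin d → ℝ) → ℝ :=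
  Gibbs.weight Ω.verts fun v => H.optRate t * optRegret P Ω ν t v

/-- The `ℓ₁` movement of the distribution at the optimal learning rates. -/
noncomputable def optMove (H : Admissible P Ω ν) (t : ℕ) : ℝ :=
  ∑ v ∈ Ω.verts, |H.optDist (t + 1) v - H.optDist t v|

/-- The potential of the regret analysis. -/
noncomputable def potential (H : Admissible P Ω ν) (t : ℕ) : ℝ :=
  Gibbs.objective Ω.verts (P.α - 1) (optRegret P Ω ν t) (H.optRate t)
    - H.optRate t * Gibbs.mean Ω.verts (fun v => H.optRate t * optRegret P Ω ν t v) (gain P Ω ν t)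

/-- The computed rate is off by a factor within 1/T ≤ 1/3 of 1, so its logarithm is off by at most
3/(2T). -/
theorem sum_abs_dist_sub_optDist_le (H : Admissible P Ω ν) {t : ℕ}
    (h : ¬ (state P Ω ν t).switched) :
    ∑ v ∈ Ω.verts, |dist P Ω (state P Ω ν t) v - H.optDist t v| ≤ 3 * Real.log P.N / P.T := by
  have hT : (3 : ℝ) ≤ P.T := by exact_mod_cast H.T_ge
  have hℓ := (Gibbs.log_nat_cases P.N).1
  have hl := (H.isOpt t).pos
  have hc := H.rate_close h
  set r := rate P Ω (state P Ω ν t) with hr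
  set l := H.optRate t with hl_def
  have h1 : |r / l - 1| ≤ 1 / P.T := by
    have e : r / l - 1 = (r - l) / l := by field_simp
    rw [e, abs_div, abs_of_pos hl, div_le_iff₀ hl, one_div_mul_eq_div]
    exact hc
  have hT' : (1 : ℝ) / P.T ≤ 1 / 3 := one_div_le_one_div_of_le (by norm_num) hT
  obtain ⟨h2, h3⟩ := abs_le.1 h1
  have hρ : 0 < r / l := by linarith
  have hr0 : 0 < r := by
    have := mul_pos hρ hl
    rwa [div_mul_cancel₀ _ hl.ne'] at this
  have h4 : |Real.log (r / l)| ≤ 3 / 2 * (1 / P.T) := by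
    have e1 := Real.log_le_sub_one_of_pos hρ
    have e2 := Real.log_le_sub_one_of_pos (inv_pos.2 hρ)
    rw [Real.log_inv] at e2
    have e3 : (r / l)⁻¹ ≤ 3 / 2 := by
      rw [inv_le_comm₀ hρ (by norm_num)]; norm_num; linarith
    have e4 : (r / l)⁻¹ - 1 = (r / l)⁻¹ * (1 - r / l) := by
      rw [mul_sub, inv_mul_cancel₀ hρ.ne', mul_one]
    have e5 : (r / l)⁻¹ * (1 - r / l) ≤ 3 / 2 * (1 / P.T) := by
      have e6 : 0 < (r / l)⁻¹ := inv_pos.2 hρ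
      exact (mul_le_mul_of_nonneg_left (by linarith) e6.le).trans
        (mul_le_mul_of_nonneg_right e3 (by positivity))
    rw [abs_le]
    constructor
    · linarith
    · have : (0 : ℝ) < 1 / P.T := by positivity
      linarith
  have h5 := Gibbs.sum_abs_weight_sub_le Ω.nonempty H.card_le (optRegret P Ω ν t) hl hr0
  rw [dist_state h]
  refine h5.trans ((mul_le_mul_of_nonneg_left h4 (by linarith)).trans_eq ?_)
  ring

theorem move_le (H : Admissible P Ω ν) {t : ℕ} (h : ¬ (state P Ω ν (t + 1)).switched) :
    move P Ω ν t ≤ H.optMove t + 6 * Real.log P.N / P.T := by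
  have h1 := H.sum_abs_dist_sub_optDist_le h
  have h2 := H.sum_abs_dist_sub_optDist_le (not_switched_of_le (Nat.le_succ t) h)
  have h3 : move P Ω ν t ≤ H.optMove t
      + (∑ v ∈ Ω.verts, |dist P Ω (state P Ω ν (t + 1)) v - H.optDist (t + 1) v|
        + ∑ v ∈ Ω.verts, |dist P Ω (state P Ω ν t) v - H.optDist t v|) := by
    rw [move, optMove, ← sum_add_distrib, ← sum_add_distrib]
    refine sum_le_sum fun v _ => ?_
    have e1 := abs_sub_le (dist P Ω (state P Ω ν (t + 1)) v) (H.optDist (t + 1) v)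
      (dist P Ω (state P Ω ν t) v)
    have e2 := abs_sub_le (H.optDist (t + 1) v) (H.optDist t v) (dist P Ω (state P Ω ν t) v)
    rw [abs_sub_comm (H.optDist t v)] at e2
    linarith
  have h4 : 6 * Real.log P.N / P.T = 3 * Real.log P.N / P.T + 3 * Real.log P.N / P.T := by ring
  linarith

/-- Under the distribution actually played the mean gain is exactly zero; the bound is the price of
replacing the computed rate by the optimal one. -/
theorem optRate_mul_mean_gain_le (H : Admissible P Ω ν) {t : ℕ} (h : ¬ (state P Ω ν t).switched) :
    H.optRate t * Gibbs.mean Ω.verts (fun v => H.optRate t * optRegret P Ω ν t v)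
      (gain P Ω ν (t + 1)) ≤ 6 * P.η * Real.log P.N / P.T := by
  have h0 : Gibbs.mean Ω.verts (fun v => rate P Ω (state P Ω ν t) * optRegret P Ω ν t v)
      (gain P Ω ν (t + 1)) = 0 := by
    have e1 : Gibbs.mean Ω.verts (fun v => rate P Ω (state P Ω ν t) * optRegret P Ω ν t v)
        (fun v => ν t ⬝ᵥ v) = ν t ⬝ᵥ action P Ω (state P Ω ν t) := by
      rw [dotProduct_action]
      have := dist_state h
      rw [dist] at this
      simp only [Gibbs.mean, this]
    have e2 : gain P Ω ν (t + 1)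
        = fun v => ν t ⬝ᵥ v - ν t ⬝ᵥ action P Ω (state P Ω ν t) := rfl
    rw [e2, Gibbs.mean_sub, Gibbs.mean_const Ω.nonempty, e1, sub_self]
  have h1 := Gibbs.abs_mean_sub_mean_le
    (fun v => rate P Ω (state P Ω ν t) * optRegret P Ω ν t v)
    (fun v => H.optRate t * optRegret P Ω ν t v) (fun v hv => H.abs_gain_le (t + 1) hv)
  have h2 := H.sum_abs_dist_sub_optDist_le h
  rw [dist_state h, optDist, sum_congr rfl fun v _ => abs_sub_comm _ _] at h2
  rw [h0, sub_zero] at h1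
  have h3 := (le_abs_self _).trans (h1.trans (mul_le_mul_of_nonneg_left h2 zero_le_two))
  have hl := (H.isOpt t).pos
  have hℓ := (Gibbs.log_nat_cases P.N).1
  have hT : (3 : ℝ) ≤ P.T := by exact_mod_cast H.T_ge
  calc _ ≤ H.optRate t * (2 * (3 * Real.log P.N / P.T)) := mul_le_mul_of_nonneg_left h3 hl.le
    _ ≤ P.η * (2 * (3 * Real.log P.N / P.T)) :=
        mul_le_mul_of_nonneg_right (H.isOpt t).le (by positivity)
    _ = _ := by ring

/-- There is no earlier utility to predict from, so all of ν 0 counts as variation, of size 1. -/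
theorem potential_one_le (H : Admissible P Ω ν) (h : ¬ (state P Ω ν 0).switched) :
    H.potential 1 ≤ H.potential 0 + 6 * P.η * Real.log P.N / P.T + 25 / 2 * P.η ^ 2
      - 13 / 100 * H.optMove 0 ^ 2 := by
  have hb := H.bounded 0
  have hstep := (H.isOpt 0).step Ω.nonempty H.card_le (H.isOpt (0 + 1)) H.le_alpha H.eta_le
    (optRegret_succ_sub 0) (a := fun v => ν 0 ⬝ᵥ v) (c := - (ν 0 ⬝ᵥ action P Ω (state P Ω ν 0)))
    (ω := 1) (ζ := 0) (fun v => by rw [gain_succ, gain_zero]; ring)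
    (fun v hv => H.abs_gain_le 0 hv) (fun v hv => H.abs_gain_le 1 hv) hb
    (by rw [abs_neg, add_zero]; exact abs_dotProduct_action_le _ _ _ hb) zero_le_one le_rfl
  have h1 := H.optRate_mul_mean_gain_le h
  rw [potential, potential, optMove, optDist, optDist]
  linarith

/-- The change of the correction ⟨ν, x⟩ does not depend on the vertex. It is bounded by the
variation plus the movement of the previous round, which enters with the tiny factor 1/1000. -/
theorem potential_succ_le (H : Admissible P Ω ν) {t : ℕ} (h : ¬ (state P Ω ν (t + 1)).switched) :
    H.potential (t + 2) ≤ H.potential (t + 1) + 6 * P.η * Real.log P.N / P.T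
      + 25 / 2 * P.η ^ 2 * Ω.utilityNorm (ν (t + 1) - ν t) ^ 2 + move P Ω ν t ^ 2 / 1000
      - 13 / 100 * H.optMove (t + 1) ^ 2 := by
  have hω := fun v hv => Ω.abs_dotProduct_le_utilityNorm (ν (t + 1) - ν t) (v := v) hv
  have hc : |-((ν (t + 1) - ν t) ⬝ᵥ action P Ω (state P Ω ν (t + 1)))
      - (ν t ⬝ᵥ action P Ω (state P Ω ν (t + 1)) - ν t ⬝ᵥ action P Ω (state P Ω ν t))|
      ≤ Ω.utilityNorm (ν (t + 1) - ν t) + move P Ω ν t := by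
    refine (abs_sub _ _).trans (add_le_add ?_ ?_)
    · rw [abs_neg]
      exact abs_dotProduct_action_le _ _ _ hω
    · rw [dotProduct_action, dotProduct_action]
      refine (Gibbs.abs_mean_sub_mean_le _ _ (H.bounded t)).trans_eq ?_
      rw [one_mul]; rfl
  have hstep := (H.isOpt (t + 1)).step Ω.nonempty H.card_le (H.isOpt (t + 1 + 1)) H.le_alpha
    H.eta_le (optRegret_succ_sub (t + 1)) (a := fun v => (ν (t + 1) - ν t) ⬝ᵥ v)
    (c := -((ν (t + 1) - ν t) ⬝ᵥ action P Ω (state P Ω ν (t + 1)))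
      - (ν t ⬝ᵥ action P Ω (state P Ω ν (t + 1)) - ν t ⬝ᵥ action P Ω (state P Ω ν t)))
    (fun v => by rw [gain_succ, gain_succ, sub_dotProduct, sub_dotProduct]; ring)
    (fun v hv => H.abs_gain_le (t + 1) hv) (fun v hv => H.abs_gain_le (t + 1 + 1) hv) hω hc
    (Ω.utilityNorm_nonneg _) (move_nonneg t)
  have h1 := H.optRate_mul_mean_gain_le h
  rw [potential, potential, optMove, optDist, optDist]
  linarith

theorem potential_le (H : Admissible P Ω ν) {m : ℕ} (hm : m + 1 ≤ P.T)
    (h : ¬ (state P Ω ν m).switched) :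
    H.potential (m + 1) ≤ H.potential 0
      + 15 * P.η ^ 2 * (1 + (state P Ω ν (m + 1)).variation)
      - 1 / 12 * ∑ t ∈ range m, move P Ω ν t ^ 2 + 4 * Real.log P.N ^ 2 := by
  obtain ⟨hℓ0, hℓ1⟩ := Gibbs.log_nat_cases P.N
  have hT : (3 : ℝ) ≤ P.T := by exact_mod_cast H.T_ge
  have hη := H.eta_pos
  have hη' := H.eta_le
  -- The induction keeps the last negative term apart, because the movement at s reappears as an
  -- error in the next round and must be paid from it.
  have key : ∀ s ≤ m, H.potential (s + 1) ≤ H.potential 0 + (s + 1) * (6 * P.η * Real.log P.N / P.T)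
      + 25 / 2 * P.η ^ 2 * (1 + ∑ t ∈ range s, Ω.utilityNorm (ν (t + 1) - ν t) ^ 2)
      - 1 / 12 * ∑ t ∈ range s, move P Ω ν t ^ 2 + s * (10 * Real.log P.N ^ 2 / P.T ^ 2)
      - 13 / 100 * H.optMove s ^ 2 := by
    intro s hs
    induction s with
    | zero =>
      have := H.potential_one_le (not_switched_of_le (Nat.zero_le m) h)
      simp only [range_zero, sum_empty, Nat.cast_zero]
      linarith
    | succ s ih =>
      have h1 := ih (by omega)
      have hs' := not_switched_of_le hs h
      have h2 := H.potential_succ_le hs'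
      have h3 := H.move_le hs'
      have h4 := move_nonneg (P := P) (Ω := Ω) (ν := ν) s
      -- The reserved 13/100 pays both this error and the 1/12 kept in the sum; inexact rates cost
      -- 10 (log N / T)² per round.
      have h5 : move P Ω ν s ^ 2 / 1000 + 1 / 12 * move P Ω ν s ^ 2
          ≤ 13 / 100 * H.optMove s ^ 2 + 10 * Real.log P.N ^ 2 / P.T ^ 2 := by
        set y := Real.log P.N / P.T
        have e1 : 6 * Real.log P.N / P.T = 6 * y := by ring
        have e2 : 10 * Real.log P.N ^ 2 / P.T ^ 2 = 10 * y ^ 2 := by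
          rw [div_pow, mul_div_assoc]
        rw [e1] at h3
        rw [e2]
        have h6 := pow_le_pow_left₀ h4 h3 2
        nlinarith only [h6, sq_nonneg (H.optMove s - 12 * y), sq_nonneg y, sq_nonneg (H.optMove s)]
      rw [sum_range_succ, sum_range_succ]
      have e3 : s + 1 + 1 = s + 2 := rfl
      rw [e3]
      push_cast
      linarith
  have h1 := key m le_rfl
  rw [variation_state]
  have hmT : ((m : ℝ) + 1) ≤ P.T := by exact_mod_cast hm
  have h2 : (m + 1) * (6 * P.η * Real.log P.N / P.T) ≤ 6 * P.η * Real.log P.N := by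
    calc (m + 1) * (6 * P.η * Real.log P.N / P.T)
        ≤ P.T * (6 * P.η * Real.log P.N / P.T) := mul_le_mul_of_nonneg_right hmT (by positivity)
      _ = _ := by field_simp
  have h3 : m * (10 * Real.log P.N ^ 2 / P.T ^ 2) ≤ 10 / 3 * Real.log P.N ^ 2 := by
    calc m * (10 * Real.log P.N ^ 2 / P.T ^ 2)
        ≤ P.T * (10 * Real.log P.N ^ 2 / P.T ^ 2) :=
          mul_le_mul_of_nonneg_right (by linarith) (by positivity)
      _ = 10 * Real.log P.N ^ 2 / P.T := by field_simp
      _ ≤ 10 * Real.log P.N ^ 2 / 3 := by gcongr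
      _ = _ := by ring
  have h4 : 6 * P.η * Real.log P.N ≤ 18 / 100 * Real.log P.N ^ 2 := by nlinarith
  have h5 : 0 ≤ P.η ^ 2 * (1 + ∑ t ∈ range m, Ω.utilityNorm (ν (t + 1) - ν t) ^ 2) := by
    positivity
  nlinarith [sq_nonneg (H.optMove m), sq_nonneg (Real.log P.N)]

theorem potential_zero_le (H : Admissible P Ω ν) :
    H.potential 0 ≤ (P.α - 1) * Real.log P.η + Real.log P.N := by
  have ho := H.isOpt 0
  have h1 : Gibbs.mean Ω.verts (fun v => H.optRate 0 * optRegret P Ω ν 0 v) (gain P Ω ν 0) = 0 := by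
    simp [Gibbs.mean, gain_zero]
  have h2 : Gibbs.partition Ω.verts (fun v => H.optRate 0 * optRegret P Ω ν 0 v) = Ω.verts.card := by
    simp [Gibbs.partition, optRegret_zero]
  rw [potential, h1, mul_zero, sub_zero, Gibbs.objective, h2]
  refine add_le_add (mul_le_mul_of_nonneg_left (Real.log_le_log ho.pos ho.le) H.alpha_pos.le) ?_
  exact Real.log_le_log (by exact_mod_cast Ω.nonempty.card_pos) (by exact_mod_cast H.card_le)

/-- The regret against a vertex, measured at an arbitrary learning rate. -/
theorem mul_regret_le (H : Admissible P Ω ν) {m : ℕ} (hm : m + 1 ≤ P.T)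
    (h : ¬ (state P Ω ν m).switched) {lam : ℝ} (hlam : 0 < lam) (hlη : lam ≤ P.η) {v : Fin d → ℝ}
    (hv : v ∈ Ω.verts) :
    lam * ∑ t ∈ range (m + 1), (ν t ⬝ᵥ v - ν t ⬝ᵥ action P Ω (state P Ω ν t))
      ≤ (P.α - 1) * (Real.log P.η - Real.log lam) + Real.log P.N + 4 * P.η
        + 15 * P.η ^ 2 * (1 + (state P Ω ν (m + 1)).variation)
        - 1 / 12 * ∑ t ∈ range m, move P Ω ν t ^ 2 + 4 * Real.log P.N ^ 2 := by
  have ho := H.isOpt (m + 1)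
  have h1 := ho.objective_le Ω.nonempty H.card_le hlam hlη
  have h2 : 0 ≤ (P.α - 1 - (2 * Real.log P.N) ^ 2)
      * (lam / H.optRate (m + 1) - 1 - Real.log (lam / H.optRate (m + 1))) := by
    refine mul_nonneg ?_ ?_
    · nlinarith [(Gibbs.log_nat_cases P.N).1, sq_nonneg (Real.log P.N), H.le_alpha]
    · linarith [Real.log_le_sub_one_of_pos (div_pos hlam ho.pos)]
  have h3 : (P.α - 1) * Real.log lam + lam * optRegret P Ω ν (m + 1) v
      ≤ Gibbs.objective Ω.verts (P.α - 1) (optRegret P Ω ν (m + 1)) lam := by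
    rw [Gibbs.objective]
    refine add_le_add le_rfl ?_
    rw [Real.le_log_iff_exp_le (Gibbs.partition_pos Ω.nonempty _)]
    exact single_le_sum (f := fun v => Real.exp (lam * optRegret P Ω ν (m + 1) v))
      (fun u _ => (Real.exp_pos _).le) hv
  have h4 := H.potential_le hm h
  have h5 := H.potential_zero_le
  rw [potential] at h4
  have h6 := (abs_le.1 (H.abs_gain_le (m + 1) hv)).1
  have h7 := (abs_le.1 (Gibbs.abs_mean_le Ω.nonempty
    (w := fun v => H.optRate (m + 1) * optRegret P Ω ν (m + 1) v)
    (fun v hv => H.abs_gain_le (m + 1) hv))).2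
  have h8 : optRegret P Ω ν (m + 1) v
      = ∑ t ∈ range (m + 1), (ν t ⬝ᵥ v - ν t ⬝ᵥ action P Ω (state P Ω ν t))
        + gain P Ω ν (m + 1) v := by
    rw [optRegret]; simp only [gain_succ]
  rw [h8, mul_add] at h3
  have h9 : H.optRate (m + 1) * Gibbs.mean Ω.verts
      (fun v => H.optRate (m + 1) * optRegret P Ω ν (m + 1) v) (gain P Ω ν (m + 1)) ≤ 2 * P.η := by
    have := mul_le_mul_of_nonneg_left h7 ho.pos.le
    linarith [ho.le]
  have h10 : -(2 * P.η) ≤ lam * gain P Ω ν (m + 1) v := by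
    have := mul_le_mul_of_nonneg_left h6 hlam.le
    linarith
  linarith

/-- The regret against a vertex before a switch. -/
theorem eta_mul_regret_le (H : Admissible P Ω ν) {m : ℕ} (hm : m + 1 ≤ P.T)
    (h : ¬ (state P Ω ν m).switched) {v : Fin d → ℝ} (hv : v ∈ Ω.verts) :
    P.η * ∑ t ∈ range (m + 1), (ν t ⬝ᵥ v - ν t ⬝ᵥ action P Ω (state P Ω ν t))
      ≤ Real.log P.N + 4 * P.η
        + 15 * P.η ^ 2 * (1 + (state P Ω ν (m + 1)).variation)
        - 1 / 12 * ∑ t ∈ range m, move P Ω ν t ^ 2 + 4 * Real.log P.N ^ 2 := by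
  have := H.mul_regret_le hm h H.eta_pos le_rfl hv
  rwa [sub_self, mul_zero, zero_add] at this

/-- The movement of the distributions is controlled by the variation of the utilities. -/
theorem sum_sq_move_le (H : Admissible P Ω ν) {m : ℕ} (hm : m + 1 ≤ P.T)
    (h : ¬ (state P Ω ν m).switched) :
    1 / 12 * ∑ t ∈ range m, move P Ω ν t ^ 2
      ≤ (P.α - 1) * Real.log (m + 1) + Real.log P.N + 6 * P.η
        + 15 * P.η ^ 2 * (1 + (state P Ω ν (m + 1)).variation) + 4 * Real.log P.N ^ 2 := by
  obtain ⟨v, hv⟩ := Ω.nonempty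
  have hη := H.eta_pos
  have hm0 : (0 : ℝ) < m + 1 := by positivity
  -- This rate turns the lower bound -2(m + 1) on the regret into -2η, while the logarithmic term
  -- costs only (α - 1) log (m + 1).
  have h1 := H.mul_regret_le hm h (lam := P.η / (m + 1)) (by positivity)
    (div_le_self hη.le (by linarith [Nat.cast_nonneg (α := ℝ) m])) hv
  rw [Real.log_div hη.ne' hm0.ne', sub_sub_cancel] at h1
  have h2 : -(2 * ((m : ℝ) + 1))
      ≤ ∑ t ∈ range (m + 1), (ν t ⬝ᵥ v - ν t ⬝ᵥ action P Ω (state P Ω ν t)) := by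
    have : ∑ t ∈ range (m + 1), (-2 : ℝ)
        ≤ ∑ t ∈ range (m + 1), (ν t ⬝ᵥ v - ν t ⬝ᵥ action P Ω (state P Ω ν t)) :=
      sum_le_sum fun t _ => (abs_le.1 (H.abs_gain_le (t + 1) hv)).1
    rw [sum_const, card_range, nsmul_eq_mul] at this
    push_cast at this
    linarith
  have h3 : -(2 * P.η) ≤ P.η / (m + 1)
      * ∑ t ∈ range (m + 1), (ν t ⬝ᵥ v - ν t ⬝ᵥ action P Ω (state P Ω ν t)) := by
    have := mul_le_mul_of_nonneg_left h2 (by positivity : 0 ≤ P.η / (m + 1))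
    refine le_trans (le_of_eq ?_) this
    field_simp
  linarith

end Admissible
end KDLRC

namespace ZeroOnePolytope

variable {d : ℕ} (Ω : ZeroOnePolytope d)

/-- The regret is determined by the vertices. -/
theorem regret_le {ν x : ℕ → Fin d → ℝ} {T : ℕ} {B : ℝ}
    (h : ∀ v ∈ Ω.verts, ∑ t ∈ range T, (ν t ⬝ᵥ v - ν t ⬝ᵥ x t) ≤ B) : Ω.regret ν x T ≤ B := by
  rw [regret, sub_le_iff_le_add]
  refine csSup_le ((Ω.nonempty.to_set.convexHull).image _) ?_
  rintro _ ⟨z, hz, rfl⟩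
  have hconv : Convex ℝ {z : Fin d → ℝ | ∑ t ∈ range T, ν t ⬝ᵥ z
      ≤ B + ∑ t ∈ range T, ν t ⬝ᵥ x t} := by
    refine convex_halfSpace_le ⟨fun a b => ?_, fun c a => ?_⟩ _
    · simp only [dotProduct_add, sum_add_distrib]
    · simp only [dotProduct_smul, ← smul_sum]
  refine convexHull_min ?_ hconv hz
  intro v hv
  have := h v hv
  rw [sum_sub_distrib] at this
  change ∑ t ∈ range T, ν t ⬝ᵥ v ≤ B + ∑ t ∈ range T, ν t ⬝ᵥ x t
  linarith

end ZeroOnePolytope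

theorem Real.one_le_log_natCast {T : ℕ} (hT : 3 ≤ T) : 1 ≤ Real.log T := by
  rw [Real.le_log_iff_exp_le (by positivity)]
  have h1 := Real.exp_one_lt_d9
  have h2 : (3 : ℝ) ≤ T := by exact_mod_cast hT
  linarith

/-! ### Regret against arbitrary bounded utilities -/

namespace KDLRC

variable {d : ℕ} {P : KDLRCParams} {Ω : ZeroOnePolytope d} {ν : ℕ → Fin d → ℝ}

theorem action_mem_carrier (P : KDLRCParams) (Ω : ZeroOnePolytope d) (s : KDLRCState d) :
    action P Ω s ∈ Ω.carrier := by
  rw [action_eq]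
  exact (convex_convexHull ℝ _).sum_mem (fun v _ => dist_nonneg P Ω s v) (sum_dist P Ω s)
    fun v hv => subset_convexHull ℝ _ hv

namespace Admissible

theorem alpha_ge (H : Admissible P Ω ν) : 2 + 70 * Real.log P.N ^ 2 ≤ P.α := by
  have := H.le_alpha
  have := (Gibbs.log_nat_cases P.N).1
  linarith

theorem threshold_eq (P : KDLRCParams) (s : ℕ) : P.threshold s
    = P.L ^ 2 * (P.n : ℝ) ^ 2 * (144 * P.η + 48 * (P.α * Real.log s + Real.log P.N)) := by
  rw [KDLRCParams.threshold]; ring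

theorem threshold_mono (H : Admissible P Ω ν) {s t : ℕ} (hst : s ≤ t) :
    P.threshold s ≤ P.threshold t := by
  have hα := H.alpha_pos
  have hlog : Real.log s ≤ Real.log t := by
    rcases Nat.eq_zero_or_pos s with rfl | hs
    · simpa using Real.log_natCast_nonneg t
    · exact Real.log_le_log (by exact_mod_cast hs) (by exact_mod_cast hst)
  rw [threshold_eq, threshold_eq]
  have := mul_le_mul_of_nonneg_left hlog (by linarith : 0 ≤ P.α)
  exact mul_le_mul_of_nonneg_left (by linarith) (by positivity)

theorem threshold_nonneg (H : Admissible P Ω ν) (s : ℕ) : 0 ≤ P.threshold s := by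
  have hα := H.alpha_pos
  have := mul_nonneg (by linarith : 0 ≤ P.α) (Real.log_natCast_nonneg s)
  rw [threshold_eq]
  have := H.eta_pos
  have := (Gibbs.log_nat_cases P.N).1
  positivity

/-- Up to the round of the switch, the variation exceeds the threshold by at most the variation
of a single round. -/
theorem variation_le (H : Admissible P Ω ν) {m : ℕ} (h : ¬ (state P Ω ν m).switched) :
    (state P Ω ν (m + 1)).variation ≤ P.threshold m + 4 := by
  rcases m with _ | m
  · rw [variation_state, range_zero, sum_empty]
    linarith [H.threshold_nonneg 0]
  · rw [switched_succ, not_or, not_lt] at h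
    rw [variation_state, sum_range_succ, ← variation_state (P := P)]
    refine add_le_add h.2 ?_
    have h1 : Ω.utilityNorm (ν (m + 1) - ν m) ≤ 2 := Ω.utilityNorm_le fun v hv => by
      rw [sub_dotProduct]
      exact (abs_sub _ _).trans (by linarith [H.bounded (m + 1) v hv, H.bounded m v hv])
    nlinarith [Ω.utilityNorm_nonneg (ν (m + 1) - ν m)]

/-- Needed for N = 1, where the claimed bounds vanish with log N. -/
theorem gain_eq_zero (h1 : Ω.verts.card = 1) (t : ℕ) {v : Fin d → ℝ} (hv : v ∈ Ω.verts) :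
    gain P Ω ν (t + 1) v = 0 := by
  obtain ⟨u, hu⟩ := card_eq_one.1 h1
  rw [hu, mem_singleton] at hv
  subst hv
  have h2 := sum_dist P Ω (state P Ω ν t)
  rw [hu, sum_singleton] at h2
  rw [gain_succ, action_eq, hu, sum_singleton, h2, one_smul, sub_self]

/-- The regret up to the round of the switch. -/
theorem regret_before_switch (H : Admissible P Ω ν) {m : ℕ} (hm : m + 1 ≤ P.T)
    (h : ¬ (state P Ω ν m).switched) {v : Fin d → ℝ} (hv : v ∈ Ω.verts) :
    ∑ t ∈ range (m + 1), (ν t ⬝ᵥ v - ν t ⬝ᵥ action P Ω (state P Ω ν t))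
      ≤ (1400 + 125 * P.β) * ((1 + P.L * P.n) * Real.log P.N ^ 2 * Real.log P.T) := by
  have hL := H.L_pos
  have hβ := H.β_ge
  have hlogT := Real.one_le_log_natCast H.T_ge
  rcases Nat.lt_or_ge P.N 2 with hN | hN
  · have hc : Ω.verts.card = 1 := by
      have := H.card_le
      have := Ω.nonempty.card_pos
      omega
    have h0 : ∑ t ∈ range (m + 1), (ν t ⬝ᵥ v - ν t ⬝ᵥ action P Ω (state P Ω ν t)) = 0 :=
      sum_eq_zero fun t _ => gain_eq_zero (P := P) (ν := ν) hc t hv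
    rw [h0]
    positivity
  have hℓ : 693 / 1000 ≤ Real.log P.N := by
    have h1 : Real.log 2 ≤ Real.log P.N := Real.log_le_log (by norm_num) (by exact_mod_cast hN)
    linarith [Real.log_two_gt_d9]
  have hη := H.eta_pos
  have hη' := H.eta_le
  have h1 := H.eta_mul_regret_le hm h hv
  have h2 : (state P Ω ν (m + 1)).variation ≤ P.threshold P.T + 4 :=
    (H.variation_le h).trans (by linarith [H.threshold_mono (by omega : m ≤ P.T)])
  have h3 : 0 ≤ ∑ t ∈ range m, move P Ω ν t ^ 2 := sum_nonneg fun _ _ => sq_nonneg _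
  have hα : 0 ≤ P.α * Real.log P.T := mul_nonneg (by linarith [H.alpha_pos]) (by linarith)
  set reg := ∑ t ∈ range (m + 1), (ν t ⬝ᵥ v - ν t ⬝ᵥ action P Ω (state P Ω ν t))
  set ℓ := Real.log P.N with hℓdef
  have h4 : P.η ^ 2 * P.threshold P.T ≤ 1 / 288 * (144 * P.η + 48 * (P.α * Real.log P.T + ℓ)) := by
    rw [threshold_eq, ← mul_assoc]
    exact mul_le_mul_of_nonneg_right H.sq_eta_mul_le (by positivity)
  have h5 : P.η ^ 2 ≤ 1 / 2500 := by nlinarith only [hη, hη']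
  have h6 : P.η ^ 2 * (1 + (state P Ω ν (m + 1)).variation)
      ≤ P.η ^ 2 * P.threshold P.T + 5 * P.η ^ 2 := by
    have := mul_le_mul_of_nonneg_left h2 (sq_nonneg P.η)
    linarith
  -- The coefficient 5/2 is 15 · 48 / 288: the factor L² n² of the threshold is cancelled by η².
  have h7 : P.η * reg ≤ 7 / 2 * ℓ + 4 * ℓ ^ 2 + 3 / 10 + 5 / 2 * (P.α * Real.log P.T) := by
    linarith
  have hℓ2 : 1 ≤ 21 / 10 * ℓ ^ 2 := by nlinarith
  have hℓ3 : ℓ ≤ 3 / 2 * ℓ ^ 2 := by nlinarith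
  have h8 : P.α ≤ (36 / 5 + P.β) * ℓ ^ 2 := by
    rw [KDLRCParams.α]
    linarith
  have h9 : P.η * reg ≤ (28 + 5 / 2 * P.β) * (ℓ ^ 2 * Real.log P.T) := by
    have e1 := mul_le_mul_of_nonneg_right h8 (by linarith : 0 ≤ Real.log P.T)
    have e2 : ℓ ^ 2 ≤ ℓ ^ 2 * Real.log P.T := le_mul_of_one_le_right (sq_nonneg ℓ) hlogT
    linarith
  have h10 : reg = 1 / P.η * (P.η * reg) := by field_simp
  have h11 : 0 ≤ (28 + 5 / 2 * P.β) * (ℓ ^ 2 * Real.log P.T) := by positivity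
  rw [h10]
  calc 1 / P.η * (P.η * reg)
      ≤ 1 / P.η * ((28 + 5 / 2 * P.β) * (ℓ ^ 2 * Real.log P.T)) :=
        mul_le_mul_of_nonneg_left h9 (by positivity)
    _ ≤ 50 * (1 + P.L * P.n) * ((28 + 5 / 2 * P.β) * (ℓ ^ 2 * Real.log P.T)) :=
        mul_le_mul_of_nonneg_right H.inv_eta_le h11
    _ = _ := by ring

/-! ### Multiplicative weights after the switch -/

theorem switched_add (m k : ℕ) (h : (state P Ω ν m).switched) :
    (state P Ω ν (m + k)).switched := by
  by_contra h'
  exact not_switched_of_le (Nat.le_add_right m k) h' h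

theorem fallbackUtil_add {m : ℕ} (h : ¬ (state P Ω ν m).switched)
    (h' : (state P Ω ν (m + 1)).switched) (k : ℕ) :
    (state P Ω ν (m + 1 + k)).fallbackUtil = ∑ j ∈ range k, ν (m + 1 + j) := by
  induction k with
  | zero =>
    rw [add_zero, state, next]
    -- The utility of the round that triggers the switch is discarded, so the sum starts at m + 1.
    simp only [if_neg h, range_zero, sum_empty]
  | succ k ih =>
    rw [← add_assoc, state, next]
    simp only [if_pos (switched_add _ k h'), ih, sum_range_succ]

/-- The regret after the switch. -/
theorem regret_after_switch (H : Admissible P Ω ν) {m k : ℕ} (hmk : m + 1 + k ≤ P.T)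
    (h : ¬ (state P Ω ν m).switched) (h' : (state P Ω ν (m + 1)).switched)
    {v : Fin d → ℝ} (hv : v ∈ Ω.verts) :
    ∑ j ∈ range k, (ν (m + 1 + j) ⬝ᵥ v
        - ν (m + 1 + j) ⬝ᵥ action P Ω (state P Ω ν (m + 1 + j)))
      ≤ 2 * √(P.T * Real.log P.N) := by
  rcases Nat.lt_or_ge P.N 2 with hN | hN
  · have hc : Ω.verts.card = 1 := by
      have := H.card_le
      have := Ω.nonempty.card_pos
      omega
    have h0 : ∑ j ∈ range k, (ν (m + 1 + j) ⬝ᵥ v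
        - ν (m + 1 + j) ⬝ᵥ action P Ω (state P Ω ν (m + 1 + j))) = 0 :=
      sum_eq_zero fun j _ => gain_eq_zero (P := P) (ν := ν) hc (m + 1 + j) hv
    rw [h0]
    positivity
  have hℓ : 0 < Real.log P.N := Real.log_pos (by exact_mod_cast hN)
  have hT : (3 : ℝ) ≤ P.T := by exact_mod_cast H.T_ge
  have hkT : (k : ℝ) ≤ P.T := by exact_mod_cast (by omega : k ≤ P.T)
  -- For T ≤ log N the trivial bound 2T suffices. Otherwise the rate is at most 1, as required by
  -- exp x ≤ 1 + x + x² below.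
  rcases le_or_gt (P.T : ℝ) (Real.log P.N) with hTℓ | hTℓ
  · have h1 : ∑ j ∈ range k, (ν (m + 1 + j) ⬝ᵥ v
        - ν (m + 1 + j) ⬝ᵥ action P Ω (state P Ω ν (m + 1 + j))) ≤ ∑ j ∈ range k, (2 : ℝ) :=
      sum_le_sum fun j _ => (abs_le.1 (H.abs_gain_le (m + 1 + j + 1) hv)).2
    rw [sum_const, card_range, nsmul_eq_mul] at h1
    have h2 : (P.T : ℝ) ≤ √(P.T * Real.log P.N) := by
      refine Real.le_sqrt_of_sq_le ?_
      nlinarith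
    linarith
  set r := P.fallbackRate with hr
  have hr0 : 0 < r := Real.sqrt_pos.2 (by positivity)
  have hr1 : r ≤ 1 := by
    rw [hr, KDLRCParams.fallbackRate, Real.sqrt_le_left zero_le_one, one_pow]
    exact (div_le_one (by linarith)).2 hTℓ.le
  have hr2 : r ^ 2 * P.T = Real.log P.N := by
    rw [hr, KDLRCParams.fallbackRate, Real.sq_sqrt (by positivity)]
    field_simp
  set U : ℕ → Fin d → ℝ := fun k => ∑ j ∈ range k, ν (m + 1 + j) with hU
  -- The usual potential argument: the log-partition function grows per round by at most r times the
  -- utility obtained plus r².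
  have key : ∀ k : ℕ, Real.log (Gibbs.partition Ω.verts fun v => r * (U k ⬝ᵥ v))
      ≤ Real.log Ω.verts.card
        + ∑ j ∈ range k, (r * (ν (m + 1 + j) ⬝ᵥ action P Ω (state P Ω ν (m + 1 + j))) + r ^ 2) := by
    intro k
    induction k with
    | zero => simp [hU, Gibbs.partition]
    | succ k ih =>
      rw [sum_range_succ, ← add_assoc]
      have hsw := switched_add (m + 1) k h'
      have hact : ν (m + 1 + k) ⬝ᵥ action P Ω (state P Ω ν (m + 1 + k))
          = Gibbs.mean Ω.verts (fun v => r * (U k ⬝ᵥ v)) (fun v => ν (m + 1 + k) ⬝ᵥ v) := by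
        rw [dotProduct_action, rate_eq, rateProgram, if_pos hsw, mu, if_pos hsw,
          fallbackUtil_add h h']
        rfl
      have hp := Gibbs.partition_pos Ω.nonempty fun v => r * (U k ⬝ᵥ v)
      set M := Gibbs.mean Ω.verts (fun v => r * (U k ⬝ᵥ v)) (fun v => ν (m + 1 + k) ⬝ᵥ v) with hM
      have hstep : Gibbs.partition Ω.verts (fun v => r * (U (k + 1) ⬝ᵥ v))
          ≤ Gibbs.partition Ω.verts (fun v => r * (U k ⬝ᵥ v)) * (1 + r * M + r ^ 2) := by
        have e1 : Gibbs.partition Ω.verts (fun v => r * (U (k + 1) ⬝ᵥ v))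
            = Gibbs.partition Ω.verts (fun v => r * (U k ⬝ᵥ v))
              * Gibbs.mean Ω.verts (fun v => r * (U k ⬝ᵥ v))
                (fun v => Real.exp (r * (ν (m + 1 + k) ⬝ᵥ v))) := by
          rw [Gibbs.mean, mul_sum]
          refine sum_congr rfl fun v _ => ?_
          have e2 : U (k + 1) = U k + ν (m + 1 + k) := by simp only [hU, sum_range_succ]
          simp only [e2, add_dotProduct, mul_add, Real.exp_add, Gibbs.weight]
          field_simp
        rw [e1]
        refine mul_le_mul_of_nonneg_left ?_ hp.le
        have e3 : 1 + r * M + r ^ 2 = Gibbs.mean Ω.verts (fun v => r * (U k ⬝ᵥ v))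
            (fun v => (1 + r * (ν (m + 1 + k) ⬝ᵥ v)) + r ^ 2) := by
          rw [Gibbs.mean_add, Gibbs.mean_add, Gibbs.mean_const_mul, Gibbs.mean_const Ω.nonempty,
            Gibbs.mean_const Ω.nonempty]
        rw [e3]
        refine Gibbs.mean_mono Ω.nonempty fun v hv => ?_
        have e4 : |r * (ν (m + 1 + k) ⬝ᵥ v)| ≤ r := by
          rw [abs_mul, abs_of_pos hr0]
          exact mul_le_of_le_one_right hr0.le (H.bounded _ v hv)
        have e5 := (abs_le.1 (Real.abs_exp_sub_one_sub_id_le (e4.trans hr1))).2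
        have e6 : (r * (ν (m + 1 + k) ⬝ᵥ v)) ^ 2 ≤ r ^ 2 := by
          rw [← sq_abs]; exact pow_le_pow_left₀ (abs_nonneg _) e4 2
        linarith
      rw [hact]
      have hpos : 0 < 1 + r * M + r ^ 2 := by
        have := (Gibbs.partition_pos Ω.nonempty fun v => r * (U (k + 1) ⬝ᵥ v)).trans_le hstep
        exact (mul_pos_iff_of_pos_left hp).1 this
      have h1 := Real.log_le_log (Gibbs.partition_pos Ω.nonempty _) hstep
      rw [Real.log_mul hp.ne' hpos.ne'] at h1
      have h2 := Real.log_le_sub_one_of_pos hpos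
      linarith
  have h1 := key k
  have h2 : r * (U k ⬝ᵥ v) ≤ Real.log (Gibbs.partition Ω.verts fun v => r * (U k ⬝ᵥ v)) := by
    rw [Real.le_log_iff_exp_le (Gibbs.partition_pos Ω.nonempty _)]
    exact single_le_sum (f := fun v => Real.exp (r * (U k ⬝ᵥ v)))
      (fun u _ => (Real.exp_pos _).le) hv
  have h3 : Real.log Ω.verts.card ≤ Real.log P.N :=
    Real.log_le_log (by exact_mod_cast Ω.nonempty.card_pos) (by exact_mod_cast H.card_le)
  have h4 : U k ⬝ᵥ v = ∑ j ∈ range k, ν (m + 1 + j) ⬝ᵥ v := by rw [hU, sum_dotProduct]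
  rw [sum_add_distrib, ← mul_sum, sum_const, card_range, nsmul_eq_mul] at h1
  rw [sum_sub_distrib, ← h4]
  have h5 : (k : ℝ) * r ^ 2 ≤ Real.log P.N := by
    rw [← hr2, mul_comm]
    exact mul_le_mul_of_nonneg_left hkT (sq_nonneg r)
  have h6 : √(P.T * Real.log P.N) = r * P.T := by
    rw [← hr2, show (P.T : ℝ) * (r ^ 2 * P.T) = (r * P.T) ^ 2 by ring,
      Real.sqrt_sq (by positivity)]
  rw [h6]
  refine le_of_mul_le_mul_left ?_ hr0
  nlinarith

/-- The regret against arbitrary bounded utilities. -/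
theorem regret_le (H : Admissible P Ω ν) :
    Ω.regret ν (fun t => action P Ω (state P Ω ν t)) P.T
      ≤ (1400 + 125 * P.β) * (√(P.T * Real.log P.N)
        + (1 + P.L * P.n) * Real.log P.N ^ 2 * Real.log P.T) := by
  have hβ := H.β_ge
  have hT := H.T_ge
  refine Ω.regret_le fun v hv => ?_
  have hsq : 0 ≤ √(P.T * Real.log P.N) := Real.sqrt_nonneg _
  -- A switch recorded only in the state T changes none of the actions played, so the last relevant
  -- state is T - 1.
  by_cases hs : (state P Ω ν (P.T - 1)).switched
  · obtain ⟨m, hm, hm1, hm2⟩ : ∃ m, m + 1 ≤ P.T - 1 ∧ ¬ (state P Ω ν m).switched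
        ∧ (state P Ω ν (m + 1)).switched := by
      classical
      have hex : ∃ t, (state P Ω ν t).switched := ⟨_, hs⟩
      have h0 : Nat.find hex ≠ 0 := fun h0 => by
        have := Nat.find_spec hex
        rw [h0] at this
        exact this
      obtain ⟨m, hm⟩ := Nat.exists_eq_succ_of_ne_zero h0
      refine ⟨m, ?_, Nat.find_min hex (by omega), ?_⟩
      · rw [← Nat.succ_eq_add_one, ← hm]; exact Nat.find_min' hex hs
      · rw [← Nat.succ_eq_add_one, ← hm]; exact Nat.find_spec hex
    have h1 := H.regret_before_switch (by omega) hm1 hv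
    have h2 := H.regret_after_switch (k := P.T - (m + 1)) (by omega) hm1 hm2 hv
    have h3 : ∑ t ∈ range P.T, (ν t ⬝ᵥ v - ν t ⬝ᵥ action P Ω (state P Ω ν t))
        = ∑ t ∈ range (m + 1 + (P.T - (m + 1))),
          (ν t ⬝ᵥ v - ν t ⬝ᵥ action P Ω (state P Ω ν t)) := by
      congr 2; omega
    rw [h3, sum_range_add]
    nlinarith
  · have h1 := H.regret_before_switch (by omega) hs hv
    rw [Nat.sub_add_cancel (by omega)] at h1
    nlinarith

end Admissible
end KDLRC

/-! ### Self-play in polyhedral games -/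

namespace PolyhedralGame

variable {n : ℕ} (G : PolyhedralGame n)

theorem gradient_dotProduct (i : Fin n) (x : (j : Fin n) → Fin (G.dim j) → ℝ)
    (v : Fin (G.dim i) → ℝ) :
    G.gradient i x ⬝ᵥ v = G.utility i (Function.update x i v) := by
  have h := LinearMap.pi_apply_eq_sum_univ ((G.utility i).toLinearMap x i) v
  rw [MultilinearMap.toLinearMap_apply] at h
  rw [h, dotProduct]
  refine sum_congr rfl fun k _ => ?_
  rw [gradient, smul_eq_mul, mul_comm, MultilinearMap.toLinearMap_apply]
  congr 3
  funext j
  simp [Pi.single_apply, eq_comm]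

variable (P : KDLRCParams)

/-- Each player's view of self-play is a run against a fixed sequence of utilities, so the
single-player estimates apply verbatim. -/
theorem selfPlayState_eq (t : ℕ) (i : Fin n) :
    G.selfPlayState P t i = KDLRC.state P (G.Ω i) (G.selfPlayUtility P i) t := by
  induction t with
  | zero => rfl
  | succ t ih => rw [KDLRC.state, ← ih]; rfl

theorem selfPlayAction_eq (i : Fin n) (t : ℕ) :
    G.selfPlayAction P i t
      = KDLRC.action P (G.Ω i) (KDLRC.state P (G.Ω i) (G.selfPlayUtility P i) t) := by
  rw [selfPlayAction, selfPlayState_eq]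

variable {G P}

/-- The utilities of all profiles of strategies lie in `[-1, 1]`. -/
theorem Bounded.abs_utility_le (hG : G.Bounded) (i : Fin n)
    {x : (j : Fin n) → Fin (G.dim j) → ℝ} (hx : ∀ j, x j ∈ (G.Ω j).carrier) :
    |G.utility i x| ≤ 1 := by
  -- Vertices are relaxed to points of the polytopes one player at a time; in each coordinate the
  -- utility is linear, so the bound passes to the convex hull.
  have key : ∀ S : Finset (Fin n), ∀ x : (j : Fin n) → Fin (G.dim j) → ℝ,
      (∀ j ∈ S, x j ∈ (G.Ω j).carrier) → (∀ j ∉ S, x j ∈ (G.Ω j).verts) →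
      |G.utility i x| ≤ 1 := by
    intro S
    induction S using Finset.induction_on with
    | empty => exact fun x _ h => hG x (fun j => h j (notMem_empty j)) i
    | insert k S hk ih =>
      intro x h1 h2
      have hconv : Convex ℝ {z | (G.utility i).toLinearMap x k z ∈ Set.Icc (-1 : ℝ) 1} :=
        (convex_Icc (-1 : ℝ) 1).linear_preimage _
      have hsub : ((G.Ω k).verts : Set (Fin (G.dim k) → ℝ))
          ⊆ {z | (G.utility i).toLinearMap x k z ∈ Set.Icc (-1 : ℝ) 1} := by
        intro z hz
        change (G.utility i).toLinearMap x k z ∈ Set.Icc (-1 : ℝ) 1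
        rw [MultilinearMap.toLinearMap_apply]
        refine abs_le.1 (ih _ (fun j hj => ?_) fun j hj => ?_)
        · have hjk : j ≠ k := fun h => hk (h ▸ hj)
          rw [Function.update_of_ne hjk]
          exact h1 j (mem_insert_of_mem hj)
        · by_cases hjk : j = k
          · subst hjk
            rw [Function.update_self]
            exact hz
          · rw [Function.update_of_ne hjk]
            exact h2 j fun h => (mem_insert.1 h).elim hjk hj
      have hmem := convexHull_min hsub hconv (h1 k (mem_insert_self k S))
      change (G.utility i).toLinearMap x k (x k) ∈ Set.Icc (-1 : ℝ) 1 at hmem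
      rw [MultilinearMap.toLinearMap_apply, Function.update_eq_self] at hmem
      exact abs_le.2 hmem
  exact key univ x (fun j _ => hx j) fun j hj => absurd (mem_univ j) hj

theorem Bounded.abs_selfPlayUtility_le (hG : G.Bounded) (i : Fin n) (t : ℕ) {v : Fin (G.dim i) → ℝ}
    (hv : v ∈ (G.Ω i).verts) : |G.selfPlayUtility P i t ⬝ᵥ v| ≤ 1 := by
  rw [selfPlayUtility, gradient_dotProduct]
  refine hG.abs_utility_le i fun j => ?_
  by_cases hj : j = i
  · subst hj
    rw [Function.update_self]
    exact subset_convexHull ℝ _ hv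
  · rw [Function.update_of_ne hj]
    exact KDLRC.action_mem_carrier _ _ _

theorem Bounded.admissible (hG : G.Bounded) (hn : 1 ≤ P.n) (hL : 0 < P.L) (hβ : 70 ≤ P.β)
    (hT : 3 ≤ P.T) (hM : 50 * Real.log (Real.log P.T) ≤ P.M)
    (hN : ∀ i, (G.Ω i).verts.card ≤ P.N) (i : Fin n) :
    KDLRC.Admissible P (G.Ω i) (G.selfPlayUtility P i) :=
  ⟨hn, hL, hβ, hT, hM, hN i, fun t _ hv => hG.abs_selfPlayUtility_le i t hv⟩

/-- In self-play, the utilities vary at most as the distributions on the vertices move. -/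
theorem Smooth.utilityNorm_le (hS : G.Smooth P.L) (i : Fin n) (t : ℕ) :
    (G.Ω i).utilityNorm (G.selfPlayUtility P i (t + 1) - G.selfPlayUtility P i t)
      ≤ P.L * ∑ j, KDLRC.move P (G.Ω j) (G.selfPlayUtility P j) t := by
  have hmean : ∀ s, (fun j => G.selfPlayAction P j s)
      = G.mean fun j => KDLRC.dist P (G.Ω j) (KDLRC.state P (G.Ω j) (G.selfPlayUtility P j) s) := by
    intro s
    funext j
    rw [selfPlayAction_eq, KDLRC.action_eq, mean]
  have hmixed : ∀ s, G.IsMixed fun j =>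
      KDLRC.dist P (G.Ω j) (KDLRC.state P (G.Ω j) (G.selfPlayUtility P j) s) := fun s j =>
    ⟨fun v _ => KDLRC.dist_nonneg _ _ _ v, KDLRC.sum_dist _ _ _⟩
  refine (G.Ω i).utilityNorm_le fun v hv => ?_
  have h := hS _ _ (hmixed (t + 1)) (hmixed t) i v hv
  rw [← hmean, ← hmean] at h
  rw [sub_dotProduct]
  exact h

/-- In self-play, no player switches. -/
theorem not_switched_selfPlay (hG : G.Bounded) (hS : G.Smooth P.L) (hnn : P.n = n) (hn : 1 ≤ P.n)
    (hL : 0 < P.L) (hβ : 70 ≤ P.β) (hT : 3 ≤ P.T) (hM : 50 * Real.log (Real.log P.T) ≤ P.M)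
    (hN : ∀ i, (G.Ω i).verts.card ≤ P.N) {t : ℕ} (ht : t ≤ P.T) (i : Fin n) :
    ¬ (KDLRC.state P (G.Ω i) (G.selfPlayUtility P i) t).switched := by
  have H := hG.admissible hn hL hβ hT hM hN
  have hnR : (P.n : ℝ) = n := by rw [hnn]
  induction t generalizing i with
  | zero => exact fun h => h
  | succ m ih =>
    have hm := ih (by omega)
    rw [KDLRC.switched_succ, not_or, not_lt]
    refine ⟨hm i, ?_⟩
    have hα := (H i).alpha_ge
    have hα1 := (H i).alpha_pos
    have hη := (H i).eta_pos
    have hη' := (H i).eta_le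
    have hsq := (H i).sq_eta_mul_le
    obtain ⟨hℓ0, hℓ1⟩ := Gibbs.log_nat_cases P.N
    rcases Nat.eq_zero_or_pos m with rfl | hm0
    · rw [KDLRC.variation_state, range_zero, sum_empty]
      exact (H i).threshold_nonneg _
    set S : Fin n → ℝ := fun j => ∑ t ∈ range m, KDLRC.move P (G.Ω j) (G.selfPlayUtility P j) t ^ 2
      with hSdef
    set W : Fin n → ℝ := fun j =>
      (KDLRC.state P (G.Ω j) (G.selfPlayUtility P j) (m + 1)).variation with hWdef
    -- Smoothness bounds one round's variation by L times the sum of the n movements, and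
    -- Cauchy–Schwarz adds the factor n.
    have hW : ∀ j, W j ≤ P.L ^ 2 * P.n * ∑ j, S j := by
      intro j
      simp only [hWdef, hSdef]
      rw [KDLRC.variation_state, sum_comm, mul_sum]
      refine sum_le_sum fun t _ => ?_
      have h1 := pow_le_pow_left₀ ((G.Ω j).utilityNorm_nonneg _) (hS.utilityNorm_le j t) 2
      have h2 := sq_sum_le_card_mul_sum_sq (s := (univ : Finset (Fin n)))
        (f := fun j => KDLRC.move P (G.Ω j) (G.selfPlayUtility P j) t)
      rw [card_univ, Fintype.card_fin] at h2
      rw [mul_pow] at h1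
      refine h1.trans ?_
      rw [mul_assoc, hnR]
      exact mul_le_mul_of_nonneg_left h2 (sq_nonneg _)
    set K := (P.α - 1) * Real.log (m + 1) + Real.log P.N + 6 * P.η + 15 * P.η ^ 2
      + 4 * Real.log P.N ^ 2 with hK
    have h1 : 1 / 12 * ∑ j, S j ≤ P.n * K + 15 * P.η ^ 2 * ∑ j, W j := by
      have h2 : ∑ j, (1 / 12 * S j) ≤ ∑ j : Fin n, (K + 15 * P.η ^ 2 * W j) := by
        refine sum_le_sum fun j _ => ?_
        have := (H j).sum_sq_move_le ht (hm j)
        simp only [hSdef, hWdef, hK]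
        linarith
      rw [← mul_sum, sum_add_distrib, ← mul_sum, sum_const, card_univ, Fintype.card_fin,
        nsmul_eq_mul] at h2
      rw [hnR]
      exact h2
    have h2 : ∑ j, W j ≤ P.n * (P.L ^ 2 * P.n * ∑ j, S j) := by
      have := sum_le_sum fun j (_ : j ∈ (univ : Finset (Fin n))) => hW j
      rw [sum_const, card_univ, Fintype.card_fin, nsmul_eq_mul] at this
      rw [hnR] at this ⊢
      exact this
    have hS0 : 0 ≤ ∑ j, S j := sum_nonneg fun j _ => sum_nonneg fun t _ => sq_nonneg _
    have h3 : 15 * P.η ^ 2 * ∑ j, W j ≤ 15 / 288 * ∑ j, S j := by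
      calc 15 * P.η ^ 2 * ∑ j, W j ≤ 15 * P.η ^ 2 * (P.n * (P.L ^ 2 * P.n * ∑ j, S j)) :=
            mul_le_mul_of_nonneg_left h2 (by positivity)
        _ = 15 * (P.η ^ 2 * (P.L ^ 2 * (P.n : ℝ) ^ 2)) * ∑ j, S j := by ring
        _ ≤ 15 * (1 / 288) * ∑ j, S j :=
            mul_le_mul_of_nonneg_right (mul_le_mul_of_nonneg_left hsq (by norm_num)) hS0
        _ = _ := by ring
    -- Self-bounding: 1/12 - 15/288 = 1/32 of the movement remains on the left.
    have h4 : ∑ j, S j ≤ 32 * (P.n * K) := by linarith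
    have hlog : 69 / 100 ≤ Real.log (m + 1) := by
      have e : Real.log 2 ≤ Real.log (m + 1) := by
        refine Real.log_le_log two_pos ?_
        have : (1 : ℝ) ≤ m := by exact_mod_cast hm0
        linarith
      linarith [Real.log_two_gt_d9]
    -- The excess of 48 over 32 absorbs the lower order terms, because α ≥ 2 + 70 log² N and log (m
    -- + 1) ≥ log 2.
    have h5 : 32 * K ≤ 144 * P.η + 48 * (P.α * Real.log ((m + 1 : ℕ) : ℝ) + Real.log P.N) := by
      push_cast
      have e1 : (2 + 70 * Real.log P.N ^ 2) * (69 / 100) ≤ P.α * Real.log (m + 1) :=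
        mul_le_mul hα hlog (by norm_num) (by linarith)
      have e2 : P.η ^ 2 ≤ 1 / 2500 := by nlinarith only [hη, hη']
      have e3 := sq_nonneg (Real.log P.N)
      rw [hK]
      linarith
    refine (hW i).trans ?_
    rw [KDLRC.Admissible.threshold_eq]
    calc P.L ^ 2 * P.n * ∑ j, S j ≤ P.L ^ 2 * P.n * (32 * (P.n * K)) :=
          mul_le_mul_of_nonneg_left h4 (by positivity)
      _ = P.L ^ 2 * (P.n : ℝ) ^ 2 * (32 * K) := by ring
      _ ≤ _ := mul_le_mul_of_nonneg_left h5 (by positivity)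

end PolyhedralGame

/-! ### The theorem -/

theorem mainTheorem11 (β : ℝ) (hβ : 70 ≤ β) :
    ∃ C : ℝ, 0 < C ∧
      ∀ (n : ℕ) (L : ℝ) (N T M : ℕ), 1 ≤ n → 0 < L → 3 ≤ T →
        C * Real.log (Real.log T) ≤ M →
        let P : KDLRCParams := { n := n, L := L, N := N, β := β, T := T, M := M }
        -- self-play
        (∀ G : PolyhedralGame n, G.Bounded → G.Smooth L → (∀ i, (G.Ω i).verts.card ≤ N) →
          ∀ i : Fin n,
            (∀ t < T,
              ¬ (G.selfPlayState P t i).switched ∧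
              KDLRC.StepCost P (G.Ω i) (G.selfPlayState P t i) (C * Real.log (Real.log T)) ∧
              KDLRC.StepCorrect P (G.Ω i) (G.selfPlayState P t i)) ∧
            (G.Ω i).regret (G.selfPlayUtility P i) (G.selfPlayAction P i) T
              ≤ C * (1 + L * n) * Real.log N ^ 2 * Real.log T) ∧
        -- adversarial utilities
        (∀ (d : ℕ) (Ω : ZeroOnePolytope d) (ν : ℕ → Fin d → ℝ), Ω.verts.card ≤ N →
          (∀ t, ∀ v ∈ Ω.verts, |ν t ⬝ᵥ v| ≤ 1) →
            (∀ t < T,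
              KDLRC.StepCost P Ω (KDLRC.state P Ω ν t) (C * Real.log (Real.log T)) ∧
              (¬ (KDLRC.state P Ω ν t).switched →
                KDLRC.StepCorrect P Ω (KDLRC.state P Ω ν t))) ∧
            Ω.regret ν (fun t => KDLRC.action P Ω (KDLRC.state P Ω ν t)) T
              ≤ C * (√(T * Real.log N) + (1 + L * n) * Real.log N ^ 2 * Real.log T)) := by
  -- The regret constant, 50 · (28 + 5β/2) from 1/η ≤ 50 (1 + L n); it also exceeds the 50 needed
  -- for the Newton passes, so the cap M is large enough.
  refine ⟨1400 + 125 * β, by linarith, fun n L N T M hn hL hT hM => ?_⟩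
  have hlog : 0 ≤ Real.log (Real.log T) := Real.log_nonneg (Real.one_le_log_natCast hT)
  have hC : 50 * Real.log (Real.log T) ≤ (1400 + 125 * β) * Real.log (Real.log T) :=
    mul_le_mul_of_nonneg_right (by linarith) hlog
  have hM' := hC.trans hM
  intro P
  have hcost : ∀ {d : ℕ} {Ω : ZeroOnePolytope d} {ν : ℕ → Fin d → ℝ},
      KDLRC.Admissible P Ω ν → ∀ t, KDLRC.StepCost P Ω (KDLRC.state P Ω ν t)
        ((1400 + 125 * β) * Real.log (Real.log T)) := by
    intro d Ω ν H t
    obtain ⟨k, hk, h⟩ := H.stepCost t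
    exact ⟨k, hk.trans hC, h⟩
  refine ⟨fun G hG hS hN i => ?_, fun d Ω ν hN hν => ?_⟩
  · have H := hG.admissible (P := P) hn hL hβ hT hM' hN i
    have hns : ∀ t ≤ T, ¬ (KDLRC.state P (G.Ω i) (G.selfPlayUtility P i) t).switched := fun t ht =>
      PolyhedralGame.not_switched_selfPlay (P := P) hG hS rfl hn hL hβ hT hM' hN ht i
    refine ⟨fun t ht => ?_, ?_⟩
    · rw [PolyhedralGame.selfPlayState_eq]
      exact ⟨hns t ht.le, hcost H t, H.stepCorrect (hns t ht.le)⟩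
    · refine (G.Ω i).regret_le fun v hv => ?_
      obtain ⟨m, rfl⟩ : ∃ m, T = m + 1 := ⟨T - 1, by omega⟩
      have h := H.regret_before_switch le_rfl (hns m (Nat.le_succ m)) hv
      simp only [PolyhedralGame.selfPlayAction_eq]
      refine h.trans_eq ?_
      simp only [P]
      ring
  · have H : KDLRC.Admissible P Ω ν := ⟨hn, hL, hβ, hT, hM', hN, hν⟩
    exact ⟨fun t _ => ⟨hcost H t, H.stepCorrect⟩, H.regret_le⟩
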